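/- Write $\pi(x,\omega)g(t)=e^{2\pi i\omega\cdot t}g(t-x)$, let $\langle f,g\rangle$ be the pairing of $f\in\mathcal S'$ with $g\in\mathcal S$, conjugate-linear in $g$, and let $V_gf(x,\omega)=\langle f,\pi(x,\omega)g\rangle$. For $\tau\in[0,1]$ and $f,g\in\mathcal S(\mathbb R^d)$ put $$W_\tau(f,g)(x,\omega)=\int_{\mathbb R^d}e^{-2\pi i y\cdot\omega}f(x+\tau y)\overline{g(x-(1-\tau)y)}\,dy ,$$ and for $\sigma\in\mathcal S'(\mathbb R^{2d})$ define $\mathrm{Op}_\tau(\sigma):\mathcal S(\mathbb R^d)\to\mathcal S'(\mathbb R^d)$ by $\langle \mathrm{Op}_\tau(\sigma)f,g\rangle=\langle\sigma,W_\tau(g,f)\rangle$. Let $v\ge 0$ be a continuous function on $\mathbb R^{2d}$ with $v(0)=1$, even in each coordinate, with $v(w+z)\le v(w)v(z)$ and $\lim_{n\to\infty}v(nz)^{1/n}=1$ for all $w,z$. Let $m_1,m_2>0$ be functions on $\mathbb R^d$ such that $m(x,\omega)=m_1(x)m_2(\omega)$ is $v$-moderate, i.e. $m(z_1+z_2)\le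 C\,v(z_1)m(z_2)$ for some constant $C$ and all $z_1,z_2\in\mathbb R^{2d}$, and such that either $m\ge1$ everywhere or $m(z)\ge c(1+|z|^2)^{-N/2}$ for all $z$, for some $c>0$, $N\in\mathbb N$. Fix a window $\varphi\in\mathcal S(\mathbb R^d)\setminus\{0\}$ with $\int_{\mathbb R^{2d}}|V_\varphi\varphi(x,\omega)|\,v(-\omega,x)\,dx\,d\omega<\infty$ (automatic if $v$ has polynomial growth) and a window $\Phi\in\mathcal S(\mathbb R^{2d})\setminus\{0\}$. For $1\le p,q\le\infty$ let $W(\mathcal FL^p_{m_1},L^q_{m_2})$ be the space of $f\in\mathcal S'(\mathbb R^d)$ with $$\|f\|_{W(\mathcal FL^p_{m_1},L^q_{m_2})}=\Big(\int_{\mathbb R^d}\Big(\int_{\mathbb R^d}|V_\varphi f(x,\omega)|^p m_1(\omega)^p\,d\omega\Big)^{q/p}m_2(x)^q\,dx\Big)^{1/q}<\infty$$ (with the usual modifications if $p=\infty$ or $q=\infty$), and let $M^{\infty,1}_{1\otimes v}(\mathbb R^{2d})$ be the space of $\sigma\in\mathcal S'(\mathbb R^{2d})$ with $\|\sigma\|_{M^{\infty,1}_{1\otimes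 v}}=\int_{\mathbb R^{2d}}\sup_{z\in\mathbb R^{2d}}|V_\Phi\sigma(z,\zeta)|\,v(\zeta)\,d\zeta<\infty$. **Theorem.** For every $\tau\in[0,1]$ there is a constant $C_\tau>0$ (which may also depend on $d,v,m_1,m_2,\varphi,\Phi$) such that for all $1\le p,q\le\infty$ and all $\sigma\in M^{\infty,1}_{1\otimes v}(\mathbb R^{2d})$ the operator $\mathrm{Op}_\tau(\sigma)$ is bounded on $W(\mathcal FL^p_{m_1},L^q_{m_2})$ with $$\|\mathrm{Op}_\tau(\sigma)\|_{W(\mathcal FL^p_{m_1},L^q_{m_2})\to W(\mathcal FL^p_{m_1},L^q_{m_2})}\le C_\tau\,\|\sigma\|_{M^{\infty,1}_{1\otimes v}} .$$ Here $\mathrm{Op}_\tau(\sigma)$ on $W(\mathcal FL^p_{m_1},L^q_{m_2})$ is the linear map $T$ that agrees with $\mathrm{Op}_\tau(\sigma)$ on the Schwartz functions in the space and satisfies, for all $f$ in the space and all $w\in\mathbb R^{2d}$, with an absolutely convergent integral, $$V_\varphi(Tf)(w)=\|\varphi\|_{L^2}^{-2}\int_{\mathbb R^{2d}}V_\varphi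 f(z)\,\langle\mathrm{Op}_\tau(\sigma)\pi(z)\varphi,\pi(w)\varphi\rangle\,dz ;$$ the existence of such a $T$ is part of the claim, and the formula determines it. -/

import Mathlib

open MeasureTheory SchwartzMap ComplexConjugate
open scoped RealInnerProductSpace FourierTransform ENNReal NNReal

set_option linter.unusedSectionVars false
noncomputable section
namespace TauPsiDO

/-! ### Helper facts: Schwartz regularity -/

theorem hasTemperateGrowth_cexp (c : ℝ) :
    Function.HasTemperateGrowth (fun t : ℝ ↦ Complex.exp ((c * Complex.I) * t)) := by
  have hd : ∀ (n : ℕ), ∀ t : ℝ, iteratedDeriv n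
      (fun t : ℝ ↦ Complex.exp ((c * Complex.I) * t)) t
        = (c * Complex.I) ^ n * Complex.exp ((c * Complex.I) * t) := by
    intro n
    induction n with
    | zero => intro t; simp
    | succ n ih =>
      intro t
      rw [iteratedDeriv_succ, funext ih]
      have h1 : HasDerivAt (fun t : ℝ ↦ (c * Complex.I) * (t : ℂ)) (c * Complex.I) t := by
        simpa using (Complex.ofRealCLM.hasDerivAt (x := t)).const_mul (c * Complex.I)
      rw [(h1.cexp.const_mul _).deriv]
      ring
  refine ⟨Complex.contDiff_exp.comp (contDiff_const.mul Complex.ofRealCLM.contDiff),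
    fun n ↦ ⟨0, |c| ^ n, fun t ↦ ?_⟩⟩
  rw [norm_iteratedFDeriv_eq_norm_iteratedDeriv, hd]
  have : ‖Complex.exp ((c * Complex.I) * t)‖ = 1 := by
    rw [show (c * Complex.I) * (t : ℂ) = ((c * t : ℝ) : ℂ) * Complex.I by push_cast; ring]
    exact Complex.norm_exp_ofReal_mul_I _
  simp [this]

section FT
variable {E : Type} [NormedAddCommGroup E] [InnerProductSpace ℝ E]
variable {F : Type} [NormedAddCommGroup F] [NormedSpace ℝ F] [NormedSpace ℂ F] [IsScalarTower ℝ ℂ F]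

/-- Phase space `E × E` with its Euclidean norm, inner product and volume; its points are
`z = (x, ω)` with `x = z.fst`, `ω = z.snd`. -/
abbrev Phase (E : Type) : Type := WithLp 2 (E × E)

/-- The point `(x, y)` of phase space. -/
def ph (x y : E) : Phase E := WithLp.toLp 2 (x, y)

theorem norm_snd_le (p : Phase E) : ‖p.snd‖ ≤ ‖p‖ := by
  have := WithLp.prod_norm_sq_eq_of_L2 p
  nlinarith [norm_nonneg p, norm_nonneg p.snd, sq_nonneg ‖p.fst‖]

theorem norm_le_fst_add_snd (p : Phase E) : ‖p‖ ≤ ‖p.fst‖ + ‖p.snd‖ := by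
  have := WithLp.prod_norm_sq_eq_of_L2 p
  nlinarith [norm_nonneg p, norm_nonneg p.snd, norm_nonneg p.fst]

/-- The second coordinate, as a continuous linear map. -/
def sndCLM : Phase E →L[ℝ] E := WithLp.sndL 2 ℝ E E
/-- The first coordinate, as a continuous linear map. -/
def fstCLM : Phase E →L[ℝ] E := WithLp.fstL 2 ℝ E E
/-- `x ↦ (x, 0)`. -/
def inlCLM : E →L[ℝ] Phase E :=
  ((WithLp.prodContinuousLinearEquiv 2 ℝ E E).symm : E × E →L[ℝ] Phase E).comp
    (ContinuousLinearMap.inl ℝ E E)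
/-- `y ↦ (0, y)`. -/
def inrCLM : E →L[ℝ] Phase E :=
  ((WithLp.prodContinuousLinearEquiv 2 ℝ E E).symm : E × E →L[ℝ] Phase E).comp
    (ContinuousLinearMap.inr ℝ E E)

theorem ph_eq (x y : E) : ph x y = inlCLM x + inrCLM y := by
  apply WithLp.ofLp_injective
  ext <;> simp [ph, inlCLM, inrCLM]

theorem continuous_ph (x : E) : Continuous (ph x) := by
  simp_rw [funext (ph_eq x)]
  fun_prop

variable [FiniteDimensional ℝ E] [MeasurableSpace E] [BorelSpace E]

theorem exists_bound (h : 𝓢(Phase E, F)) : ∃ B : E → ℝ, Integrable B ∧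
    ∀ x y, ‖h (ph x y)‖ ≤ B y := by
  set r := Module.finrank ℝ E + 1
  set C := 2 ^ r * (Finset.Iic (r, 0)).sup
    (fun m => SchwartzMap.seminorm ℝ m.1 m.2) h
  refine ⟨fun y ↦ C * (1 + ‖y‖) ^ (-(r : ℝ)), ?_, fun x y ↦ ?_⟩
  · exact (integrable_one_add_norm (by simp [r])).const_mul C
  · have h1 := SchwartzMap.one_add_le_sup_seminorm_apply (𝕜 := ℝ) (m := (r, 0)) le_rfl le_rfl h
      (ph x y)
    have h2 : ‖y‖ ≤ ‖ph x y‖ := norm_snd_le (ph x y)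
    rw [norm_iteratedFDeriv_zero] at h1
    change _ ≤ C * (1 + ‖y‖) ^ (-(r : ℝ))
    rw [Real.rpow_neg (by positivity), Real.rpow_natCast, ← div_eq_mul_inv,
      le_div_iff₀ (by positivity), mul_comm]
    refine le_trans ?_ h1
    gcongr

/-- The partial Fourier transform in the second variable. -/
def pft (h : Phase E → F) (p : Phase E) : F :=
  ∫ y : E, 𝐞 (-⟪y, p.snd⟫) • h (ph p.fst y)

theorem norm_pft_le (h : 𝓢(Phase E, F)) : ∃ C, ∀ p, ‖pft h p‖ ≤ C := by
  obtain ⟨B, hB, hle⟩ := exists_bound h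
  refine ⟨∫ y, B y, fun p ↦ ?_⟩
  exact norm_integral_le_of_norm_le hB (Filter.Eventually.of_forall fun y ↦ by simpa using hle _ _)

theorem integrable_slice (h : 𝓢(Phase E, F)) (x : E) : Integrable (fun y ↦ h (ph x y)) := by
  obtain ⟨B, hB, hle⟩ := exists_bound h
  exact hB.mono' (h.continuous.comp (continuous_ph x)).aestronglyMeasurable
    (Filter.Eventually.of_forall (hle x))

/-- `(p, q) ↦ ⟪p.fst, q.fst⟫`. -/
def Lx : Phase E →L[ℝ] Phase E →L[ℝ] ℝ := (innerSL ℝ).bilinearComp fstCLM fstCLM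
/-- `(p, q) ↦ ⟪p.snd, q.snd⟫`. -/
def Ly : Phase E →L[ℝ] Phase E →L[ℝ] ℝ := (innerSL ℝ).bilinearComp sndCLM sndCLM

/-- The Schwartz function whose partial Fourier transform is the derivative of that of `h`. -/
def dpft (h : 𝓢(Phase E, F)) : 𝓢(Phase E, Phase E →L[ℝ] F) :=
  SchwartzMap.postcompCLM (𝕜 := ℝ)
    ((ContinuousLinearMap.compL ℝ (Phase E) (Phase E) F).flip (inlCLM.comp fstCLM))
    (SchwartzMap.fderivCLM ℝ (Phase E) F h)
  + (-(2 * Real.pi * Complex.I)) • SchwartzMap.smulRightCLM ℝ F Ly h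

theorem dpft_apply (h : 𝓢(Phase E, F)) (p : Phase E) :
    dpft h p = (fderiv ℝ h p).comp (inlCLM.comp fstCLM) +
     (-(2 * Real.pi * Complex.I)) • (Ly p).smulRight (h p) := rfl

theorem hasFDerivAt_integrand (h : 𝓢(Phase E, F)) (y : E) (q : Phase E) :
    HasFDerivAt (fun q : Phase E ↦ 𝐞 (-⟪y, q.snd⟫) • h (ph q.fst y))
      (𝐞 (-⟪y, q.snd⟫) • (dpft h) (ph q.fst y)) q := by
  have ha : HasFDerivAt (fun q : Phase E ↦ -⟪y, q.snd⟫) (-((innerSL ℝ y).comp sndCLM)) q :=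
    ((innerSL ℝ y).comp sndCLM).hasFDerivAt.neg
  have hb : HasFDerivAt (fun q : Phase E ↦ ((𝐞 (-⟪y, q.snd⟫) : Circle) : ℂ)) _ q :=
    HasFDerivAt.comp (g := fun x : ℝ ↦ ((𝐞 x : Circle) : ℂ)) q
      (Real.hasDerivAt_fourierChar (-⟪y, q.snd⟫)).hasFDerivAt ha
  have hg : HasFDerivAt (fun q : Phase E ↦ ph q.fst y) (inlCLM.comp fstCLM) q := by
    simp_rw [ph_eq]
    exact ((inlCLM.comp fstCLM).hasFDerivAt).add_const _
  have hh : HasFDerivAt (fun q : Phase E ↦ h (ph q.fst y)) 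
      ((fderiv ℝ h (ph q.fst y)).comp (inlCLM.comp fstCLM)) q :=
    HasFDerivAt.comp (g := h) q (h.differentiableAt.hasFDerivAt) hg
  have hm := hb.smul hh
  refine HasFDerivAt.congr_fderiv (f' := _) hm ?_
  rw [dpft_apply]
  ext v
  simp only [Circle.smul_def, add_apply, smul_apply,
    ContinuousLinearMap.comp_apply, ContinuousLinearMap.smulRight_apply, smul_add,
    neg_apply, ContinuousLinearMap.toSpanSingleton_apply]
  congr 1
  have e1 : Ly (ph q.fst y) v = ⟪y, v.snd⟫ := rfl
  have e2 : (innerSL ℝ y) (sndCLM v) = ⟪y, v.snd⟫ := rfl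
  rw [e1, e2]
  have e3 : ⟪y, v.snd⟫ • h (ph q.fst y) = ((⟪y, v.snd⟫ : ℝ) : ℂ) • h (ph q.fst y) := by
    rw [← algebraMap_smul ℂ, Complex.coe_algebraMap]
  rw [e3, smul_smul, smul_smul]
  congr 1
  rw [Complex.real_smul]
  push_cast
  ring

theorem continuous_integrand (k : 𝓢(Phase E, F)) (q : Phase E) :
    Continuous (fun y ↦ 𝐞 (-⟪y, q.snd⟫) • k (ph q.fst y)) := by
  have := k.continuous.comp (continuous_ph q.fst)
  have h2 : Continuous (fun y : E ↦ 𝐞 (-⟪y, q.snd⟫)) :=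
    Real.continuous_fourierChar.comp (by fun_prop)
  exact h2.smul this

theorem integrable_integrand (h : 𝓢(Phase E, F)) (p : Phase E) :
    Integrable (fun y ↦ 𝐞 (-⟪y, p.snd⟫) • h (ph p.fst y)) :=
  (integrable_slice h p.fst).norm.mono' (continuous_integrand h p).aestronglyMeasurable
      (Filter.Eventually.of_forall fun y ↦ by simp)

theorem aesm_integrand (k : 𝓢(Phase E, F)) (q : Phase E) :
    AEStronglyMeasurable (fun y ↦ 𝐞 (-⟪y, q.snd⟫) • k (ph q.fst y)) :=
  (continuous_integrand k q).aestronglyMeasurable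

theorem norm_integrand (k : 𝓢(Phase E, F)) (q : Phase E) (y : E) :
    ‖𝐞 (-⟪y, q.snd⟫) • k (ph q.fst y)‖ = ‖k (ph q.fst y)‖ := Circle.norm_smul _ _

theorem hasFDerivAt_pft (h : 𝓢(Phase E, F)) (p : Phase E) :
    HasFDerivAt (pft h) (pft (dpft h) p) p := by
  obtain ⟨B, hB, hle⟩ := exists_bound (dpft h)
  exact hasFDerivAt_integral_of_dominated_of_fderiv_le (bound := B) (s := Set.univ)
    (F := fun (q : Phase E) (y : E) ↦ 𝐞 (-⟪y, q.snd⟫) • h (ph q.fst y))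
    (F' := fun (q : Phase E) (y : E) ↦ 𝐞 (-⟪y, q.snd⟫) • (dpft h) (ph q.fst y))
    Filter.univ_mem (Filter.Eventually.of_forall fun q ↦ aesm_integrand h q)
    (integrable_integrand h p)
    (aesm_integrand (dpft h) p)
    (Filter.Eventually.of_forall fun y q _ ↦ (norm_integrand (dpft h) q y).trans_le (hle _ _)) hB
    (Filter.Eventually.of_forall fun y q _ ↦ hasFDerivAt_integrand h y q)

end FT

section smooth
variable {E : Type} [NormedAddCommGroup E] [InnerProductSpace ℝ E] [FiniteDimensional ℝ E]
  [MeasurableSpace E] [BorelSpace E]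

theorem contDiff_pft (n : ℕ) : ∀ {F : Type} [NormedAddCommGroup F] [NormedSpace ℝ F]
    [NormedSpace ℂ F] [IsScalarTower ℝ ℂ F] (h : 𝓢(Phase E, F)), ContDiff ℝ n (pft h) := by
  induction n with
  | zero =>
    intro F _ _ _ _ h
    rw [Nat.cast_zero, contDiff_zero]
    exact continuous_iff_continuousAt.2 fun p ↦ (hasFDerivAt_pft h p).continuousAt
  | succ n ih =>
    intro F _ _ _ _ h
    rw [Nat.cast_succ, contDiff_succ_iff_hasFDerivAt]
    exact ⟨pft (dpft h), ih (dpft h), hasFDerivAt_pft h⟩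

theorem fourier_fderiv' {F : Type} [NormedAddCommGroup F] [i : NormedSpace ℝ F]
    [NormedSpace ℂ F] [IsScalarTower ℝ ℂ F] {f : E → F} (hf : Integrable f)
    (hd : Differentiable ℝ f) (hf' : Integrable (fderiv ℝ f)) (w : E) :
    2 * Real.pi * ‖w‖ * ‖∫ y, 𝐞 (-⟪y, w⟫) • f y‖ ≤ ‖∫ y, 𝐞 (-⟪y, w⟫) • fderiv ℝ f y‖ := by
  have hi : i = NormedSpace.complexToReal := by
    ext r x
    exact (algebraMap_smul ℂ r x).symm
  subst hi
  have := congrFun (Real.fourier_fderiv hf hd hf') w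
  rw [Real.fourier_eq] at this
  rw [this, ← Real.fourier_eq, VectorFourier.norm_fourierSMulRight]
  rw [neg_apply, norm_neg]
  refine le_of_eq ?_
  congr 2
  exact (innerSL_apply_norm (𝕜 := ℝ) w).symm

/-- The derivative of `h` in the second variable. -/
def dy {F : Type} [NormedAddCommGroup F] [NormedSpace ℝ F]
    [NormedSpace ℂ F] [IsScalarTower ℝ ℂ F] (h : 𝓢(Phase E, F)) : 𝓢(Phase E, E →L[ℝ] F) :=
  SchwartzMap.postcompCLM (𝕜 := ℝ)
    ((ContinuousLinearMap.compL ℝ E (Phase E) F).flip inrCLM)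
    (SchwartzMap.fderivCLM ℝ (Phase E) F h)

theorem norm_fst_le_Lx (p : Phase E) : ‖p.fst‖ ≤ ‖Lx p‖ := by
  have h1 : Lx p (ph p.fst 0) = ⟪p.fst, p.fst⟫ := rfl
  rw [real_inner_self_eq_norm_sq] at h1
  have h2 := (Lx p).le_opNorm (ph p.fst 0)
  have h3 := norm_le_fst_add_snd (ph p.fst 0)
  have h4 : (ph p.fst (0 : E)).fst = p.fst := rfl
  have h5 : (ph p.fst (0 : E)).snd = 0 := rfl
  rw [h4, h5, norm_zero, add_zero] at h3
  rw [h1, Real.norm_of_nonneg (by positivity)] at h2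
  rcases (norm_nonneg p.fst).eq_or_lt with h0 | h0
  · rw [← h0]; positivity
  · have : ‖p.fst‖ ^ 2 ≤ ‖Lx p‖ * ‖p.fst‖ := h2.trans (by gcongr)
    nlinarith

theorem decay_pft (k : ℕ) : ∀ {F : Type} [NormedAddCommGroup F] [NormedSpace ℝ F]
    [NormedSpace ℂ F] [IsScalarTower ℝ ℂ F] [CompleteSpace F] (h : 𝓢(Phase E, F)),
    ∃ C, ∀ p, ‖p‖ ^ k * ‖pft h p‖ ≤ C := by
  induction k with
  | zero =>
    intro F _ _ _ _ _ h
    simpa using norm_pft_le h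
  | succ n ih =>
    intro F _ _ _ _ _ h
    obtain ⟨C1, h1⟩ := ih (SchwartzMap.smulRightCLM ℝ F Lx h)
    obtain ⟨C2, h2⟩ := ih (dy h)
    refine ⟨C1 + C2, fun p ↦ ?_⟩
    have e1 : ‖p.fst‖ * ‖pft h p‖ ≤ ‖pft (SchwartzMap.smulRightCLM ℝ F Lx h) p‖ := by
      have : pft (SchwartzMap.smulRightCLM ℝ F Lx h) p = (Lx p).smulRight (pft h p) := by
        have h3 := (ContinuousLinearMap.smulRightL ℝ (Phase E) F (Lx p)).integral_comp_comm
          (integrable_integrand h p)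
        refine Eq.trans ?_ h3
        refine integral_congr_ae (Filter.Eventually.of_forall fun y ↦ ?_)
        ext v
        have e4 : Lx (ph p.fst y) v = Lx p v := rfl
        change 𝐞 (-⟪y, p.snd⟫) • (Lx (ph p.fst y) v • h (ph p.fst y)) = 
          Lx p v • 𝐞 (-⟪y, p.snd⟫) • h (ph p.fst y)
        rw [e4, smul_comm]
      rw [this, ContinuousLinearMap.norm_smulRight_apply]
      gcongr
      exact norm_fst_le_Lx p
    have e2 : ‖p.snd‖ * ‖pft h p‖ ≤ ‖pft (dy h) p‖ := by
      have hd : ∀ y, HasFDerivAt (fun y ↦ h (ph p.fst y)) (dy h (ph p.fst y)) y := by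
        intro y
        have hg : HasFDerivAt (fun y : E ↦ ph p.fst y) inrCLM y := by
          simp_rw [ph_eq]
          exact (inrCLM.hasFDerivAt).const_add _
        exact HasFDerivAt.comp (g := h) y (h.differentiableAt.hasFDerivAt) hg
      have hd' : fderiv ℝ (fun y ↦ h (ph p.fst y)) = fun y ↦ dy h (ph p.fst y) :=
        funext fun y ↦ (hd y).fderiv
      have := fourier_fderiv' (integrable_slice h p.fst) (fun y ↦ (hd y).differentiableAt)
        (by rw [hd']; exact integrable_slice (dy h) p.fst) p.snd
      rw [hd'] at this
      refine le_trans ?_ this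
      change _ ≤ 2 * Real.pi * ‖p.snd‖ * ‖pft h p‖
      gcongr
      have := Real.pi_gt_three
      nlinarith [norm_nonneg p.snd]
    have := norm_le_fst_add_snd p
    calc ‖p‖ ^ (n + 1) * ‖pft h p‖ = ‖p‖ ^ n * (‖p‖ * ‖pft h p‖) := by ring
      _ ≤ ‖p‖ ^ n * ((‖p.fst‖ + ‖p.snd‖) * ‖pft h p‖) := by gcongr
      _ = ‖p‖ ^ n * (‖p.fst‖ * ‖pft h p‖) + ‖p‖ ^ n * (‖p.snd‖ * ‖pft h p‖) := by ring
      _ ≤ ‖p‖ ^ n * ‖pft (SchwartzMap.smulRightCLM ℝ F Lx h) p‖ + ‖p‖ ^ n * ‖pft (dy h) p‖ := by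
          gcongr
      _ ≤ C1 + C2 := add_le_add (h1 p) (h2 p)

theorem decay_iteratedFDeriv_pft (n : ℕ) : ∀ {F : Type} [NormedAddCommGroup F] [NormedSpace ℝ F]
    [NormedSpace ℂ F] [IsScalarTower ℝ ℂ F] [CompleteSpace F] (h : 𝓢(Phase E, F)) (k : ℕ),
    ∃ C, ∀ p, ‖p‖ ^ k * ‖iteratedFDeriv ℝ n (pft h) p‖ ≤ C := by
  induction n with
  | zero =>
    intro F _ _ _ _ _ h k
    simpa using decay_pft k h
  | succ n ih =>
    intro F _ _ _ _ _ h k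
    obtain ⟨C, hC⟩ := ih (dpft h) k
    refine ⟨C, fun p ↦ ?_⟩
    have : fderiv ℝ (pft h) = pft (dpft h) := funext fun p ↦ (hasFDerivAt_pft h p).fderiv
    rw [← norm_iteratedFDeriv_fderiv, this]
    exact hC p

end smooth
/-! ### Tensor products of Schwartz functions in linear coordinates -/

section tensor
variable {E : Type} [NormedAddCommGroup E] [InnerProductSpace ℝ E]

theorem contDiff_tensor (f g : 𝓢(E, ℂ)) (a b : Phase E →L[ℝ] E) :
    ContDiff ℝ ((⊤ : ℕ∞) : WithTop ℕ∞) (fun p ↦ f (a p) * g (b p)) :=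
  ((f.smooth ⊤).comp a.contDiff).mul ((g.smooth ⊤).comp b.contDiff)

theorem decay_tensor (f g : 𝓢(E, ℂ)) (a b : Phase E →L[ℝ] E) (K : ℝ)
    (hK : ∀ p, ‖p‖ ≤ K * (‖a p‖ + ‖b p‖)) (k n : ℕ) :
    ∃ C, ∀ p, ‖p‖ ^ k * ‖iteratedFDeriv ℝ n (fun p ↦ f (a p) * g (b p)) p‖ ≤ C := by
  set Cf := 2 ^ k * (Finset.Iic (k, n)).sup (fun m => SchwartzMap.seminorm ℝ m.1 m.2) f
  set Cg := 2 ^ k * (Finset.Iic (k, n)).sup (fun m => SchwartzMap.seminorm ℝ m.1 m.2) g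
  have hf : ∀ i ≤ n, ∀ x, (1 + ‖x‖) ^ k * ‖iteratedFDeriv ℝ i f x‖ ≤ Cf := fun i hi x ↦
    SchwartzMap.one_add_le_sup_seminorm_apply (𝕜 := ℝ) (m := (k, n)) le_rfl hi f x
  have hg : ∀ i ≤ n, ∀ x, (1 + ‖x‖) ^ k * ‖iteratedFDeriv ℝ i g x‖ ≤ Cg := fun i hi x ↦
    SchwartzMap.one_add_le_sup_seminorm_apply (𝕜 := ℝ) (m := (k, n)) le_rfl hi g x
  refine ⟨∑ i ∈ Finset.range (n + 1), |K| ^ k * (n.choose i : ℝ) *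
    (‖a‖ ^ i * Cf) * (‖b‖ ^ (n - i) * Cg), fun p ↦ ?_⟩
  have hp : ‖p‖ ^ k ≤ |K| ^ k * ((1 + ‖a p‖) ^ k * (1 + ‖b p‖) ^ k) := by
    rw [← mul_pow, ← mul_pow]
    refine pow_le_pow_left₀ (norm_nonneg _) ((hK p).trans ?_) k
    have h1 : ‖a p‖ + ‖b p‖ ≤ (1 + ‖a p‖) * (1 + ‖b p‖) := by
      nlinarith [norm_nonneg (a p), norm_nonneg (b p),
        mul_nonneg (norm_nonneg (a p)) (norm_nonneg (b p))]
    exact mul_le_mul (le_abs_self K) h1 (by positivity) (abs_nonneg K)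
  have hfa : ∀ i, ‖iteratedFDeriv ℝ i (fun p ↦ f (a p)) p‖ ≤
      ‖a‖ ^ i * ‖iteratedFDeriv ℝ i f (a p)‖ := by
    intro i
    have := a.iteratedFDeriv_comp_right (f.smooth ⊤) p (i := i) (mod_cast le_top)
    rw [show (fun p ↦ f (a p)) = f ∘ a from rfl, this, mul_comm]
    refine (ContinuousMultilinearMap.norm_compContinuousLinearMap_le _ _).trans (le_of_eq ?_)
    simp
  have hgb : ∀ i, ‖iteratedFDeriv ℝ i (fun p ↦ g (b p)) p‖ ≤
      ‖b‖ ^ i * ‖iteratedFDeriv ℝ i g (b p)‖ := by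
    intro i
    have := b.iteratedFDeriv_comp_right (g.smooth ⊤) p (i := i) (mod_cast le_top)
    rw [show (fun p ↦ g (b p)) = g ∘ b from rfl, this, mul_comm]
    refine (ContinuousMultilinearMap.norm_compContinuousLinearMap_le _ _).trans (le_of_eq ?_)
    simp
  have hmul := norm_iteratedFDeriv_mul_le (n := n) (N := ((⊤ : ℕ∞) : WithTop ℕ∞)) ((f.smooth ⊤).comp a.contDiff)
    ((g.smooth ⊤).comp b.contDiff) p (mod_cast le_top)
  refine (mul_le_mul hp hmul (norm_nonneg _) (by positivity)).trans ?_
  rw [Finset.mul_sum]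
  refine Finset.sum_le_sum fun i hi ↦ ?_
  have hi' : i ≤ n := by simpa [Nat.lt_succ_iff] using hi
  calc _ ≤ |K| ^ k * ((1 + ‖a p‖) ^ k * (1 + ‖b p‖) ^ k) * ((n.choose i : ℝ) *
        (‖a‖ ^ i * ‖iteratedFDeriv ℝ i f (a p)‖) *
        (‖b‖ ^ (n - i) * ‖iteratedFDeriv ℝ (n - i) g (b p)‖)) := by
        gcongr
        · exact hfa i
        · exact hgb (n - i)
    _ = |K| ^ k * (n.choose i : ℝ) *
        (‖a‖ ^ i * ((1 + ‖a p‖) ^ k * ‖iteratedFDeriv ℝ i f (a p)‖)) *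
        (‖b‖ ^ (n - i) * ((1 + ‖b p‖) ^ k * ‖iteratedFDeriv ℝ (n - i) g (b p)‖)) := by ring
    _ ≤ _ := by
        have hCf : 0 ≤ Cf := le_trans (by positivity) (hf i hi' (a p))
        gcongr
        · exact hf i hi' (a p)
        · exact hg (n - i) (Nat.sub_le _ _) (b p)

/-- The Schwartz function `p ↦ f (a p) g (b p)` on phase space. -/
def tensorS (f g : 𝓢(E, ℂ)) (a b : Phase E →L[ℝ] E) (K : ℝ)
    (hK : ∀ p, ‖p‖ ≤ K * (‖a p‖ + ‖b p‖)) : 𝓢(Phase E, ℂ) where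
  toFun p := f (a p) * g (b p)
  smooth' := contDiff_tensor f g a b
  decay' := decay_tensor f g a b K hK

end tensor

/-! ### Time-frequency shifts, brackets, short-time Fourier transform -/

section stft
variable {V : Type} [NormedAddCommGroup V] [InnerProductSpace ℝ V]

theorem hasTemperateGrowth_character (ω : V) :
    Function.HasTemperateGrowth (fun t : V ↦ ((𝐞 (⟪ω, t⟫) : Circle) : ℂ)) := by
  have h := (hasTemperateGrowth_cexp (2 * Real.pi)).comp
    (Function.hasTemperateGrowth_inner_right ω)
  convert h using 2 with t
  simp only [Real.fourierChar_apply, Function.comp_apply]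
  push_cast
  ring_nf

/-- Complex conjugation of Schwartz functions. -/
def conjS (g : 𝓢(V, ℂ)) : 𝓢(V, ℂ) :=
  SchwartzMap.postcompCLM (𝕜 := ℝ) (Complex.conjCLE : ℂ →L[ℝ] ℂ) g

theorem conjS_apply (g : 𝓢(V, ℂ)) (t : V) : conjS g t = conj (g t) := rfl

/-- The time-frequency shift `π(x, ω) g (t) = e^{2πi ω·t} g(t - x)`, see `tfShift_apply`. -/
def tfShift (x ω : V) (g : 𝓢(V, ℂ)) : 𝓢(V, ℂ) :=
  SchwartzMap.smulLeftCLM ℂ (fun t : V ↦ ((𝐞 (⟪ω, t⟫) : Circle) : ℂ))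
    (SchwartzMap.compSubConstCLM ℂ x g)

theorem tfShift_apply (x ω : V) (g : 𝓢(V, ℂ)) (t : V) :
    tfShift x ω g t = Complex.exp (2 * Real.pi * Complex.I * ⟪ω, t⟫) * g (t - x) := by
  rw [tfShift, SchwartzMap.smulLeftCLM_apply_apply (hasTemperateGrowth_character ω),
    Real.fourierChar_apply]
  simp only [compSubConstCLM_apply, smul_eq_mul]
  push_cast
  ring_nf

/-- The bracket `⟨f, g⟩` of a tempered distribution `f` and a Schwartz function `g`,
conjugate-linear in `g`; for a function `f` it is `∫ f(t) conj (g(t)) dt`. -/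
def bracket (f : 𝓢'(V, ℂ)) (g : 𝓢(V, ℂ)) : ℂ := f (conjS g)

/-- The short-time Fourier transform `V_g f (x, ω) = ⟨f, π(x, ω) g⟩`. -/
def stft (g : 𝓢(V, ℂ)) (f : 𝓢'(V, ℂ)) (x ω : V) : ℂ := bracket f (tfShift x ω g)

end stft

/-! ### Modulation and Wiener amalgam spaces -/

section spaces
variable {V : Type} [NormedAddCommGroup V] [InnerProductSpace ℝ V] [FiniteDimensional ℝ V]
  [MeasurableSpace V] [BorelSpace V]

/-- A Schwartz function as a tempered distribution. -/
def toDist (f : 𝓢(V, ℂ)) : 𝓢'(V, ℂ) := SchwartzMap.toTemperedDistributionCLM V ℂ volume f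

theorem bracket_toDist (f g : 𝓢(V, ℂ)) : bracket (toDist f) g = ∫ t, f t * conj (g t) := by
  refine (SchwartzMap.toTemperedDistributionCLM_apply_apply volume f (conjS g)).trans ?_
  simp [conjS_apply, mul_comm]

/-- The norm of `M^{p,q}_m`, computed with the window `g`: the `L^q` norm in `ω` of the `L^p`
norm in `x` of `V_g f (x, ω) m(x, ω)`; it is `∞` if `f` is not in the space. -/
def modNorm (g : 𝓢(V, ℂ)) (m : V → V → ℝ) (p q : ℝ≥0∞) (f : 𝓢'(V, ℂ)) : ℝ≥0∞ :=
  eLpNorm (fun ω ↦ eLpNorm (fun x ↦ ‖stft g f x ω‖ₑ * ENNReal.ofReal (m x ω)) p volume) q volume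

/-- The norm of `W(𝓕 L^p_u, L^q_w)`, computed with the window `g`: the `L^q_w` norm in `x` of the
`L^p_u` norm in `ω` of `V_g f (x, ω)`; it is `∞` if `f` is not in the space. -/
def amalgamNorm (g : 𝓢(V, ℂ)) (u w : V → ℝ) (p q : ℝ≥0∞) (f : 𝓢'(V, ℂ)) : ℝ≥0∞ :=
  eLpNorm (fun x ↦ eLpNorm (fun ω ↦ ‖stft g f x ω‖ₑ * ENNReal.ofReal (u ω)) p volume
    * ENNReal.ofReal (w x)) q volume

/-- The Wiener amalgam space `W(𝓕 L^p_u, L^q_w)`. -/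
def Amalgam (g : 𝓢(V, ℂ)) (u w : V → ℝ) (p q : ℝ≥0∞) : Set 𝓢'(V, ℂ) :=
  {f | amalgamNorm g u w p q f < ∞}

end spaces

/-! ### Weights -/

/-- Euclidean space `ℝ^d`. -/
abbrev Rd (d : ℕ) : Type := EuclideanSpace ℝ (Fin d)

/-- Admissible weights on `ℝ^{2d}`. -/
structure IsAdmissible {d : ℕ} (v : Phase (Rd d) → ℝ) : Prop where
  nonneg : ∀ z, 0 ≤ v z
  continuous : Continuous v
  map_zero : v 0 = 1
  even : ∀ z z' : Phase (Rd d), (∀ i, |z'.fst i| = |z.fst i|) → (∀ i, |z'.snd i| = |z.snd i|) →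
    v z' = v z
  submultiplicative : ∀ w z, v (w + z) ≤ v w * v z
  grs : ∀ z, Filter.Tendsto (fun n : ℕ ↦ v ((n : ℝ) • z) ^ (1 / (n : ℝ))) Filter.atTop (nhds 1)

/-- `m` is a `v`-moderate weight. -/
structure IsModerate {d : ℕ} (v m : Phase (Rd d) → ℝ) : Prop where
  pos : ∀ z, 0 < m z
  moderate : ∃ C : ℝ, 0 ≤ C ∧ ∀ z₁ z₂, m (z₁ + z₂) ≤ C * v z₁ * m z₂

/-- `m ≥ 1`, or `m(z) ≥ c (1 + |z|²)^{-N/2}` for some `c > 0` and `N ∈ ℕ`. -/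
def IsTemperedBelow {d : ℕ} (m : Phase (Rd d) → ℝ) : Prop :=
  (∀ z, 1 ≤ m z) ∨ ∃ c : ℝ, 0 < c ∧ ∃ N : ℕ, ∀ z, c * (√(1 + ‖z‖ ^ 2) ^ N)⁻¹ ≤ m z

/-- The weight `(m₁ ⊗ m₂)(x, ω) = m₁(x) m₂(ω)`. -/
def tensorWeight {d : ℕ} (m₁ m₂ : Rd d → ℝ) (z : Phase (Rd d)) : ℝ := m₁ z.fst * m₂ z.snd

/-- `φ` is a non-zero Schwartz function in `M^1_{v ∘ J⁻¹}(ℝ^d)`, where `J⁻¹(x, ω) = (-ω, x)`.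
For a Schwartz function `φ ≠ 0` and an even submultiplicative weight, membership in this space
may be tested with the window `φ` itself. For `v` of polynomial growth every `φ ≠ 0` qualifies. -/
structure IsWindow {d : ℕ} (v : Phase (Rd d) → ℝ) (φ : 𝓢(Rd d, ℂ)) : Prop where
  ne_zero : φ ≠ 0
  integrable : modNorm φ (fun x ω ↦ v (ph (-ω) x)) 1 1 (toDist φ) < ∞

/-- The norm of `M^{∞,1}_{1 ⊗ v}(ℝ^{2d})`, computed with the window `Φ`. -/
def sjostrandNorm {d : ℕ} (v : Phase (Rd d) → ℝ) (Φ : 𝓢(Phase (Rd d), ℂ))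
    (σ : 𝓢'(Phase (Rd d), ℂ)) : ℝ≥0∞ := modNorm Φ (fun _ ζ ↦ v ζ) ∞ 1 σ

/-! ### `τ`-Wigner distributions and `τ`-pseudodifferential operators -/

section wigner
variable {E : Type} [NormedAddCommGroup E] [InnerProductSpace ℝ E]

/-- `(x, y) ↦ x + c y`. -/
def shear (c : ℝ) : Phase E →L[ℝ] E := fstCLM + c • sndCLM

theorem shear_ph (c : ℝ) (x y : E) : shear c (ph x y) = x + c • y := rfl

theorem norm_le_shear (τ : ℝ) (p : Phase E) :
    ‖p‖ ≤ (1 + |1 - τ| + |τ|) * (‖shear τ p‖ + ‖shear (τ - 1) p‖) := by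
  set A := shear τ p
  set B := shear (τ - 1) p
  have hA : A = p.fst + τ • p.snd := rfl
  have hB : B = p.fst + (τ - 1) • p.snd := rfl
  have h1 : p.snd = A - B := by rw [hA, hB]; module
  have h2 : p.fst = (1 - τ) • A + τ • B := by rw [hA, hB]; module
  have h3 : ‖p.snd‖ ≤ ‖A‖ + ‖B‖ := by rw [h1]; exact norm_sub_le _ _
  have h4 : ‖p.fst‖ ≤ |1 - τ| * ‖A‖ + |τ| * ‖B‖ := by
    rw [h2]
    refine (norm_add_le _ _).trans (le_of_eq ?_)
    simp [norm_smul]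
  have h5 := norm_le_fst_add_snd p
  nlinarith [norm_nonneg A, norm_nonneg B, abs_nonneg τ, abs_nonneg (1 - τ),
    mul_nonneg (abs_nonneg τ) (norm_nonneg A), mul_nonneg (abs_nonneg (1 - τ)) (norm_nonneg B)]

/-- `(x, y) ↦ f(x + τ y) conj (g(x - (1 - τ) y))` as a Schwartz function. -/
def wignerKernel (τ : ℝ) (f g : 𝓢(E, ℂ)) : 𝓢(Phase E, ℂ) :=
  tensorS f (conjS g) (shear τ) (shear (τ - 1)) _ (norm_le_shear τ)

theorem wignerKernel_ph (τ : ℝ) (f g : 𝓢(E, ℂ)) (x y : E) :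
    wignerKernel τ f g (ph x y) = f (x + τ • y) * conj (g (x - (1 - τ) • y)) := by
  change f (x + τ • y) * conj (g (x + (τ - 1) • y)) = _
  congr 4
  module

variable [FiniteDimensional ℝ E] [MeasurableSpace E] [BorelSpace E]

/-- The cross-`τ`-Wigner distribution, a Schwartz function on phase space; the formula is in
`tauWigner_ph`. -/
def tauWigner (τ : ℝ) (f g : 𝓢(E, ℂ)) : 𝓢(Phase E, ℂ) where
  toFun := pft (wignerKernel τ f g)
  smooth' := contDiff_infty.2 fun n ↦ contDiff_pft n _
  decay' k n := decay_iteratedFDeriv_pft n _ k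

theorem tauWigner_ph (τ : ℝ) (f g : 𝓢(E, ℂ)) (x ω : E) :
    tauWigner τ f g (ph x ω) = ∫ y : E, Complex.exp (-(2 * Real.pi * Complex.I * ⟪y, ω⟫)) *
      (f (x + τ • y) * conj (g (x - (1 - τ) • y))) := by
  change ∫ y : E, 𝐞 (-⟪y, ω⟫) • wignerKernel τ f g (ph x y) = _
  congr 1
  ext y
  rw [wignerKernel_ph, Circle.smul_def, Real.fourierChar_apply, smul_eq_mul]
  push_cast
  ring_nf

/-- The operator `Op_τ(σ) : 𝓢 → 𝓢'` in weak form: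
`opTau τ σ f g = ⟨Op_τ(σ) f, g⟩ = ⟨σ, W_τ(g, f)⟩`. -/
def opTau (τ : ℝ) (σ : 𝓢'(Phase E, ℂ)) (f g : 𝓢(E, ℂ)) : ℂ := bracket σ (tauWigner τ g f)

/-- `T` is the operator `Op_τ(σ)` on the space `W` of distributions: it is linear on `W`, it is
given on Schwartz functions by the definition of `Op_τ(σ)`, and on all of `W` by applying
`Op_τ(σ)` under the integral in the inversion formula
`f = ‖φ‖₂⁻² ∫ V_φ f(z) π(z)φ dz`, that is (weakly, against `π(x, ω)φ`)
`T f = ‖φ‖₂⁻² ∫ V_φ f(z) Op_τ(σ) π(z)φ dz`, the integrals being absolutely convergent.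
The last property determines `T` on `W`. -/
structure IsTauOperatorOn (τ : ℝ) (σ : 𝓢'(Phase E, ℂ)) (φ : 𝓢(E, ℂ)) (W : Set 𝓢'(E, ℂ))
    (T : 𝓢'(E, ℂ) → 𝓢'(E, ℂ)) : Prop where
  map_add : ∀ f ∈ W, ∀ h ∈ W, T (f + h) = T f + T h
  map_smul : ∀ (c : ℂ), ∀ f ∈ W, T (c • f) = c • T f
  apply_schwartz : ∀ f : 𝓢(E, ℂ), toDist f ∈ W → ∀ g, bracket (T (toDist f)) g = opTau τ σ f g
  integrable : ∀ f ∈ W, ∀ x ω : E, Integrable (fun z : Phase E ↦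
    stft φ f z.fst z.snd * opTau τ σ (tfShift z.fst z.snd φ) (tfShift x ω φ))
  stft_apply : ∀ f ∈ W, ∀ x ω : E, stft φ (T f) x ω = ((∫ t, ‖φ t‖ ^ 2 : ℝ) : ℂ)⁻¹ *
    ∫ z : Phase E, stft φ f z.fst z.snd * opTau τ σ (tfShift z.fst z.snd φ) (tfShift x ω φ)

end wigner
end TauPsiDO
end

open TauPsiDO

open TauPsiDO

noncomputable section
namespace TauPsiDO

/-! The idea is almost diagonalization by time-frequency shifts. Put `Ψ = tauWigner τ φ φ`.
Covariance of the `τ`-Wigner distribution (`tauWigner_tf`) says that `W_τ(π(w)φ, π(z)φ)` is, up to a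
unimodular factor, a time-frequency shift of `Ψ` whose frequency is `rot (w - z)`. Hence the matrix
entry `⟨Op_τ(σ) π(z)φ, π(w)φ⟩` has the modulus of a value of `V_Ψ σ` at frequency `rot (w - z)`.
Taking the supremum over positions bounds it by `kernelBound τ σ φ (w - z)`, a convolution kernel
(`enorm_opTau_le`).

This kernel is integrable against `v ∘ rot`, with norm controlled by the Sjöstrand norm of `σ`
(`exists_lintegral_kernelBound_le`). This is a change of window from `Φ` to `Ψ`. It needs the
ambiguity function of `Ψ` to be integrable against `v`. By Moyal's formula that function factors
into two copies of the ambiguity function of `φ` in measure-preserving coordinates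
(`ambig_tauWigner`), so the window hypothesis on `φ` suffices.

Consequently `|V_φ(Tf)|` is dominated by the convolution of `|V_φ f|` with the kernel. Moderateness
moves the weight inside the convolution, and Young's inequality for mixed norms
(`mixNorm_convolution_le`) gives the estimate with a constant independent of `p` and `q`.

Schwartz functions need not be dense when an exponent is infinite, so `T` is constructed directly,
by a method common to all exponents. A local averaging argument
(`ModeratePair.exists_bound_absStft`) shows that `V_φ f` times the weight is bounded for every `f`
in the amalgam space. Hence the integral `opStft` defining `V_φ(Tf)` converges absolutely, and it
grows polynomially because the weight has a polynomial lower bound. The adjoint of `V_φ` then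
synthesizes a tempered distribution from it. What remains is that the short-time Fourier transform
of this distribution is again `opStft` after normalization. This is
`ModeratePair.integral_opStft_mul`: Fubini applied to a triple integral, one order giving the
reproducing formula for `V_φ f`, the other the matrix representation of `Op_τ(σ)`
(`opTau_eq_integral`). -/

/-! ### Integrals of families of Schwartz functions under tempered distributions -/

section families

/-- Bounded continuous functions with values in a normed group. -/
abbrev BddCont (V F : Type) [TopologicalSpace V] [NormedAddCommGroup F] : Type :=
  BoundedContinuousFunction V F

variable {V : Type} [NormedAddCommGroup V] [NormedSpace ℝ V]

theorem continuous_iteratedFDeriv_schwartz (g : 𝓢(V, ℂ)) (n : ℕ) :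
    Continuous (iteratedFDeriv ℝ n g) :=
  (g.smooth ⊤).continuous_iteratedFDeriv (mod_cast le_top)

/-- The weighted derivative `t ↦ ‖t‖ ^ k • D^n g (t)` of a Schwartz function, a bounded continuous
function. -/
def weightedDeriv (k n : ℕ) (g : 𝓢(V, ℂ)) :
    BddCont V (V [×n]→L[ℝ] ℂ) :=
  BoundedContinuousFunction.ofNormedAddCommGroup
    (fun t ↦ ((‖t‖ ^ k : ℝ) : ℂ) • iteratedFDeriv ℝ n g t)
    ((Complex.continuous_ofReal.comp (continuous_norm.pow k)).smul
      (continuous_iteratedFDeriv_schwartz g n))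
    (SchwartzMap.seminorm ℂ k n g)
    (fun t ↦ by
      rw [norm_smul, Complex.norm_real, Real.norm_of_nonneg (by positivity)]
      exact SchwartzMap.le_seminorm ℂ k n g t)

theorem weightedDeriv_apply (k n : ℕ) (g : 𝓢(V, ℂ)) (t : V) :
    weightedDeriv k n g t = ((‖t‖ ^ k : ℝ) : ℂ) • iteratedFDeriv ℝ n g t := rfl

theorem norm_weightedDeriv_le (k n : ℕ) (g : 𝓢(V, ℂ)) :
    ‖weightedDeriv k n g‖ ≤ SchwartzMap.seminorm ℂ k n g :=
  BoundedContinuousFunction.norm_ofNormedAddCommGroup_le _ (apply_nonneg _ _) _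

theorem seminorm_le_norm_weightedDeriv (k n : ℕ) (g : 𝓢(V, ℂ)) :
    SchwartzMap.seminorm ℂ k n g ≤ ‖weightedDeriv k n g‖ := by
  refine SchwartzMap.seminorm_le_bound ℂ k n g (norm_nonneg _) fun t ↦ ?_
  have h := (weightedDeriv k n g).norm_coe_le_norm t
  rwa [weightedDeriv_apply, norm_smul, Complex.norm_real, Real.norm_of_nonneg (by positivity)] at h

theorem iteratedFDeriv_add_schwartz (n : ℕ) (f g : 𝓢(V, ℂ)) (t : V) :
    iteratedFDeriv ℝ n (f + g : 𝓢(V, ℂ)) t = iteratedFDeriv ℝ n f t + iteratedFDeriv ℝ n g t :=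
  iteratedFDeriv_add_apply ((f.smooth n).contDiffAt) ((g.smooth n).contDiffAt)

theorem iteratedFDeriv_smul_schwartz (n : ℕ) (c : ℂ) (g : 𝓢(V, ℂ)) (t : V) :
    iteratedFDeriv ℝ n (c • g : 𝓢(V, ℂ)) t = c • iteratedFDeriv ℝ n g t :=
  iteratedFDeriv_const_smul_apply ((g.smooth n).contDiffAt)

/-- `weightedDeriv` as a linear map. -/
def weightedDerivLM (k n : ℕ) :
    𝓢(V, ℂ) →ₗ[ℂ] BddCont V (V [×n]→L[ℝ] ℂ) where
  toFun := weightedDeriv k n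
  map_add' f g := by
    ext1 t
    simp only [weightedDeriv_apply, iteratedFDeriv_add_schwartz, smul_add,
      BoundedContinuousFunction.coe_add, Pi.add_apply]
  map_smul' c g := by
    ext1 t
    simp only [weightedDeriv_apply, iteratedFDeriv_smul_schwartz, RingHom.id_apply,
      BoundedContinuousFunction.coe_smul]
    rw [smul_comm]

theorem continuous_weightedDeriv (k n : ℕ) :
    Continuous (weightedDeriv k n : 𝓢(V, ℂ) → _) := by
  refine continuous_iff_continuousAt.2 fun g ↦ tendsto_iff_norm_sub_tendsto_zero.2 ?_
  have h1 : Filter.Tendsto (fun h : 𝓢(V, ℂ) ↦ SchwartzMap.seminorm ℂ k n (h - g)) (nhds g)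
      (nhds 0) := by
    have hc : Continuous (SchwartzMap.seminorm ℂ k n : 𝓢(V, ℂ) → ℝ) :=
      (schwartz_withSeminorms ℂ V ℂ).continuous_seminorm (k, n)
    have h2 := (hc.comp (continuous_id.sub continuous_const : Continuous fun h ↦ h - g)).tendsto g
    refine (h2.congr' (Filter.Eventually.of_forall fun h ↦ rfl)).trans (le_of_eq ?_)
    simp
  refine squeeze_zero (fun _ ↦ norm_nonneg _) (fun h ↦ ?_) h1
  have : weightedDeriv k n h - weightedDeriv k n g = weightedDeriv k n (h - g) :=
    ((weightedDerivLM (V := V) k n).map_sub h g).symm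
  rw [this]
  exact norm_weightedDeriv_le k n _

variable {α : Type} [TopologicalSpace α] [SecondCountableTopology α] [MeasurableSpace α]
  [OpensMeasurableSpace α] {μ : Measure α}

theorem integrable_weightedDeriv {h : α → 𝓢(V, ℂ)} (hc : Continuous h) {k n : ℕ} {B : α → ℝ}
    (hB : Integrable B μ) (hle : ∀ w, SchwartzMap.seminorm ℂ k n (h w) ≤ B w) :
    Integrable (fun w ↦ weightedDeriv k n (h w)) μ :=
  hB.mono' ((continuous_weightedDeriv k n).comp hc).aestronglyMeasurable
    (Filter.Eventually.of_forall fun w ↦ (norm_weightedDeriv_le k n _).trans (hle w))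

/-- Differentiation under the integral sign. It is stated after evaluation at a vector because the
induction on the order of differentiation compares multilinear maps by evaluating them. -/
theorem fderiv_integral_apply {G : Type} [NormedAddCommGroup G] [NormedSpace ℝ G]
    {F : α → V → G} (hd : ∀ w x, DifferentiableAt ℝ (F w) x) (hint : ∀ x, Integrable (F · x) μ)
    (hm : ∀ x, AEStronglyMeasurable (fun w ↦ fderiv ℝ (F w) x) μ) {B : α → ℝ}
    (hB : Integrable B μ) (hle : ∀ w x, ‖fderiv ℝ (F w) x‖ ≤ B w) (x v : V) :
    Integrable (fun w ↦ fderiv ℝ (F w) x v) μ ∧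
    fderiv ℝ (fun x ↦ ∫ w, F w x ∂μ) x v = ∫ w, fderiv ℝ (F w) x v ∂μ := by
  have h1 : Integrable (fun w ↦ fderiv ℝ (F w) x) μ :=
    hB.mono' (hm x) (Filter.Eventually.of_forall fun w ↦ hle w x)
  refine ⟨h1.apply_continuousLinearMap v, ?_⟩
  have hkey : HasFDerivAt (fun x ↦ ∫ w, F w x ∂μ) (∫ w, fderiv ℝ (F w) x ∂μ) x :=
    hasFDerivAt_integral_of_dominated_of_fderiv_le (s := Set.univ) (bound := B)
      (F' := fun x w ↦ fderiv ℝ (F w) x) Filter.univ_mem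
      (Filter.Eventually.of_forall fun x ↦ (hint x).aestronglyMeasurable) (hint x) (hm x)
      (Filter.Eventually.of_forall fun w x _ ↦ hle w x) hB
      (Filter.Eventually.of_forall fun w x _ ↦ (hd w x).hasFDerivAt)
  rw [hkey.fderiv, ContinuousLinearMap.integral_apply h1]

/-- The integrable bound on the `(0, n + 1)` seminorm dominates the next derivative uniformly in the
point, so each induction step differentiates under the integral. -/
theorem iteratedFDeriv_integral_schwartz {h : α → 𝓢(V, ℂ)} (hc : Continuous h)
    (hB : ∀ k n, ∃ B : α → ℝ, Integrable B μ ∧ ∀ w, SchwartzMap.seminorm ℂ k n (h w) ≤ B w)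
    {g : 𝓢(V, ℂ)} (hg : ∀ t, g t = ∫ w, h w t ∂μ) (n : ℕ) :
    ∀ t, iteratedFDeriv ℝ n g t = ∫ w, iteratedFDeriv ℝ n (h w) t ∂μ := by
  have hint : ∀ n t, Integrable (fun w ↦ iteratedFDeriv ℝ n (h w) t) μ := by
    intro n t
    obtain ⟨B, hB, hle⟩ := hB 0 n
    have := (BoundedContinuousFunction.evalCLM ℂ t).integrable_comp
      (integrable_weightedDeriv hc hB hle)
    simpa [weightedDeriv_apply] using this
  induction n with
  | zero =>
    intro t
    ext m
    rw [iteratedFDeriv_zero_apply, hg]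
    have h1 := (ContinuousMultilinearMap.apply ℝ (fun _ : Fin 0 ↦ V) ℂ m).integral_comp_comm
      (hint 0 t)
    simpa using h1
  | succ n ih =>
    intro t
    obtain ⟨B, hB, hle⟩ := hB 0 (n + 1)
    have hd : ∀ f : 𝓢(V, ℂ), ∀ x, DifferentiableAt ℝ (iteratedFDeriv ℝ n f) x := fun f x ↦
      ((f.smooth ⊤).differentiable_iteratedFDeriv (m := n) (mod_cast WithTop.coe_lt_top n)) x
    have he : ∀ f : 𝓢(V, ℂ), ∀ x, fderiv ℝ (iteratedFDeriv ℝ n f) x =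
        continuousMultilinearCurryLeftEquiv ℝ (fun _ ↦ V) ℂ (iteratedFDeriv ℝ (n + 1) f x) := by
      intro f x
      rw [iteratedFDeriv_succ_eq_comp_left]
      simp
    have hm : ∀ x, AEStronglyMeasurable (fun w ↦ fderiv ℝ (iteratedFDeriv ℝ n (h w)) x) μ := by
      intro x
      simp_rw [he]
      exact (continuousMultilinearCurryLeftEquiv ℝ (fun _ ↦ V) ℂ).continuous.comp_aestronglyMeasurable
        (hint (n + 1) x).aestronglyMeasurable
    have hb : ∀ w x, ‖fderiv ℝ (iteratedFDeriv ℝ n (h w)) x‖ ≤ B w := by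
      intro w x
      rw [he, LinearIsometryEquiv.norm_map]
      exact (SchwartzMap.norm_iteratedFDeriv_le_seminorm ℂ (h w) (n + 1) x).trans (hle w)
    have h2 := fun v ↦ fderiv_integral_apply (fun w x ↦ hd (h w) x) (hint n) hm hB hb t v
    rw [← show iteratedFDeriv ℝ n g = _ from funext ih] at h2
    ext m
    have h3 := (ContinuousMultilinearMap.apply ℝ (fun _ : Fin (n + 1) ↦ V) ℂ m).integral_comp_comm
      (hint (n + 1) t)
    have h4 := (ContinuousMultilinearMap.apply ℝ (fun _ : Fin n ↦ V) ℂ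
      (Fin.tail m)).integral_comp_comm (h2 (m 0)).1
    simp only [ContinuousMultilinearMap.apply_apply] at h3 h4
    rw [← h3, iteratedFDeriv_succ_apply_left, (h2 (m 0)).2, ← h4]
    rfl

/-- A tempered distribution commutes with an absolutely convergent integral of Schwartz
functions. -/
theorem distribution_integral (f : 𝓢'(V, ℂ)) {h : α → 𝓢(V, ℂ)} (hc : Continuous h)
    (hB : ∀ k n, ∃ B : α → ℝ, Integrable B μ ∧ ∀ w, SchwartzMap.seminorm ℂ k n (h w) ≤ B w)
    {g : 𝓢(V, ℂ)} (hg : ∀ t, g t = ∫ w, h w t ∂μ) : f g = ∫ w, f (h w) ∂μ := by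
  have hfc : Continuous (fun g ↦ f g) := map_continuous f
  -- The Schwartz space is not normed, so the Bochner integral is taken elsewhere: `f` is controlled
  -- by finitely many seminorms, hence factors through the map `ι` into a finite product of Banach
  -- spaces of bounded continuous functions.
  obtain ⟨s, C, hC, hle⟩ := Seminorm.bound_of_continuous (schwartz_withSeminorms ℂ V ℂ)
    ((normSeminorm ℂ ℂ).comp (f : 𝓢(V, ℂ) →ₗ[ℂ] ℂ)) (continuous_norm.comp hfc)
  let X := ∀ i : s, BddCont V (V [×i.1.2]→L[ℝ] ℂ)
  let ι : 𝓢(V, ℂ) →ₗ[ℂ] X := LinearMap.pi fun i ↦ weightedDerivLM i.1.1 i.1.2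
  have hι : ∀ g, ‖f g‖ ≤ C * ‖ι g‖ := by
    intro g
    refine (hle g).trans ?_
    change (C : ℝ) * _ ≤ _
    gcongr
    refine Seminorm.finset_sup_apply_le (norm_nonneg _) fun i hi ↦ ?_
    refine (seminorm_le_norm_weightedDeriv i.1 i.2 g).trans ?_
    exact norm_le_pi_norm (ι g) ⟨i, hi⟩
  have hker : LinearMap.ker ι ≤ LinearMap.ker (f : 𝓢(V, ℂ) →ₗ[ℂ] ℂ) := by
    intro g hg
    have h1 := hι g
    rw [LinearMap.mem_ker.1 hg, norm_zero (E := X), mul_zero] at h1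
    exact LinearMap.mem_ker.2 (norm_le_zero_iff.1 h1)
  let L0 : LinearMap.range ι →ₗ[ℂ] ℂ :=
    ((LinearMap.ker ι).liftQ (f : 𝓢(V, ℂ) →ₗ[ℂ] ℂ) hker) ∘ₗ
      (ι.quotKerEquivRange.symm : LinearMap.range ι →ₗ[ℂ] _)
  have hL0 : ∀ g, L0 ⟨ι g, LinearMap.mem_range_self ι g⟩ = f g := by
    intro g
    have : ι.quotKerEquivRange.symm ⟨ι g, LinearMap.mem_range_self ι g⟩ =
        (LinearMap.ker ι).mkQ g := ι.quotKerEquivRange_symm_apply_image g _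
    simp only [L0, LinearMap.comp_apply, LinearEquiv.coe_coe, this]
    exact Submodule.liftQ_apply _ _ _
  -- Hahn–Banach extends the functional from the range of `ι` to the whole Banach space, where
  -- continuous functionals commute with the Bochner integral.
  obtain ⟨L, hL, -⟩ := exists_extension_norm_eq (LinearMap.range ι) (L0.mkContinuous C (by
    rintro ⟨_, g, rfl⟩
    rw [hL0]
    exact hι g))
  have hLι : ∀ g, L (ι g) = f g := fun g ↦ (hL ⟨ι g, LinearMap.mem_range_self ι g⟩).trans (hL0 g)
  have hint : ∀ i : s, Integrable (fun w ↦ ι (h w) i) μ := by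
    intro i
    obtain ⟨B, hB, hle⟩ := hB i.1.1 i.1.2
    exact integrable_weightedDeriv hc hB hle
  have hintX : Integrable (fun w ↦ ι (h w)) μ := Integrable.of_eval hint
  have hg' : ι g = ∫ w, ι (h w) ∂μ := by
    funext i
    have h1 := (ContinuousLinearMap.proj (R := ℂ) (φ := fun i : s ↦
      BddCont V (V [×i.1.2]→L[ℝ] ℂ)) i).integral_comp_comm hintX
    refine Eq.trans ?_ h1
    ext1 t
    have h2 := (BoundedContinuousFunction.evalCLM ℂ t).integral_comp_comm (hint i)
    refine Eq.trans ?_ h2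
    change ((‖t‖ ^ i.1.1 : ℝ) : ℂ) • iteratedFDeriv ℝ i.1.2 g t =
      ∫ w, ((‖t‖ ^ i.1.1 : ℝ) : ℂ) • iteratedFDeriv ℝ i.1.2 (h w) t ∂μ
    rw [iteratedFDeriv_integral_schwartz hc hB hg, integral_smul]
  rw [← hLι, hg', ← L.integral_comp_comm hintX]
  simp_rw [hLι]

end families

/-! ### Bounds and continuity of time-frequency shifts -/

section shifts
variable {V : Type} [NormedAddCommGroup V] [InnerProductSpace ℝ V]

/-- Peetre's inequality; it makes translation cost only a power of `1 + ‖x‖` in every Schwartz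
seminorm. -/
theorem one_add_norm_le_mul (t x : V) : 1 + ‖t‖ ≤ (1 + ‖x‖) * (1 + ‖t - x‖) := by
  have h : ‖t‖ ≤ ‖x‖ + ‖t - x‖ := by
    simpa using norm_add_le x (t - x)
  nlinarith [norm_nonneg x, norm_nonneg (t - x), mul_nonneg (norm_nonneg x) (norm_nonneg (t - x))]

theorem iteratedFDeriv_translation (n : ℕ) (x t : V) (g : 𝓢(V, ℂ)) :
    iteratedFDeriv ℝ n (SchwartzMap.compSubConstCLM ℂ x g) t = iteratedFDeriv ℝ n g (t - x) :=
  iteratedFDeriv_comp_sub n x t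

theorem seminorm_translation_le {k n K N : ℕ} (hk : k ≤ K) (hn : n ≤ N) (x : V) (g : 𝓢(V, ℂ)) :
    SchwartzMap.seminorm ℂ k n (SchwartzMap.compSubConstCLM ℂ x g) ≤ (1 + ‖x‖) ^ K *
      (2 ^ K * (Finset.Iic (K, N)).sup (schwartzSeminormFamily ℂ V ℂ) g) := by
  refine SchwartzMap.seminorm_le_bound ℂ k n _ (by positivity) fun t ↦ ?_
  rw [iteratedFDeriv_translation]
  have h1 : (1 + ‖t - x‖) ^ K * ‖iteratedFDeriv ℝ n g (t - x)‖ ≤ _ :=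
    SchwartzMap.one_add_le_sup_seminorm_apply (𝕜 := ℂ) (m := (K, N)) le_rfl hn g (t - x)
  have h2 : ‖t‖ ^ k ≤ (1 + ‖x‖) ^ K * (1 + ‖t - x‖) ^ K := by
    rw [← mul_pow]
    calc ‖t‖ ^ k ≤ (1 + ‖t‖) ^ k := by gcongr; linarith
      _ ≤ (1 + ‖t‖) ^ K := pow_le_pow_right₀ (by linarith [norm_nonneg t]) hk
      _ ≤ _ := by gcongr; exact one_add_norm_le_mul t x
  calc _ ≤ (1 + ‖x‖) ^ K * (1 + ‖t - x‖) ^ K * ‖iteratedFDeriv ℝ n g (t - x)‖ := by gcongr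
    _ = (1 + ‖x‖) ^ K * ((1 + ‖t - x‖) ^ K * ‖iteratedFDeriv ℝ n g (t - x)‖) := by ring
    _ ≤ _ := mul_le_mul_of_nonneg_left h1 (by positivity)

/-- Every continuous seminorm of `A a g` is bounded by a power of `1 + ‖a‖` times a continuous
seminorm of `g`. -/
def PolyBounded {β V W : Type} [Norm β] [NormedAddCommGroup V] [NormedSpace ℝ V]
    [NormedAddCommGroup W] [NormedSpace ℝ W] (A : β → 𝓢(V, ℂ) → 𝓢(W, ℂ)) : Prop :=
  ∀ q : Seminorm ℂ 𝓢(W, ℂ), Continuous q → ∃ (N : ℕ) (q' : Seminorm ℂ 𝓢(V, ℂ)), Continuous q' ∧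
    ∀ a g, q (A a g) ≤ (1 + ‖a‖) ^ N * q' g

theorem continuous_smul_sup (C : ℝ≥0) (s : Finset (ℕ × ℕ)) :
    Continuous (C • s.sup (schwartzSeminormFamily ℂ V ℂ) : Seminorm ℂ 𝓢(V, ℂ)) := by
  have h : Continuous (s.sup (schwartzSeminormFamily ℂ V ℂ) : Seminorm ℂ 𝓢(V, ℂ)) := by
    induction s using Finset.cons_induction with
    | empty => exact continuous_const
    | cons i s hi ih =>
      rw [Finset.sup_cons]
      exact ((schwartz_withSeminorms ℂ V ℂ).continuous_seminorm i).sup ih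
  exact h.const_smul C

theorem norm_translate_sub_le {G : Type} [NormedAddCommGroup G] [NormedSpace ℝ G] {F : V → G}
    (hF : Differentiable ℝ F) {c D r : ℝ} (hc : 0 ≤ c) {t x₀ x : V}
    (h : ∀ y ∈ Metric.ball x₀ r, c * ‖fderiv ℝ F (t - y)‖ ≤ D) (hx : x ∈ Metric.ball x₀ r) :
    c * ‖F (t - x) - F (t - x₀)‖ ≤ D * ‖x - x₀‖ := by
  have hd : ∀ y, HasFDerivAt (fun y ↦ c • F (t - y)) (c • -(fderiv ℝ F (t - y))) y := by
    intro y
    have h1 : HasFDerivAt (fun y : V ↦ t - y) (-ContinuousLinearMap.id ℝ V) y :=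
      (hasFDerivAt_id y).const_sub t
    have h2 := (hF (t - y)).hasFDerivAt.comp y h1
    refine (h2.const_smul c).congr_fderiv ?_
    ext v
    simp
  have h := (convex_ball x₀ r).norm_image_sub_le_of_norm_fderiv_le
    (fun y _ ↦ (hd y).differentiableAt) (fun y hy ↦ by
      rw [(hd y).fderiv, norm_smul, norm_neg, Real.norm_of_nonneg hc]
      exact h y hy) (Metric.mem_ball_self (Metric.pos_of_mem_ball hx)) hx
  rwa [← smul_sub, norm_smul, Real.norm_of_nonneg hc] at h

theorem polyBounded_translation :
    PolyBounded (fun (x : V) (g : 𝓢(V, ℂ)) ↦ SchwartzMap.compSubConstCLM ℂ x g) := by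
  intro q hq
  obtain ⟨s, C, -, hle⟩ := Seminorm.bound_of_continuous (schwartz_withSeminorms ℂ V ℂ) q hq
  set K := (s.sup id).1
  set N := (s.sup id).2
  refine ⟨K, (C * 2 ^ K) • (Finset.Iic (K, N)).sup (schwartzSeminormFamily ℂ V ℂ),
    continuous_smul_sup _ _, fun x g ↦ (hle _).trans ?_⟩
  change (C : ℝ) * _ ≤ (1 + ‖x‖) ^ K * (((C * 2 ^ K : ℝ≥0) : ℝ) * _)
  have : s.sup (schwartzSeminormFamily ℂ V ℂ) (SchwartzMap.compSubConstCLM ℂ x g) ≤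
      (1 + ‖x‖) ^ K * (2 ^ K * (Finset.Iic (K, N)).sup (schwartzSeminormFamily ℂ V ℂ) g) := by
    refine Seminorm.finset_sup_apply_le (by positivity) fun i hi ↦ ?_
    have hi' : i ≤ s.sup id := Finset.le_sup (f := id) hi
    exact seminorm_translation_le hi'.1 hi'.2 x g
  calc _ ≤ (C : ℝ) * ((1 + ‖x‖) ^ K *
      (2 ^ K * (Finset.Iic (K, N)).sup (schwartzSeminormFamily ℂ V ℂ) g)) := by gcongr
    _ = _ := by push_cast; ring

theorem continuous_translation (g : 𝓢(V, ℂ)) :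
    Continuous (fun x : V ↦ SchwartzMap.compSubConstCLM ℂ x g) := by
  refine continuous_iff_continuousAt.2 fun x₀ ↦
    ((schwartz_withSeminorms ℂ V ℂ).tendsto_nhds _ _).2 fun i ε hε ↦ ?_
  obtain ⟨k, n⟩ := i
  -- A Lipschitz constant on the unit ball around `x₀`: the mean value inequality costs one
  -- derivative, and `1 + ‖y‖ ≤ 2 + ‖x₀‖` there.
  set D := (2 + ‖x₀‖) ^ k *
    (2 ^ k * (Finset.Iic (k, n + 1)).sup (schwartzSeminormFamily ℂ V ℂ) g)
  have hD : 0 ≤ D := by positivity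
  have hmv : ∀ x ∈ Metric.ball x₀ 1, SchwartzMap.seminorm ℂ k n
      (SchwartzMap.compSubConstCLM ℂ x g - SchwartzMap.compSubConstCLM ℂ x₀ g) ≤
        D * ‖x - x₀‖ := by
    intro x hx
    refine SchwartzMap.seminorm_le_bound ℂ k n _ (by positivity) fun t ↦ ?_
    have e1 : iteratedFDeriv ℝ n
        (SchwartzMap.compSubConstCLM ℂ x g - SchwartzMap.compSubConstCLM ℂ x₀ g : 𝓢(V, ℂ)) t =
        iteratedFDeriv ℝ n g (t - x) - iteratedFDeriv ℝ n g (t - x₀) := by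
      rw [← iteratedFDeriv_translation, ← iteratedFDeriv_translation]
      exact iteratedFDeriv_sub_apply ((SchwartzMap.smooth _ n).contDiffAt)
        ((SchwartzMap.smooth _ n).contDiffAt)
    have hdg : Differentiable ℝ (iteratedFDeriv ℝ n g) :=
      (g.smooth ⊤).differentiable_iteratedFDeriv (m := n) (mod_cast WithTop.coe_lt_top n)
    have hb : ∀ y ∈ Metric.ball x₀ 1,
        ‖t‖ ^ k * ‖fderiv ℝ (iteratedFDeriv ℝ n g) (t - y)‖ ≤ D := by
      intro y hy
      rw [norm_fderiv_iteratedFDeriv, ← iteratedFDeriv_translation]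
      refine (SchwartzMap.le_seminorm ℂ k (n + 1) _ t).trans
        ((seminorm_translation_le le_rfl le_rfl y g).trans ?_)
      have : ‖y‖ ≤ 1 + ‖x₀‖ := by
        rw [mem_ball_iff_norm] at hy
        linarith [norm_sub_norm_le y x₀]
      have h3 : 1 + ‖y‖ ≤ 2 + ‖x₀‖ := by linarith
      exact mul_le_mul_of_nonneg_right (pow_le_pow_left₀ (by positivity) h3 k) (by positivity)
    rw [e1]
    exact norm_translate_sub_le hdg (by positivity) hb hx
  have h0 : Filter.Tendsto (fun x ↦ D * ‖x - x₀‖) (nhds x₀) (nhds 0) := by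
    have : Continuous (fun x ↦ D * ‖x - x₀‖) := by fun_prop
    simpa using this.tendsto x₀
  filter_upwards [h0.eventually_lt_const hε, Metric.ball_mem_nhds x₀ one_pos] with x hx hx1
  exact (hmv x hx1).trans_lt hx

variable [FiniteDimensional ℝ V] [MeasurableSpace V] [BorelSpace V]

/-- Multiplication by the character of frequency `ω`. -/
def modulation (ω : V) : 𝓢(V, ℂ) →L[ℂ] 𝓢(V, ℂ) :=
  SchwartzMap.smulLeftCLM ℂ (fun t : V ↦ ((𝐞 (⟪ω, t⟫) : Circle) : ℂ))

theorem modulation_apply (ω : V) (g : 𝓢(V, ℂ)) (t : V) :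
    modulation ω g t = 𝐞 (⟪ω, t⟫) • g t := by
  rw [modulation, SchwartzMap.smulLeftCLM_apply_apply (hasTemperateGrowth_character ω)]
  rfl

theorem tfShift_eq (x ω : V) (g : 𝓢(V, ℂ)) :
    tfShift x ω g = modulation ω (SchwartzMap.compSubConstCLM ℂ x g) := rfl

theorem tfShift_apply' (x ω : V) (g : 𝓢(V, ℂ)) (t : V) :
    tfShift x ω g t = 𝐞 (⟪ω, t⟫) • g (t - x) := by
  rw [tfShift_eq, modulation_apply]; rfl

theorem fourier_modulation (ω : V) (g : 𝓢(V, ℂ)) :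
    𝓕 (modulation ω g) = SchwartzMap.compSubConstCLM ℂ ω (𝓕 g) := by
  ext ξ
  rw [SchwartzMap.compSubConstCLM_apply, SchwartzMap.fourier_coe, SchwartzMap.fourier_coe,
    Real.fourier_eq, Real.fourier_eq]
  congr 1
  ext t
  rw [modulation_apply, smul_smul, ← AddChar.map_add_eq_mul]
  congr 2
  rw [inner_sub_right, real_inner_comm t ω]
  abel

/-- The Fourier transform conjugates modulations to translations, so seminorm bounds and continuity
are inherited from the translation case. -/
theorem modulation_eq (ω : V) (g : 𝓢(V, ℂ)) :
    modulation ω g = 𝓕⁻ (SchwartzMap.compSubConstCLM ℂ ω (𝓕 g)) := by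
  rw [← fourier_modulation, FourierTransform.fourierInv_fourier_eq]

theorem continuous_fourierInv_schwartz : Continuous (fun g : 𝓢(V, ℂ) ↦ 𝓕⁻ g) :=
  (FourierTransform.fourierCLE ℂ 𝓢(V, ℂ) (F := 𝓢(V, ℂ))).symm.continuous

theorem polyBounded_modulation : PolyBounded (fun (ω : V) (g : 𝓢(V, ℂ)) ↦ modulation ω g) := by
  intro q hq
  let e := FourierTransform.fourierCLE ℂ 𝓢(V, ℂ) (F := 𝓢(V, ℂ))
  obtain ⟨N, q', hq', hle⟩ := polyBounded_translation (q.comp (e.symm : 𝓢(V, ℂ) →ₗ[ℂ] 𝓢(V, ℂ)))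
    (hq.comp e.symm.continuous)
  refine ⟨N, q'.comp (e : 𝓢(V, ℂ) →ₗ[ℂ] 𝓢(V, ℂ)), hq'.comp e.continuous, fun ω g ↦ ?_⟩
  beta_reduce
  rw [modulation_eq]
  exact hle ω (𝓕 g)

theorem continuous_modulation (g : 𝓢(V, ℂ)) : Continuous (fun ω : V ↦ modulation ω g) := by
  simp_rw [modulation_eq]
  exact continuous_fourierInv_schwartz.comp (continuous_translation (𝓕 g))

/-- Time-frequency shifts, indexed by points of the product `V × V`. -/
def tf (z : V × V) (g : 𝓢(V, ℂ)) : 𝓢(V, ℂ) := tfShift z.1 z.2 g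

theorem polyBounded_tf : PolyBounded (tf : V × V → 𝓢(V, ℂ) → 𝓢(V, ℂ)) := by
  intro q hq
  obtain ⟨N, q', hq', h1⟩ := polyBounded_modulation q hq
  obtain ⟨N', q'', hq'', h2⟩ := polyBounded_translation q' hq'
  refine ⟨N + N', q'', hq'', fun z g ↦ (h1 z.2 _).trans ?_⟩
  have h3 : ‖z.1‖ ≤ ‖z‖ := _root_.norm_fst_le z
  have h4 : ‖z.2‖ ≤ ‖z‖ := _root_.norm_snd_le z
  calc _ ≤ (1 + ‖z.2‖) ^ N * ((1 + ‖z.1‖) ^ N' * q'' g) := by gcongr; exact h2 _ _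
    _ ≤ (1 + ‖z‖) ^ N * ((1 + ‖z‖) ^ N' * q'' g) := by gcongr
    _ = _ := by ring

/-- Separate continuity in position and frequency becomes joint continuity because modulations are
equicontinuous locally in the frequency, by `polyBounded_modulation`. -/
theorem continuous_tf (g : 𝓢(V, ℂ)) : Continuous (fun z : V × V ↦ tf z g) := by
  refine continuous_iff_continuousAt.2 fun z₀ ↦
    ((schwartz_withSeminorms ℂ V ℂ).tendsto_nhds _ _).2 fun i ε hε ↦ ?_
  set q := schwartzSeminormFamily ℂ V ℂ i
  have hq : Continuous q := (schwartz_withSeminorms ℂ V ℂ).continuous_seminorm i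
  obtain ⟨N, q', hq', h1⟩ := polyBounded_modulation q hq
  set g₀ := SchwartzMap.compSubConstCLM ℂ z₀.1 g
  have hc : Continuous (fun z : V × V ↦
      (1 + ‖z.2‖) ^ N * q' (SchwartzMap.compSubConstCLM ℂ z.1 g - g₀) +
        q (modulation z.2 g₀ - modulation z₀.2 g₀)) := by
    have h5 := (continuous_translation g).comp (continuous_fst (X := V) (Y := V))
    have h6 := (continuous_modulation g₀).comp (continuous_snd (X := V) (Y := V))
    have h7 := hq'.comp (h5.sub (continuous_const : Continuous fun _ ↦ g₀))
    have h8 := hq.comp (h6.sub (continuous_const : Continuous fun _ ↦ modulation z₀.2 g₀))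
    exact (((continuous_const.add continuous_snd.norm).pow N).mul h7).add h8
  have h0 := hc.tendsto z₀
  simp only [g₀, sub_self, map_zero, mul_zero, add_zero] at h0
  filter_upwards [h0.eventually_lt_const hε] with z hz
  refine lt_of_le_of_lt ?_ hz
  have e : tf z g - tf z₀ g = modulation z.2 (SchwartzMap.compSubConstCLM ℂ z.1 g - g₀) +
      (modulation z.2 g₀ - modulation z₀.2 g₀) := by
    rw [map_sub]
    change modulation z.2 _ - modulation z₀.2 _ = _
    abel
  rw [e]
  exact (map_add_le_add q _ _).trans (add_le_add (h1 _ _) le_rfl)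

end shifts

/-! ### Decay and inversion of the short-time Fourier transform -/

section inversion
variable {V : Type} [NormedAddCommGroup V] [InnerProductSpace ℝ V] [FiniteDimensional ℝ V]
  [MeasurableSpace V] [BorelSpace V]

instance isAddHaarMeasure_volume_prod : (volume : Measure (V × V)).IsAddHaarMeasure := by
  rw [Measure.volume_eq_prod]
  infer_instance

/-- The `L²` inner product of Schwartz functions, linear in the first argument. -/
def ip (f g : 𝓢(V, ℂ)) : ℂ := ∫ t, f t * conj (g t)

theorem integrable_mul_conj (f g : 𝓢(V, ℂ)) : Integrable (fun t ↦ f t * conj (g t)) :=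
  (SchwartzMap.pairing (ContinuousLinearMap.mul ℂ ℂ) f (conjS g)).integrable

theorem ip_add_left (f g h : 𝓢(V, ℂ)) : ip (f + g) h = ip f h + ip g h := by
  rw [ip, ip, ip, ← integral_add (integrable_mul_conj f h) (integrable_mul_conj g h)]
  simp [add_mul]

theorem ip_smul_left (c : ℂ) (f h : 𝓢(V, ℂ)) : ip (c • f) h = c * ip f h := by
  rw [ip, ip, ← integral_const_mul]
  simp [mul_assoc]

theorem ip_smul_right (c : ℂ) (f h : 𝓢(V, ℂ)) : ip f (c • h) = conj c * ip f h := by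
  rw [ip, ip, ← integral_const_mul]
  congr 1; ext t
  simp only [smul_apply, smul_eq_mul, map_mul]
  ring

theorem conj_ip (f g : 𝓢(V, ℂ)) : conj (ip f g) = ip g f := by
  rw [ip, ip, ← integral_conj]
  simp [mul_comm]

theorem ip_self (f : 𝓢(V, ℂ)) : ip f f = ((∫ t, ‖f t‖ ^ 2 : ℝ) : ℂ) := by
  rw [ip, ← integral_complex_ofReal]
  congr 1; ext t
  rw [Complex.mul_conj, Complex.normSq_eq_norm_sq]

theorem ip_self_ne_zero {f : 𝓢(V, ℂ)} (hf : f ≠ 0) : ip f f ≠ 0 := by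
  rw [ip_self, Ne, Complex.ofReal_eq_zero]
  have hint : Integrable (fun t ↦ ‖f t‖ ^ 2) := by
    refine (integrable_mul_conj f f).norm.congr (Filter.Eventually.of_forall fun t ↦ ?_)
    simp [sq]
  rw [integral_eq_zero_iff_of_nonneg (fun t ↦ by positivity) hint]
  intro h
  apply hf
  have h2 : (fun t ↦ ‖f t‖ ^ 2) = 0 :=
    Continuous.ae_eq_iff_eq volume (f.continuous.norm.pow 2) continuous_const |>.1 h
  ext t
  simpa using congrFun h2 t

theorem bracket_toDist_eq (f g : 𝓢(V, ℂ)) : bracket (toDist f) g = ip f g := bracket_toDist f g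

theorem conjS_tf (z : V × V) (g : 𝓢(V, ℂ)) : conjS (tf z g) = tf (z.1, -z.2) (conjS g) := by
  ext t
  rw [conjS_apply, tf, tf, tfShift_apply', tfShift_apply', conjS_apply, Circle.smul_def,
    Circle.smul_def, inner_neg_left, AddChar.map_neg_eq_inv, Circle.coe_inv_eq_conj]
  simp

theorem conjS_smul (c : ℂ) (g : 𝓢(V, ℂ)) : conjS (c • g) = conj c • conjS g := by
  ext t
  simp [conjS_apply]

theorem bracket_smul_right (f : 𝓢'(V, ℂ)) (c : ℂ) (g : 𝓢(V, ℂ)) :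
    bracket f (c • g) = conj c * bracket f g := by
  rw [bracket, conjS_smul, map_smul, smul_eq_mul, bracket]

theorem continuous_bracket_tf (f : 𝓢'(V, ℂ)) (g : 𝓢(V, ℂ)) :
    Continuous (fun z : V × V ↦ bracket f (tf z g)) := by
  simp_rw [bracket, conjS_tf]
  have h : Continuous (fun z : V × V ↦ ((z.1, -z.2) : V × V)) := by fun_prop
  exact (map_continuous f).comp ((continuous_tf (conjS g)).comp h)

theorem continuous_ip_tf (f g : 𝓢(V, ℂ)) : Continuous (fun z : V × V ↦ ip f (tf z g)) := by
  simp_rw [← bracket_toDist_eq]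
  exact continuous_bracket_tf _ _

theorem norm_tf_apply (z : V × V) (g : 𝓢(V, ℂ)) (t : V) : ‖tf z g t‖ = ‖g (t - z.1)‖ := by
  rw [tf, tfShift_apply', Circle.norm_smul]

/-- On the Fourier side a time-frequency shift is, up to a phase, translation by its frequency. With
Plancherel this turns spatial decay estimates into decay in the frequency variable. -/
theorem norm_fourier_tf (z : V × V) (g : 𝓢(V, ℂ)) (ξ : V) :
    ‖𝓕 (tf z g) ξ‖ = ‖𝓕 g (ξ - z.2)‖ := by
  rw [tf, tfShift_eq, fourier_modulation, SchwartzMap.compSubConstCLM_apply,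
    SchwartzMap.fourier_coe, SchwartzMap.fourier_coe, Real.fourier_eq, Real.fourier_eq]
  rw [← integral_add_right_eq_self _ z.1, ← Circle.norm_smul (𝐞 ⟪z.1, ξ - z.2⟫),
    Circle.smul_def, ← integral_smul]
  congr 2
  ext t
  rw [SchwartzMap.compSubConstCLM_apply, add_sub_cancel_right, ← Circle.smul_def, smul_smul,
    ← AddChar.map_add_eq_mul]
  congr 2
  rw [inner_add_left]
  ring

theorem ip_fourier (f g : 𝓢(V, ℂ)) : ip (𝓕 f) (𝓕 g) = ip f g := by
  have h := SchwartzMap.integral_sesq_fourier_fourier g f (innerSL ℂ : ℂ →L⋆[ℂ] ℂ →L[ℂ] ℂ)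
  simpa [ip, innerSL_apply_apply, RCLike.inner_apply] using h

theorem exists_seminorm_integral_norm (M : ℕ) : ∃ q : Seminorm ℂ 𝓢(V, ℂ), Continuous q ∧
    ∀ g, Integrable (fun t ↦ (1 + ‖t‖) ^ M * ‖g t‖) ∧ ∫ t, (1 + ‖t‖) ^ M * ‖g t‖ ≤ q g := by
  set r := Module.finrank ℝ V + 1
  have hI : Integrable (fun t : V ↦ (1 + ‖t‖) ^ (-(r : ℝ))) :=
    integrable_one_add_norm (by simp [r])
  set I : ℝ≥0 := (∫ t : V, (1 + ‖t‖) ^ (-(r : ℝ))).toNNReal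
  have hI0 : (I : ℝ) = ∫ t : V, (1 + ‖t‖) ^ (-(r : ℝ)) :=
    Real.coe_toNNReal _ (integral_nonneg fun t ↦ by positivity)
  refine ⟨(I * 2 ^ (M + r)) • (Finset.Iic (M + r, 0)).sup (schwartzSeminormFamily ℂ V ℂ),
    continuous_smul_sup _ _, fun g ↦ ?_⟩
  set D := 2 ^ (M + r) * (Finset.Iic (M + r, 0)).sup (schwartzSeminormFamily ℂ V ℂ) g
  have hb : ∀ t, (1 + ‖t‖) ^ M * ‖g t‖ ≤ (1 + ‖t‖) ^ (-(r : ℝ)) * D := by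
    intro t
    have h1 : (1 + ‖t‖) ^ (M + r) * ‖iteratedFDeriv ℝ 0 g t‖ ≤ D :=
      SchwartzMap.one_add_le_sup_seminorm_apply (𝕜 := ℂ) (m := (M + r, 0)) le_rfl le_rfl g t
    rw [norm_iteratedFDeriv_zero, pow_add] at h1
    rw [Real.rpow_neg (by positivity), Real.rpow_natCast, inv_mul_eq_div,
      le_div_iff₀ (by positivity)]
    linarith
  have hint : Integrable (fun t ↦ (1 + ‖t‖) ^ M * ‖g t‖) := by
    refine (hI.mul_const D).mono' ?_ (Filter.Eventually.of_forall fun t ↦ ?_)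
    · exact (((continuous_const.add continuous_norm).pow M).mul
        g.continuous.norm).aestronglyMeasurable
    · rw [Real.norm_of_nonneg (by positivity)]
      exact hb t
  refine ⟨hint, (integral_mono hint (hI.mul_const D) hb).trans (le_of_eq ?_)⟩
  rw [integral_mul_const, ← hI0]
  change _ = ((I * 2 ^ (M + r) : ℝ≥0) : ℝ) * _
  push_cast
  ring

theorem exists_seminorm_integral_translate (φ : 𝓢(V, ℂ)) (M : ℕ) :
    ∃ q : Seminorm ℂ 𝓢(V, ℂ), Continuous q ∧
      ∀ g x, (1 + ‖x‖) ^ M * ∫ t, ‖g t‖ * ‖φ (t - x)‖ ≤ q g := by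
  obtain ⟨q, hq, hle⟩ := exists_seminorm_integral_norm (V := V) M
  set C : ℝ≥0 := (2 ^ M * (Finset.Iic (M, 0)).sup (schwartzSeminormFamily ℂ V ℂ) φ).toNNReal
  have hC0 : (C : ℝ) = 2 ^ M * (Finset.Iic (M, 0)).sup (schwartzSeminormFamily ℂ V ℂ) φ :=
    Real.coe_toNNReal _ (by positivity)
  refine ⟨C • q, hq.const_smul C, fun g x ↦ ?_⟩
  have hC : ∀ s, (1 + ‖s‖) ^ M * ‖φ s‖ ≤ C := by
    intro s
    have h1 : (1 + ‖s‖) ^ M * ‖iteratedFDeriv ℝ 0 φ s‖ ≤ _ :=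
      SchwartzMap.one_add_le_sup_seminorm_apply (𝕜 := ℂ) (m := (M, 0)) le_rfl le_rfl φ s
    rw [norm_iteratedFDeriv_zero] at h1
    rw [hC0]
    exact h1
  obtain ⟨h1, h2⟩ := hle g
  rw [← integral_const_mul]
  calc _ ≤ ∫ t, C * ((1 + ‖t‖) ^ M * ‖g t‖) := by
        refine integral_mono_of_nonneg (Filter.Eventually.of_forall fun t ↦ by positivity)
          (h1.const_mul _) (Filter.Eventually.of_forall fun t ↦ ?_)
        have h3 : (1 + ‖x‖) ^ M ≤ (1 + ‖t‖) ^ M * (1 + ‖t - x‖) ^ M := by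
          rw [← mul_pow, norm_sub_rev]
          gcongr
          exact one_add_norm_le_mul x t
        calc (1 + ‖x‖) ^ M * (‖g t‖ * ‖φ (t - x)‖)
            ≤ (1 + ‖t‖) ^ M * (1 + ‖t - x‖) ^ M * (‖g t‖ * ‖φ (t - x)‖) := by gcongr
          _ = ((1 + ‖t‖) ^ M * ‖g t‖) * ((1 + ‖t - x‖) ^ M * ‖φ (t - x)‖) := by ring
          _ ≤ ((1 + ‖t‖) ^ M * ‖g t‖) * C := by gcongr; exact hC _
          _ = _ := mul_comm _ _
    _ = C * ∫ t, (1 + ‖t‖) ^ M * ‖g t‖ := integral_const_mul _ _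
    _ ≤ C * q g := by gcongr

/-- Rapid decay of the short-time Fourier transform of a Schwartz function. -/
theorem exists_seminorm_ip_tf (φ : 𝓢(V, ℂ)) (M : ℕ) :
    ∃ q : Seminorm ℂ 𝓢(V, ℂ), Continuous q ∧
      ∀ g z, (1 + ‖z‖) ^ M * ‖ip g (tf z φ)‖ ≤ q g := by
  obtain ⟨q₁, hq₁, h1⟩ := exists_seminorm_integral_translate φ M
  obtain ⟨q₂, hq₂, h2⟩ := exists_seminorm_integral_translate (𝓕 φ) M
  let e := FourierTransform.fourierCLE ℂ 𝓢(V, ℂ) (F := 𝓢(V, ℂ))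
  refine ⟨q₁ + q₂.comp (e : 𝓢(V, ℂ) →ₗ[ℂ] 𝓢(V, ℂ)), hq₁.add (hq₂.comp e.continuous),
    fun g z ↦ ?_⟩
  change _ ≤ q₁ g + q₂ (𝓕 g)
  have h3 : ‖ip g (tf z φ)‖ ≤ ∫ t, ‖g t‖ * ‖φ (t - z.1)‖ := by
    refine (norm_integral_le_integral_norm _).trans (le_of_eq ?_)
    congr 1; ext t
    rw [norm_mul, RCLike.norm_conj, norm_tf_apply]
  have h4 : ‖ip g (tf z φ)‖ ≤ ∫ t, ‖𝓕 g t‖ * ‖𝓕 φ (t - z.2)‖ := by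
    rw [← ip_fourier]
    refine (norm_integral_le_integral_norm _).trans (le_of_eq ?_)
    congr 1; ext t
    rw [norm_mul, RCLike.norm_conj, norm_fourier_tf]
  -- The product norm is the maximum, so only the larger coordinate has to be beaten: the frequency
  -- by the estimate on the Fourier side, the position by the direct one.
  rcases le_total ‖z.1‖ ‖z.2‖ with h | h
  · rw [Prod.norm_def, max_eq_right h]
    calc _ ≤ (1 + ‖z.2‖) ^ M * ∫ t, ‖𝓕 g t‖ * ‖𝓕 φ (t - z.2)‖ := by gcongr
      _ ≤ q₂ (𝓕 g) := h2 _ _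
      _ ≤ _ := by linarith [apply_nonneg q₁ g]
  · rw [Prod.norm_def, max_eq_left h]
    calc _ ≤ (1 + ‖z.1‖) ^ M * ∫ t, ‖g t‖ * ‖φ (t - z.1)‖ := by gcongr
      _ ≤ q₁ g := h1 _ _
      _ ≤ _ := by linarith [apply_nonneg q₂ (𝓕 g)]

/-- Rapid decay of order `M + r`, with `r` one more than the dimension of the time-frequency plane,
leaves an integrable factor. -/
theorem exists_seminorm_integral_ip_tf (φ : 𝓢(V, ℂ)) (M : ℕ) :
    ∃ q : Seminorm ℂ 𝓢(V, ℂ), Continuous q ∧ ∃ B : V × V → ℝ, Integrable B ∧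
      (∀ z, 0 ≤ B z) ∧ ∀ g z, (1 + ‖z‖) ^ M * ‖ip g (tf z φ)‖ ≤ q g * B z := by
  set r := Module.finrank ℝ (V × V) + 1
  obtain ⟨q, hq, hle⟩ := exists_seminorm_ip_tf φ (M + r)
  refine ⟨q, hq, fun z ↦ (1 + ‖z‖) ^ (-(r : ℝ)), integrable_one_add_norm (by simp [r]),
    fun z ↦ by positivity, fun g z ↦ ?_⟩
  beta_reduce
  rw [Real.rpow_neg (by positivity), Real.rpow_natCast, ← div_eq_mul_inv,
      le_div_iff₀ (by positivity)]
  have := hle g z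
  rw [pow_add] at this
  linarith

theorem integrable_pow_mul_ip_tf (g φ : 𝓢(V, ℂ)) (M : ℕ) :
    Integrable (fun z : V × V ↦ (1 + ‖z‖) ^ M * ‖ip g (tf z φ)‖) := by
  obtain ⟨q, -, B, hB, -, hle⟩ := exists_seminorm_integral_ip_tf φ M
  refine (hB.const_mul (q g)).mono' ?_ (Filter.Eventually.of_forall fun z ↦ ?_)
  · exact (((continuous_const.add continuous_norm).pow M).mul
      (continuous_ip_tf g φ).norm).aestronglyMeasurable
  · rw [Real.norm_of_nonneg (by positivity)]
    exact hle g z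

theorem integrable_ip_tf (g φ : 𝓢(V, ℂ)) : Integrable (fun z : V × V ↦ ip g (tf z φ)) := by
  have h := integrable_pow_mul_ip_tf g φ 0
  simp only [pow_zero, one_mul] at h
  exact (integrable_norm_iff (continuous_ip_tf g φ).aestronglyMeasurable).1 h

theorem ip_tf_eq_fourier (g α : 𝓢(V, ℂ)) (x ω : V) : ip g (tf (x, ω) α) =
    𝓕 (SchwartzMap.pairing (ContinuousLinearMap.mul ℂ ℂ) g
      (conjS (SchwartzMap.compSubConstCLM ℂ x α))) ω := by
  rw [SchwartzMap.fourier_coe, Real.fourier_eq, ip]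
  congr 1; ext t
  rw [SchwartzMap.pairing_apply_apply, conjS_apply, tf, tfShift_apply',
    SchwartzMap.compSubConstCLM_apply, Circle.smul_def, Circle.smul_def, AddChar.map_neg_eq_inv,
    Circle.coe_inv_eq_conj, real_inner_comm]
  simp only [smul_eq_mul, map_mul, ContinuousLinearMap.mul_apply']
  ring

/-- The inversion formula of the short-time Fourier transform, pointwise. -/
theorem stft_inversion (g α β : 𝓢(V, ℂ)) (t : V) :
    ∫ z : V × V, ip g (tf z α) * tf z β t = ip β α * g t := by
  have hint : Integrable (fun z : V × V ↦ ip g (tf z α) * tf z β t) := by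
    have hc : Continuous (fun z : V × V ↦ tf z β t) := by
      have h2 : Continuous (fun f : 𝓢(V, ℂ) ↦ f t) := map_continuous (TemperedDistribution.delta t)
      exact h2.comp (continuous_tf β)
    refine (integrable_ip_tf g α).mul_bdd (c := SchwartzMap.seminorm ℂ 0 0 β)
      hc.aestronglyMeasurable (Filter.Eventually.of_forall fun z ↦ ?_)
    rw [norm_tf_apply]
    exact SchwartzMap.norm_le_seminorm ℂ β _
  rw [Measure.volume_eq_prod] at hint ⊢
  rw [integral_prod _ hint]
  -- For fixed `x`, the short-time Fourier transform is the Fourier transform of `g` times a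
  -- conjugated translate of `α`, so the integral over `ω` is Fourier inversion; the integral over
  -- `x` then produces `ip β α`.
  have h1 : ∀ x, ∫ ω, ip g (tf (x, ω) α) * tf (x, ω) β t =
      g t * (β (t - x) * conj (α (t - x))) := by
    intro x
    set k := SchwartzMap.pairing (ContinuousLinearMap.mul ℂ ℂ) g
      (conjS (SchwartzMap.compSubConstCLM ℂ x α))
    have h2 : 𝓕⁻ (𝓕 k) t = k t := by rw [FourierTransform.fourierInv_fourier_eq]
    rw [SchwartzMap.fourierInv_coe, Real.fourierInv_eq] at h2
    calc _ = ∫ ω, (𝐞 ⟪ω, t⟫ • 𝓕 k ω) * β (t - x) := by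
          congr 1; ext ω
          rw [ip_tf_eq_fourier, tf, tfShift_apply', Circle.smul_def, Circle.smul_def, smul_eq_mul,
            smul_eq_mul]
          ring
      _ = k t * β (t - x) := by rw [integral_mul_const, h2]
      _ = _ := by
          rw [SchwartzMap.pairing_apply_apply, conjS_apply, SchwartzMap.compSubConstCLM_apply]
          simp only [ContinuousLinearMap.mul_apply']
          ring
  simp_rw [h1]
  rw [integral_const_mul, mul_comm]
  congr 1
  exact integral_sub_left_eq_self (fun s ↦ β s * conj (α s)) volume t

/-- Continuity of `f` and `polyBounded_tf` give polynomial growth of the second factor, which the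
rapid decay of the first absorbs. -/
theorem integrable_conj_ip_mul_bracket (f : 𝓢'(V, ℂ)) (g α β : 𝓢(V, ℂ)) :
    Integrable (fun z : V × V ↦ conj (ip g (tf z α)) * bracket f (tf z β)) := by
  obtain ⟨N, q, -, hle⟩ := polyBounded_tf (V := V)
    ((normSeminorm ℂ ℂ).comp (f : 𝓢(V, ℂ) →ₗ[ℂ] ℂ)) (continuous_norm.comp (map_continuous f))
  refine ((integrable_pow_mul_ip_tf g α N).mul_const (q (conjS β))).mono' ?_
    (Filter.Eventually.of_forall fun z ↦ ?_)
  · exact (((Complex.continuous_conj.comp (continuous_ip_tf g α))).mul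
      (continuous_bracket_tf f β)).aestronglyMeasurable
  · have h1 : ‖bracket f (tf z β)‖ ≤ (1 + ‖((z.1, -z.2) : V × V)‖) ^ N * q (conjS β) := by
      rw [bracket, conjS_tf]
      exact hle _ _
    have h2 : ‖((z.1, -z.2) : V × V)‖ = ‖z‖ := by simp [Prod.norm_def]
    rw [h2] at h1
    rw [norm_mul, RCLike.norm_conj]
    calc _ ≤ ‖ip g (tf z α)‖ * ((1 + ‖z‖) ^ N * q (conjS β)) := by gcongr
      _ = _ := by ring

/-- The inversion formula of the short-time Fourier transform, tested against a tempered
distribution. -/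
theorem bracket_inversion (f : 𝓢'(V, ℂ)) (g α β : 𝓢(V, ℂ)) :
    conj (ip β α) * bracket f g = ∫ z : V × V, conj (ip g (tf z α)) * bracket f (tf z β) := by
  rw [← bracket_smul_right]
  -- The pointwise inversion formula is an absolutely convergent integral of Schwartz functions in
  -- every seminorm, so `f` may be applied under the integral.
  have h := distribution_integral (μ := (volume : Measure (V × V))) f
    (h := fun z ↦ conj (ip g (tf z α)) • tf (z.1, -z.2) (conjS β))
    (g := conjS (ip β α • g)) ?_ ?_ ?_
  · rw [bracket, h]
    congr 1; ext z
    rw [map_smul, smul_eq_mul, bracket, conjS_tf]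
  · have h2 : Continuous (fun z : V × V ↦ ((z.1, -z.2) : V × V)) := by fun_prop
    exact (Complex.continuous_conj.comp (continuous_ip_tf g α)).smul
      ((continuous_tf (conjS β)).comp h2)
  · intro k n
    obtain ⟨N, q, -, hle⟩ := polyBounded_tf (V := V) (SchwartzMap.seminorm ℂ k n)
      ((schwartz_withSeminorms ℂ V ℂ).continuous_seminorm (k, n))
    refine ⟨_, (integrable_pow_mul_ip_tf g α N).mul_const (q (conjS β)), fun z ↦ ?_⟩
    have h2 : ‖((z.1, -z.2) : V × V)‖ = ‖z‖ := by simp [Prod.norm_def]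
    have h1 := hle (z.1, -z.2) (conjS β)
    rw [h2] at h1
    rw [map_smul_eq_mul, RCLike.norm_conj]
    calc _ ≤ ‖ip g (tf z α)‖ * ((1 + ‖z‖) ^ N * q (conjS β)) := by gcongr
      _ = _ := by ring
  · intro t
    rw [conjS_apply, smul_apply, smul_eq_mul, ← stft_inversion, ← integral_conj]
    congr 1; ext z
    rw [map_mul, ← conjS_apply, conjS_tf]
    rfl

end inversion

/-! ### Moyal's formula and covariance of the `τ`-Wigner distribution -/

section composition
variable {V : Type} [NormedAddCommGroup V] [InnerProductSpace ℝ V] [FiniteDimensional ℝ V]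
  [MeasurableSpace V] [BorelSpace V]

theorem tf_apply (z : V × V) (g : 𝓢(V, ℂ)) (t : V) :
    tf z g t = 𝐞 ⟪z.2, t⟫ • g (t - z.1) := tfShift_apply' _ _ _ _

/-- Time-frequency shifts compose up to a unimodular cocycle, which is invisible in absolute values.
-/
theorem tf_tf (z w : V × V) (g : 𝓢(V, ℂ)) :
    tf z (tf w g) = ((𝐞 (-⟪w.2, z.1⟫) : Circle) : ℂ) • tf (z + w) g := by
  ext t
  rw [smul_apply, ← Circle.smul_def, tf, tfShift_apply', tf, tfShift_apply', tf,
    tfShift_apply', smul_smul, smul_smul, ← AddChar.map_add_eq_mul, ← AddChar.map_add_eq_mul,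
    sub_sub, Prod.fst_add, Prod.snd_add]
  congr 2
  rw [inner_sub_right, inner_add_left]
  ring

theorem ip_tf_tf (f g : 𝓢(V, ℂ)) (z w : V × V) :
    𝐞 (⟪w.2 - z.2, z.1⟫) • ip (tf z f) (tf w g) = ip f (tf (w - z) g) := by
  rw [ip, ip, ← integral_add_right_eq_self _ z.1, Circle.smul_def, ← integral_smul]
  congr 1
  ext t
  rw [tf, tfShift_apply', tf, tfShift_apply', tf, tfShift_apply', ← Circle.smul_def,
    add_sub_cancel_right, Circle.smul_def, Circle.smul_def, Circle.smul_def, Circle.smul_def]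
  simp only [smul_eq_mul, map_mul, ← Circle.coe_inv_eq_conj, ← AddChar.map_neg_eq_inv]
  have e1 : t + z.1 - w.1 = t - (w.1 - z.1) := by abel
  rw [e1, Prod.fst_sub, Prod.snd_sub]
  have e2 : ((𝐞 ⟪w.2 - z.2, z.1⟫ : Circle) : ℂ) * ((𝐞 ⟪z.2, t + z.1⟫ : Circle) : ℂ) *
      ((𝐞 (-⟪w.2, t + z.1⟫) : Circle) : ℂ) = ((𝐞 (-⟪w.2 - z.2, t⟫) : Circle) : ℂ) := by
    rw [← Circle.coe_mul, ← Circle.coe_mul, ← AddChar.map_add_eq_mul, ← AddChar.map_add_eq_mul]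
    congr 2
    simp only [inner_sub_left, inner_add_right]
    ring
  rw [← e2]
  ring

theorem norm_ip_tf_tf (f g : 𝓢(V, ℂ)) (z w : V × V) :
    ‖ip (tf z f) (tf w g)‖ = ‖ip f (tf (w - z) g)‖ := by
  rw [← ip_tf_tf, Circle.norm_smul]

theorem continuous_ip_tf_tf (f g : 𝓢(V, ℂ)) :
    Continuous (fun p : (V × V) × (V × V) ↦ ip (tf p.1 f) (tf p.2 g)) := by
  have h : ∀ p : (V × V) × (V × V), ip (tf p.1 f) (tf p.2 g) =
      (𝐞 (⟪p.2.2 - p.1.2, p.1.1⟫))⁻¹ • ip f (tf (p.2 - p.1) g) := fun p ↦ by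
    rw [← ip_tf_tf, inv_smul_smul]
  simp_rw [h]
  have h1 : Continuous (fun p : (V × V) × (V × V) ↦ ⟪p.2.2 - p.1.2, p.1.1⟫) := by fun_prop
  exact (Real.continuous_fourierChar.comp h1).inv.smul
    ((continuous_ip_tf f g).comp (continuous_snd.sub continuous_fst))

theorem norm_bracket_tf_tf (f : 𝓢'(V, ℂ)) (g : 𝓢(V, ℂ)) (z w : V × V) :
    ‖bracket f (tf z (tf w g))‖ = ‖bracket f (tf (z + w) g)‖ := by
  rw [tf_tf, bracket_smul_right, norm_mul, RCLike.norm_conj, Circle.norm_coe, one_mul]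

end composition

/-! ### The `τ`-Wigner distribution and the matrix of `Op_τ(σ)`. -/

section moyal
variable {E : Type} [NormedAddCommGroup E] [InnerProductSpace ℝ E] [FiniteDimensional ℝ E]
  [MeasurableSpace E] [BorelSpace E]

theorem measurePreserving_toPhase :
    MeasurePreserving (fun z : E × E ↦ ph z.1 z.2) volume volume :=
  WithLp.volume_preserving_toLp E E

theorem integral_phase {G : Type} [NormedAddCommGroup G] [NormedSpace ℝ G] (F : Phase E → G) :
    ∫ p, F p = ∫ z : E × E, F (ph z.1 z.2) :=
  (MeasurePreserving.integral_comp (f := fun z : E × E ↦ ph z.1 z.2) measurePreserving_toPhase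
    (MeasurableEquiv.toLp 2 (E × E)).measurableEmbedding F).symm

theorem integrable_phase_iff {G : Type} [NormedAddCommGroup G] (F : Phase E → G) :
    Integrable (fun z : E × E ↦ F (ph z.1 z.2)) ↔ Integrable F :=
  MeasurePreserving.integrable_comp_emb measurePreserving_toPhase
    (MeasurableEquiv.toLp 2 (E × E)).measurableEmbedding

theorem hasTemperateGrowth_ph (x : E) : Function.HasTemperateGrowth (fun y : E ↦ ph x y) := by
  simp_rw [ph_eq]
  have h := ContinuousLinearMap.hasTemperateGrowth (inrCLM (E := E))
  exact (Function.HasTemperateGrowth.const (inlCLM x)).add h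

/-- The slice `y ↦ h (x, y)` of a Schwartz function on phase space. -/
def slice (h : 𝓢(Phase E, ℂ)) (x : E) : 𝓢(E, ℂ) :=
  SchwartzMap.compCLM ℂ (g := fun y ↦ ph x y) (hasTemperateGrowth_ph x)
    ⟨1, 1, fun y ↦ by
      have := TauPsiDO.norm_snd_le (ph x y)
      change ‖y‖ ≤ ‖ph x y‖ at this
      linarith⟩ h

theorem ip_phase (h k : 𝓢(Phase E, ℂ)) : ip h k = ∫ x, ip (slice h x) (slice k x) := by
  rw [ip, integral_phase, Measure.volume_eq_prod, integral_prod]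
  · rfl
  · exact (integrable_phase_iff (fun p ↦ h p * conj (k p))).2 (integrable_mul_conj h k)

/-- For each fixed `x`, the slice of `tauWigner` is the Fourier transform of the slice of its
kernel, so this is Plancherel fibre by fibre. -/
theorem ip_tauWigner_eq_ip_wignerKernel (τ : ℝ) (f g f' g' : 𝓢(E, ℂ)) :
    ip (tauWigner τ f g) (tauWigner τ f' g') =
      ip (wignerKernel τ f g) (wignerKernel τ f' g') := by
  rw [ip_phase, ip_phase]
  congr 1; ext x
  rw [← ip_fourier (slice (wignerKernel τ f g) x)]
  congr 1

/-- Moyal's formula. -/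
theorem ip_tauWigner (τ : ℝ) (g f g' f' : 𝓢(E, ℂ)) :
    ip (tauWigner τ g f) (tauWigner τ g' f') = ip g g' * conj (ip f f') := by
  rw [ip_tauWigner_eq_ip_wignerKernel]
  set a : E → ℂ := fun t ↦ g t * conj (g' t)
  set b : E → ℂ := fun t ↦ conj (f t) * f' t
  have ha : Integrable a := integrable_mul_conj g g'
  have hb : Integrable b := by
    refine (integrable_mul_conj f' f).congr (Filter.Eventually.of_forall fun t ↦ ?_)
    exact mul_comm _ _
  have e1 : ip (wignerKernel τ g f) (wignerKernel τ g' f') =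
      ∫ z : E × E, a (z.1 + τ • z.2) * b (z.1 - (1 - τ) • z.2) := by
    rw [ip, integral_phase]
    congr 1; ext z
    rw [wignerKernel_ph, wignerKernel_ph]
    simp only [map_mul, Complex.conj_conj, a, b]
    ring
  have hint : Integrable (fun z : E × E ↦ a (z.1 + τ • z.2) * b (z.1 - (1 - τ) • z.2)) := by
    have h := (integrable_phase_iff (fun p ↦ wignerKernel τ g f p *
      conj (wignerKernel τ g' f' p))).2 (integrable_mul_conj _ _)
    refine h.congr (Filter.Eventually.of_forall fun z ↦ ?_)
    beta_reduce
    rw [wignerKernel_ph, wignerKernel_ph]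
    simp only [map_mul, Complex.conj_conj, a, b]
    ring
  have hint2 : Integrable (fun z : E × E ↦ a z.2 * b (z.2 - z.1)) := by
    have h := ha.convolution_integrand (ContinuousLinearMap.mul ℂ ℂ) hb.comp_neg
    refine h.congr (Filter.Eventually.of_forall fun z ↦ ?_)
    simp
  rw [e1, Measure.volume_eq_prod, integral_prod_symm _ hint]
  -- The two arguments differ by exactly `y`; translating `x` by `τ • y` therefore removes `τ` from
  -- the integral.
  have e2 : ∀ y, ∫ x, a (x + τ • y) * b (x - (1 - τ) • y) = ∫ x, a x * b (x - y) := by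
    intro y
    rw [← integral_add_right_eq_self (fun x ↦ a x * b (x - y)) (τ • y)]
    congr 1; ext x
    congr 2
    module
  simp_rw [e2]
  rw [integral_integral_swap hint2]
  have e3 : ∀ x, ∫ y, a x * b (x - y) = a x * ∫ y, b y := by
    intro x
    rw [integral_const_mul, integral_sub_left_eq_self]
  simp_rw [e3]
  rw [integral_mul_const, conj_ip]
  congr 1
  simp_rw [b, mul_comm (conj (f _))]
  rfl

/-- The rotation `(x, ω) ↦ (ω, -x)` of phase space. -/
def rot (η : E × E) : Phase E := ph η.2 (-η.1)

/-- The point of phase space and the frequency of the time-frequency shift by which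
`W_τ(π(w) g, π(z) f)` differs from `W_τ(g, f)`. -/
def wignerPoint (τ : ℝ) (w z : E × E) : Phase E × Phase E :=
  (ph ((1 - τ) • w.1 + τ • z.1) (τ • w.2 + (1 - τ) • z.2), rot (w - z))

/-- Covariance of the cross-`τ`-Wigner distribution. -/
theorem tauWigner_tf (τ : ℝ) (w z : E × E) (g f : 𝓢(E, ℂ)) :
    tauWigner τ (tf w g) (tf z f) =
      ((𝐞 ⟪w.1 - z.1, τ • w.2 + (1 - τ) • z.2⟫ : Circle) : ℂ) •
        tf (wignerPoint τ w z) (tauWigner τ g f) := by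
  ext p
  rw [smul_apply, ← Circle.smul_def, tf_apply]
  change ∫ y : E, 𝐞 (-⟪y, p.snd⟫) • wignerKernel τ (tf w g) (tf z f) (ph p.fst y) =
    _ • _ • ∫ y : E, 𝐞 (-⟪y, (p - (wignerPoint τ w z).1).snd⟫) •
      wignerKernel τ g f (ph (p - (wignerPoint τ w z).1).fst y)
  have e1 : (p - (wignerPoint τ w z).1).snd = p.snd - (τ • w.2 + (1 - τ) • z.2) := rfl
  have e2 : (p - (wignerPoint τ w z).1).fst = p.fst - ((1 - τ) • w.1 + τ • z.1) := rfl
  have e3 : ⟪(wignerPoint τ w z).2, p⟫ = ⟪w.2 - z.2, p.fst⟫ + ⟪-(w.1 - z.1), p.snd⟫ := rfl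
  -- Shifting `y` by `w.1 - z.1` makes both arguments refer to the common base point `p.fst - ((1 -
  -- τ) • w.1 + τ • z.1)`; the rest is bookkeeping of phases.
  rw [e1, e2, e3, Circle.smul_def, Circle.smul_def, ← integral_smul, ← integral_smul,
    ← integral_add_right_eq_self _ (w.1 - z.1)]
  congr 1; ext y
  rw [wignerKernel_ph, wignerKernel_ph, tf, tfShift_apply', tf, tfShift_apply',
    ← Circle.smul_def, ← Circle.smul_def, smul_smul, smul_smul, ← AddChar.map_add_eq_mul,
    ← AddChar.map_add_eq_mul]
  have e4 : p.fst + τ • (y + (w.1 - z.1)) - w.1 =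
      p.fst - ((1 - τ) • w.1 + τ • z.1) + τ • y := by module
  have e5 : p.fst - (1 - τ) • (y + (w.1 - z.1)) - z.1 =
      p.fst - ((1 - τ) • w.1 + τ • z.1) - (1 - τ) • y := by module
  rw [e4, e5]
  simp only [Circle.smul_def, smul_eq_mul, map_mul, ← Circle.coe_inv_eq_conj,
    ← AddChar.map_neg_eq_inv]
  have e6 : ((𝐞 (-⟪y + (w.1 - z.1), p.snd⟫) : Circle) : ℂ) *
      ((𝐞 ⟪w.2, p.fst + τ • (y + (w.1 - z.1))⟫ : Circle) : ℂ) *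
      ((𝐞 (-⟪z.2, p.fst - (1 - τ) • (y + (w.1 - z.1))⟫) : Circle) : ℂ) =
      ((𝐞 (⟪w.1 - z.1, τ • w.2 + (1 - τ) • z.2⟫ + (⟪w.2 - z.2, p.fst⟫ + ⟪-(w.1 - z.1), p.snd⟫)
        + -⟪y, p.snd - (τ • w.2 + (1 - τ) • z.2)⟫) : Circle) : ℂ) := by
    rw [← Circle.coe_mul, ← Circle.coe_mul, ← AddChar.map_add_eq_mul, ← AddChar.map_add_eq_mul]
    congr 2
    simp only [inner_sub_left, inner_add_left, inner_add_right, inner_sub_right, inner_neg_left,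
      real_inner_smul_right, real_inner_comm w.2, real_inner_comm z.2]
    ring
  rw [← e6]
  ring

theorem opTau_eq (τ : ℝ) (σ : 𝓢'(Phase E, ℂ)) (w z : E × E) (g f : 𝓢(E, ℂ)) :
    opTau τ σ (tf z f) (tf w g) =
      conj ((𝐞 ⟪w.1 - z.1, τ • w.2 + (1 - τ) • z.2⟫ : Circle) : ℂ) *
        bracket σ (tf (wignerPoint τ w z) (tauWigner τ g f)) := by
  rw [opTau, tauWigner_tf, bracket_smul_right]

/-- The key identity: matrix entries of the operator are, in modulus, values of the short-time
Fourier transform of the symbol with a `τ`-Wigner window, at a frequency depending only on `w - z`.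
-/
theorem norm_opTau (τ : ℝ) (σ : 𝓢'(Phase E, ℂ)) (w z : E × E) (g f : 𝓢(E, ℂ)) :
    ‖opTau τ σ (tf z f) (tf w g)‖ =
      ‖bracket σ (tf (wignerPoint τ w z) (tauWigner τ g f))‖ := by
  rw [opTau_eq, norm_mul, RCLike.norm_conj, Circle.norm_coe, one_mul]

theorem continuous_ph_prod : Continuous (fun z : E × E ↦ ph z.1 z.2) :=
  WithLp.prod_continuous_toLp 2 E E

theorem continuous_rot : Continuous (rot : E × E → Phase E) :=
  continuous_ph_prod.comp (by fun_prop : Continuous fun η : E × E ↦ (η.2, -η.1))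

theorem continuous_wignerPoint (τ : ℝ) :
    Continuous (fun p : (E × E) × (E × E) ↦ wignerPoint τ p.1 p.2) := by
  refine Continuous.prodMk ?_ ?_
  · exact continuous_ph_prod.comp (by fun_prop : Continuous fun p : (E × E) × (E × E) ↦
      ((1 - τ) • p.1.1 + τ • p.2.1, τ • p.1.2 + (1 - τ) • p.2.2))
  · exact continuous_rot.comp (continuous_fst.sub continuous_snd)

theorem continuous_opTau (τ : ℝ) (σ : 𝓢'(Phase E, ℂ)) (g f : 𝓢(E, ℂ)) :
    Continuous (fun p : (E × E) × (E × E) ↦ opTau τ σ (tf p.2 f) (tf p.1 g)) := by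
  simp_rw [opTau_eq]
  refine Continuous.mul ?_ ((continuous_bracket_tf σ _).comp (continuous_wignerPoint τ))
  refine Complex.continuous_conj.comp (continuous_subtype_val.comp
    (Real.continuous_fourierChar.comp ?_))
  fun_prop

theorem measurePreserving_rot : MeasurePreserving (rot : E × E → Phase E) volume volume := by
  have h1 : MeasurePreserving (fun η : E × E ↦ (η.2, -η.1)) volume volume := by
    rw [Measure.volume_eq_prod]
    exact ((MeasurePreserving.id volume).prod (Measure.measurePreserving_neg volume)).comp
      Measure.measurePreserving_swap
  exact measurePreserving_toPhase.comp h1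

/-- The map is a composition of two skew products, intertwined with swaps: `z` is replaced by `w -
z`, and then, with this difference fixed, `w` is merely translated. No step requires dividing by `τ`
or `1 - τ`. -/
theorem measurePreserving_wignerPoint (τ : ℝ) :
    MeasurePreserving (fun p : (E × E) × (E × E) ↦ wignerPoint τ p.1 p.2) volume volume := by
  have h1 : MeasurePreserving (fun p : (E × E) × (E × E) ↦ (p.1, p.1 - p.2))
      (volume.prod volume) (volume.prod volume) :=
    (MeasurePreserving.id volume).skew_product (g := fun w z ↦ w - z)
      (by exact measurable_fst.sub measurable_snd)
      (Filter.Eventually.of_forall fun w ↦ (Measure.measurePreserving_sub_left volume w).map_eq)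
  have h2 : MeasurePreserving (fun p : (E × E) × (E × E) ↦
      (rot p.1, ph (p.2.1 - τ • p.1.1) (p.2.2 - (1 - τ) • p.1.2)))
      (volume.prod volume) (volume.prod volume) := by
    refine measurePreserving_rot.skew_product
      (g := fun (η w : E × E) ↦ ph (w.1 - τ • η.1) (w.2 - (1 - τ) • η.2)) ?_ ?_
    · have : Continuous (fun p : (E × E) × (E × E) ↦
          (p.2.1 - τ • p.1.1, p.2.2 - (1 - τ) • p.1.2)) := by fun_prop
      exact (continuous_ph_prod.comp this).measurable
    · refine Filter.Eventually.of_forall fun η ↦ ?_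
      exact (measurePreserving_toPhase.comp
        (measurePreserving_sub_right volume ((τ • η.1, (1 - τ) • η.2) : E × E))).map_eq
  have h3 := Measure.measurePreserving_swap.comp
    (h2.comp (Measure.measurePreserving_swap.comp h1))
  rw [Measure.volume_eq_prod, Measure.volume_eq_prod (Phase E) (Phase E)]
  suffices h : (fun p : (E × E) × (E × E) ↦ wignerPoint τ p.1 p.2) = fun p ↦
      (ph (p.1.1 - τ • (p.1.1 - p.2.1)) (p.1.2 - (1 - τ) • (p.1.2 - p.2.2)), rot (p.1 - p.2)) by
    rw [h]
    exact h3
  funext p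
  refine Prod.ext ?_ rfl
  change ph _ _ = ph (p.1.1 - τ • (p.1.1 - p.2.1)) (p.1.2 - (1 - τ) • (p.1.2 - p.2.2))
  congr 1 <;> module

/-- The unimodular factor from covariance occurs once in the factor containing `σ` and once,
conjugated, in Moyal's formula, so it cancels in the product. -/
theorem conj_ip_mul_bracket_wignerPoint (τ : ℝ) (σ : 𝓢'(Phase E, ℂ)) (f g φ : 𝓢(E, ℂ))
    (w z : E × E) :
    conj (ip (tauWigner τ g f) (tf (wignerPoint τ w z) (tauWigner τ φ φ))) *
      bracket σ (tf (wignerPoint τ w z) (tauWigner τ φ φ)) =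
    opTau τ σ (tf z φ) (tf w φ) * ip f (tf z φ) * conj (ip g (tf w φ)) := by
  have h1 := opTau_eq τ σ w z φ φ
  have h2 := ip_tauWigner τ g f (tf w φ) (tf z φ)
  rw [tauWigner_tf, ip_smul_right] at h2
  set c := ((𝐞 ⟪w.1 - z.1, τ • w.2 + (1 - τ) • z.2⟫ : Circle) : ℂ)
  have hc : c * conj c = 1 := by
    rw [Complex.mul_conj, Complex.normSq_eq_norm_sq, Circle.norm_coe]; simp
  have h3 := congrArg conj h2
  simp only [map_mul, Complex.conj_conj] at h3
  rw [h1]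
  linear_combination (conj c * bracket σ (tf (wignerPoint τ w z) (tauWigner τ φ φ))) * h3 -
    (conj (ip (tauWigner τ g f) (tf (wignerPoint τ w z) (tauWigner τ φ φ))) *
      bracket σ (tf (wignerPoint τ w z) (tauWigner τ φ φ))) * hc

/-- The matrix representation of `Op_τ(σ)` with respect to the time-frequency shifts of `φ`. -/
theorem opTau_eq_integral (τ : ℝ) (σ : 𝓢'(Phase E, ℂ)) (f g φ : 𝓢(E, ℂ)) :
    Integrable (fun p : (E × E) × (E × E) ↦
      opTau τ σ (tf p.2 φ) (tf p.1 φ) * ip f (tf p.2 φ) * conj (ip g (tf p.1 φ))) ∧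
    ip φ φ ^ 2 * opTau τ σ f g = ∫ p : (E × E) × (E × E),
      opTau τ σ (tf p.2 φ) (tf p.1 φ) * ip f (tf p.2 φ) * conj (ip g (tf p.1 φ)) := by
  -- The inversion formula for the symbol itself, tested against `W_τ(g, f)`; pulling it back along
  -- `wignerPoint` yields the double integral over `w` and `z`.
  have h := bracket_inversion σ (tauWigner τ g f) (tauWigner τ φ φ) (tauWigner τ φ φ)
  have hi := integrable_conj_ip_mul_bracket σ (tauWigner τ g f) (tauWigner τ φ φ) (tauWigner τ φ φ)
  have hmp := measurePreserving_wignerPoint (E := E) τ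
  simp_rw [← conj_ip_mul_bracket_wignerPoint]
  refine ⟨hmp.integrable_comp_of_integrable hi, ?_⟩
  rw [conj_ip, ip_tauWigner, conj_ip] at h
  rw [sq, opTau, h, ← hmp.map_eq]
  refine integral_map hmp.aemeasurable ?_
  rw [hmp.map_eq]
  exact hi.aestronglyMeasurable

end moyal

/-! ### Minkowski's integral inequality and mixed norms -/

section minkowski
variable {α β : Type} [MeasurableSpace α] [MeasurableSpace β] {μ : Measure α} {ν : Measure β}

theorem eLpNorm_ennreal_eq {p : ℝ≥0∞} (hp : p ≠ 0) (hp' : p ≠ ∞) (f : α → ℝ≥0∞) :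
    eLpNorm f p μ = (∫⁻ x, f x ^ p.toReal ∂μ) ^ (1 / p.toReal) := by
  rw [eLpNorm_eq_lintegral_rpow_enorm_toReal hp hp']
  simp

theorem eLpNorm_mono_ennreal {f g : α → ℝ≥0∞} (p : ℝ≥0∞) (h : ∀ x, f x ≤ g x) :
    eLpNorm f p μ ≤ eLpNorm g p μ :=
  eLpNorm_mono_enorm fun x ↦ by simpa using h x

theorem eLpNorm_const_mul_ennreal {f : α → ℝ≥0∞} (hf : Measurable f) (c : ℝ≥0∞)
    (p : ℝ≥0∞) : eLpNorm (fun x ↦ c * f x) p μ = c * eLpNorm f p μ := by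
  by_cases h0 : p = 0
  · simp [h0]
  by_cases h1 : p = ∞
  · simp only [h1, eLpNorm_exponent_top, eLpNormEssSup, enorm_eq_self]
    exact ENNReal.essSup_const_mul
  · have hp : 0 < p.toReal := ENNReal.toReal_pos h0 h1
    simp_rw [eLpNorm_ennreal_eq h0 h1, ENNReal.mul_rpow_of_nonneg _ _ hp.le]
    rw [lintegral_const_mul _ (hf.pow_const _), ENNReal.mul_rpow_of_nonneg _ _ (by positivity),
      ← ENNReal.rpow_mul, mul_one_div_cancel hp.ne', ENNReal.rpow_one]

theorem measurable_eLpNorm_left [SFinite μ] {f : α → β → ℝ≥0∞}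
    (hf : Measurable (Function.uncurry f)) (p : ℝ≥0∞) :
    Measurable (fun y ↦ eLpNorm (fun x ↦ f x y) p μ) := by
  have hf' : Measurable (fun z : β × α ↦ f z.2 z.1) := hf.comp measurable_swap
  by_cases h0 : p = 0
  · simp [h0]
  by_cases h1 : p = ∞
  · simp only [h1, eLpNorm_exponent_top, eLpNormEssSup, enorm_eq_self]
    -- A sublevel set of the essential supremum consists of those parameters whose section above `c`
    -- is null, and measures of sections are measurable.
    refine measurable_of_Iic fun c ↦ ?_
    have h2 : (fun y ↦ essSup (fun x ↦ f x y) μ) ⁻¹' Set.Iic c =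
        {y | μ (Prod.mk y ⁻¹' {z : β × α | c < f z.2 z.1}) = 0} := by
      ext y
      have h3 : essSup (fun x ↦ f x y) μ ≤ c ↔ ∀ᵐ x ∂μ, f x y ≤ c :=
        ⟨fun h ↦ (ae_le_essSup (f := fun x ↦ f x y)).mono fun x hx ↦ hx.trans h,
          fun h ↦ essSup_le_of_ae_le c h⟩
      simp only [Set.mem_preimage, Set.mem_Iic, Set.mem_ofPred_eq]
      rw [h3, ae_iff]
      simp only [not_le]
      rfl
    rw [h2]
    exact measurable_measure_prodMk_left (measurableSet_lt measurable_const hf')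
      (measurableSet_singleton 0)
  · simp_rw [eLpNorm_ennreal_eq h0 h1]
    exact (Measurable.lintegral_prod_right' (f := fun z : β × α ↦ f z.2 z.1 ^ p.toReal)
      (hf'.pow_const _)).pow_const _

/-- Write `f = (f * N ^ (-1/s)) * N ^ (1/s)` with `N y` the `L^r` norm of `f` in `x` and `s` the
conjugate exponent. Hölder in `y`, the `r`-th power and Tonelli then leave `∫ N ^ r * N ^ (-(r - 1))
= ∫ N`, up to null and infinite values of `N`. -/
theorem lintegral_rpow_lintegral_le [SFinite μ] [SFinite ν] {f : α → β → ℝ≥0∞}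
    (hf : Measurable (Function.uncurry f)) {r : ℝ} (hr : 1 ≤ r) :
    ∫⁻ x, (∫⁻ y, f x y ∂ν) ^ r ∂μ ≤ (∫⁻ y, (∫⁻ x, f x y ^ r ∂μ) ^ (1 / r) ∂ν) ^ r := by
  have hr0 : 0 < r := by linarith
  have hf' : Measurable (fun z : β × α ↦ f z.2 z.1) := hf.comp measurable_swap
  rcases hr.eq_or_lt with rfl | hr1
  · simp only [ENNReal.rpow_one, div_one]
    exact (lintegral_lintegral_swap hf.aemeasurable).le
  set N : β → ℝ≥0∞ := fun y ↦ (∫⁻ x, f x y ^ r ∂μ) ^ (1 / r)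
  have hN : Measurable N := (Measurable.lintegral_prod_right'
    (f := fun z : β × α ↦ f z.2 z.1 ^ r) (hf'.pow_const _)).pow_const _
  by_cases hfin : ∫⁻ y, N y ∂ν = ∞
  · rw [hfin, ENNReal.top_rpow_of_pos hr0]
    exact le_top
  have hNr : ∀ y, ∫⁻ x, f x y ^ r ∂μ = N y ^ r := by
    intro y
    rw [← ENNReal.rpow_mul, one_div_mul_cancel hr0.ne', ENNReal.rpow_one]
  have hN_fin : ∀ᵐ y ∂ν, N y < ∞ := ae_lt_top hN hfin
  -- The splitting by powers of `N` is illegitimate where `N y = 0`, but there the integrand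
  -- vanishes almost everywhere; Tonelli puts the exceptional set in the right order of variables.
  have hzero : ∀ᵐ x ∂μ, ∀ᵐ y ∂ν, N y = 0 → f x y = 0 := by
    have h1 : ∀ᵐ z ∂ν.prod μ, N z.1 = 0 → f z.2 z.1 = 0 := by
      rw [Measure.ae_prod_iff_ae_ae]
      · refine Filter.Eventually.of_forall fun y ↦ ?_
        by_cases hy : N y = 0
        · have h2 := hNr y
          rw [hy, ENNReal.zero_rpow_of_pos hr0, lintegral_eq_zero_iff] at h2
          · filter_upwards [h2] with x hx _
            exact (ENNReal.rpow_eq_zero_iff_of_pos hr0).1 hx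
          · exact (hf'.comp measurable_prodMk_left).pow_const _
        · exact Filter.Eventually.of_forall fun x h ↦ absurd h hy
      · have : {z : β × α | N z.1 = 0 → f z.2 z.1 = 0} =
            {z | N z.1 = 0}ᶜ ∪ {z | f z.2 z.1 = 0} := by
          ext z; simp [imp_iff_not_or]
        rw [this]
        exact ((hN.comp measurable_fst) (measurableSet_singleton 0)).compl.union
          (hf' (measurableSet_singleton 0))
    have h2 : ∀ᵐ z ∂μ.prod ν, N z.2 = 0 → f z.1 z.2 = 0 :=
      Measure.measurePreserving_swap.quasiMeasurePreserving.ae h1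
    exact Measure.ae_ae_of_ae_prod h2
  set s := r.conjExponent
  have hrs : r.HolderConjugate s := Real.HolderConjugate.conjExponent hr1
  have hs0 : 0 < s := hrs.symm.pos
  have hrs' : 1 / s * r = r - 1 := by
    have := hrs.inv_add_inv_eq_one
    field_simp at this ⊢
    linarith
  have hpt : ∀ᵐ x ∂μ, (∫⁻ y, f x y ∂ν) ^ r ≤
      (∫⁻ y, f x y ^ r * N y ^ (-(r - 1)) ∂ν) * (∫⁻ y, N y ∂ν) ^ (r - 1) := by
    filter_upwards [hzero] with x hx
    have hfx : Measurable (f x) := hf.comp measurable_prodMk_left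
    have h1 : ∫⁻ y, f x y ∂ν ≤
        ∫⁻ y, ((fun y ↦ f x y * N y ^ (-(1 / s))) * (fun y ↦ N y ^ (1 / s))) y ∂ν := by
      refine lintegral_mono_ae ?_
      filter_upwards [hx, hN_fin] with y hy hy'
      by_cases h0 : N y = 0
      · rw [hy h0]; exact zero_le
      · rw [Pi.mul_apply, mul_assoc, ← ENNReal.rpow_add _ _ h0 hy'.ne, neg_add_cancel,
          ENNReal.rpow_zero, mul_one]
    have h2 := ENNReal.lintegral_mul_le_Lp_mul_Lq ν hrs
      (hfx.mul (hN.pow_const (-(1 / s)))).aemeasurable (hN.pow_const (1 / s)).aemeasurable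
    have h3 := ENNReal.rpow_le_rpow (h1.trans h2) hr0.le
    rw [ENNReal.mul_rpow_of_nonneg _ _ hr0.le, ← ENNReal.rpow_mul, ← ENNReal.rpow_mul,
      one_div_mul_cancel hr0.ne', ENNReal.rpow_one, hrs'] at h3
    refine h3.trans (le_of_eq ?_)
    congr 2
    · ext y
      rw [Pi.mul_apply, ENNReal.mul_rpow_of_nonneg _ _ hr0.le, ← ENNReal.rpow_mul, neg_mul, hrs']
    · congr 1; ext y
      rw [← ENNReal.rpow_mul, one_div_mul_cancel hs0.ne', ENNReal.rpow_one]
  have hm : Measurable (fun z : α × β ↦ f z.1 z.2 ^ r * N z.2 ^ (-(r - 1))) :=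
    (hf.pow_const r).mul ((hN.comp measurable_snd).pow_const _)
  calc _ ≤ ∫⁻ x, (∫⁻ y, f x y ^ r * N y ^ (-(r - 1)) ∂ν) * (∫⁻ y, N y ∂ν) ^ (r - 1) ∂μ :=
        lintegral_mono_ae hpt
    _ = (∫⁻ y, ∫⁻ x, f x y ^ r * N y ^ (-(r - 1)) ∂μ ∂ν) * (∫⁻ y, N y ∂ν) ^ (r - 1) := by
        rw [lintegral_mul_const _ (Measurable.lintegral_prod_right' hm),
          lintegral_lintegral_swap hm.aemeasurable]
    _ ≤ (∫⁻ y, N y ∂ν) * (∫⁻ y, N y ∂ν) ^ (r - 1) := by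
        gcongr with y
        have hfy : Measurable (fun x ↦ f x y ^ r) :=
          (hf'.comp measurable_prodMk_left).pow_const r
        rw [lintegral_mul_const _ hfy, hNr]
        by_cases h0 : N y = 0
        · rw [h0, ENNReal.zero_rpow_of_pos hr0, zero_mul]
        by_cases h1 : N y = ∞
        · rw [h1]; exact le_top
        · rw [← ENNReal.rpow_add _ _ h0 h1]
          ring_nf
          rw [ENNReal.rpow_one]
    _ = _ := by
        set T := ∫⁻ y, N y ∂ν
        by_cases h0 : T = 0
        · rw [h0, zero_mul, ENNReal.zero_rpow_of_pos hr0]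
        · nth_rewrite 1 [← ENNReal.rpow_one T]
          rw [← ENNReal.rpow_add _ _ h0 hfin]
          ring_nf

/-- Minkowski's integral inequality. -/
theorem eLpNorm_lintegral_le [SFinite μ] [SFinite ν] {f : α → β → ℝ≥0∞}
    (hf : Measurable (Function.uncurry f)) {p : ℝ≥0∞} (hp : 1 ≤ p) :
    eLpNorm (fun x ↦ ∫⁻ y, f x y ∂ν) p μ ≤ ∫⁻ y, eLpNorm (fun x ↦ f x y) p μ ∂ν := by
  have hf' : Measurable (fun z : β × α ↦ f z.2 z.1) := hf.comp measurable_swap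
  have h0 : p ≠ 0 := (one_pos.trans_le hp).ne'
  by_cases h1 : p = ∞
  · subst h1
    have hN := measurable_eLpNorm_left (μ := μ) hf ∞
    -- For `p = ∞` the bound holds almost everywhere in the product, and is then sliced in the other
    -- variable.
    have h2 : ∀ᵐ z ∂ν.prod μ, f z.2 z.1 ≤ eLpNorm (fun x ↦ f x z.1) ∞ μ := by
      have hm : MeasurableSet {z : β × α | f z.2 z.1 ≤ eLpNorm (fun x ↦ f x z.1) ∞ μ} :=
        measurableSet_le hf' (hN.comp measurable_fst)
      rw [Measure.ae_prod_iff_ae_ae hm]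
      refine Filter.Eventually.of_forall fun y ↦ ?_
      simpa [eLpNorm_exponent_top] using enorm_ae_le_eLpNormEssSup (fun x ↦ f x y) μ
    have h3 : ∀ᵐ z ∂μ.prod ν, f z.1 z.2 ≤ eLpNorm (fun x ↦ f x z.2) ∞ μ :=
      Measure.measurePreserving_swap.quasiMeasurePreserving.ae h2
    rw [eLpNorm_exponent_top]
    refine essSup_le_of_ae_le _ ?_
    filter_upwards [Measure.ae_ae_of_ae_prod h3] with x hx
    exact lintegral_mono_ae hx
  · have hr : 1 ≤ p.toReal := by
      rw [← ENNReal.toReal_one]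
      exact ENNReal.toReal_mono h1 hp
    have hr0 : 0 < p.toReal := by linarith
    simp_rw [eLpNorm_ennreal_eq h0 h1]
    have h2 := ENNReal.rpow_le_rpow (lintegral_rpow_lintegral_le (μ := μ) (ν := ν) hf hr)
      (one_div_nonneg.2 hr0.le)
    refine h2.trans (le_of_eq ?_)
    rw [← ENNReal.rpow_mul, mul_one_div_cancel hr0.ne', ENNReal.rpow_one]

end minkowski

/-! ### Mixed norms: convolution and local averages. -/

section mixed
variable {E : Type} [NormedAddCommGroup E] [InnerProductSpace ℝ E] [FiniteDimensional ℝ E]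
  [MeasurableSpace E] [BorelSpace E]

/-- The mixed norm: the `L^q` norm in `x` of the `L^p` norm in `ω`. -/
def mixNorm (p q : ℝ≥0∞) (F : E × E → ℝ≥0∞) : ℝ≥0∞ :=
  eLpNorm (fun x ↦ eLpNorm (fun ω ↦ F (x, ω)) p volume) q volume

theorem mixNorm_mono {p q : ℝ≥0∞} {F G : E × E → ℝ≥0∞} (h : ∀ z, F z ≤ G z) :
    mixNorm p q F ≤ mixNorm p q G :=
  eLpNorm_mono_ennreal q fun x ↦ eLpNorm_mono_ennreal p fun ω ↦ h (x, ω)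

theorem measurable_inner_eLpNorm {F : E × E → ℝ≥0∞} (hF : Measurable F) (p : ℝ≥0∞) :
    Measurable (fun x ↦ eLpNorm (fun ω ↦ F (x, ω)) p volume) :=
  measurable_eLpNorm_left (f := fun ω x ↦ F (x, ω)) (hF.comp measurable_swap) p

theorem mixNorm_const_mul {p q : ℝ≥0∞} {F : E × E → ℝ≥0∞} (hF : Measurable F)
    (c : ℝ≥0∞) : mixNorm p q (fun z ↦ c * F z) = c * mixNorm p q F := by
  simp_rw [mixNorm]
  rw [← eLpNorm_const_mul_ennreal (measurable_inner_eLpNorm hF p) c]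
  congr 1; ext x
  exact eLpNorm_const_mul_ennreal (hF.comp measurable_prodMk_left) c p

/-- Minkowski's inequality applied twice, to the inner norm and then to the outer one. -/
theorem mixNorm_lintegral_le {β : Type} [MeasurableSpace β] {ν : Measure β} [SFinite ν]
    {p q : ℝ≥0∞} (hp : 1 ≤ p) (hq : 1 ≤ q) {F : E × E → β → ℝ≥0∞}
    (hF : Measurable (Function.uncurry F)) :
    mixNorm p q (fun z ↦ ∫⁻ y, F z y ∂ν) ≤ ∫⁻ y, mixNorm p q (fun z ↦ F z y) ∂ν := by
  have h1 : ∀ x, Measurable (Function.uncurry fun ω y ↦ F (x, ω) y) := fun x ↦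
    hF.comp ((measurable_const.prodMk measurable_fst).prodMk measurable_snd)
  have h2 : Measurable (Function.uncurry fun x y ↦ eLpNorm (fun ω ↦ F (x, ω) y) p volume) :=
    measurable_eLpNorm_left (f := fun ω (w : E × β) ↦ F (w.1, ω) w.2)
      (hF.comp (((measurable_fst.comp measurable_snd).prodMk measurable_fst).prodMk
        (measurable_snd.comp measurable_snd))) p
  calc _ ≤ eLpNorm (fun x ↦ ∫⁻ y, eLpNorm (fun ω ↦ F (x, ω) y) p volume ∂ν) q volume :=
        eLpNorm_mono_ennreal q fun x ↦ eLpNorm_lintegral_le (h1 x) hp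
    _ ≤ _ := eLpNorm_lintegral_le h2 hq

theorem mixNorm_sub_right {p q : ℝ≥0∞} {F : E × E → ℝ≥0∞} (hF : Measurable F) (a : E × E) :
    mixNorm p q (fun z ↦ F (z - a)) = mixNorm p q F := by
  have h1 : ∀ x, eLpNorm (fun ω ↦ F ((x, ω) - a)) p volume =
      eLpNorm (fun ω ↦ F (x - a.1, ω)) p volume := fun x ↦
    eLpNorm_comp_measurePreserving (g := fun ω ↦ F (x - a.1, ω))
      (hF.comp measurable_prodMk_left).aestronglyMeasurable
      (measurePreserving_sub_right volume a.2)
  simp_rw [mixNorm, h1]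
  exact eLpNorm_comp_measurePreserving
    (g := fun x ↦ eLpNorm (fun ω ↦ F (x, ω)) p volume)
    (measurable_inner_eLpNorm hF p).aestronglyMeasurable
    (measurePreserving_sub_right volume a.1)

/-- Young's inequality for mixed norms. -/
theorem mixNorm_convolution_le {p q : ℝ≥0∞} (hp : 1 ≤ p) (hq : 1 ≤ q) {F B : E × E → ℝ≥0∞}
    (hF : Measurable F) (hB : Measurable B) :
    mixNorm p q (fun w ↦ ∫⁻ z, F z * B (w - z)) ≤ (∫⁻ z, B z) * mixNorm p q F := by
  -- Written this way the convolution is a superposition of translates of `F`, all of the same mixed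
  -- norm, and Minkowski's inequality applies.
  have h1 : ∀ w, ∫⁻ z, F z * B (w - z) = ∫⁻ η, B η * F (w - η) := by
    intro w
    rw [← lintegral_sub_left_eq_self _ w]
    congr 1; ext η
    rw [sub_sub_cancel, mul_comm]
  simp_rw [h1]
  have h2 : Measurable (Function.uncurry fun (w η : E × E) ↦ B η * F (w - η)) :=
    (hB.comp measurable_snd).mul (hF.comp (measurable_fst.sub measurable_snd))
  refine (mixNorm_lintegral_le hp hq h2).trans (le_of_eq ?_)
  rw [← lintegral_mul_const _ hB]
  congr 1; ext η
  have hFη : Measurable (fun z ↦ F (z - η)) := hF.comp (measurable_id.sub_const η)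
  rw [mixNorm_const_mul hFη, mixNorm_sub_right hF]

/-- On a set of finite measure `L^p` embeds in `L^1`; translation invariance makes the constant
independent of the centre. -/
theorem setLIntegral_ball_le {p : ℝ≥0∞} (hp : 1 ≤ p) {h : E → ℝ≥0∞} (hh : Measurable h)
    (r : ℝ) (a : E) : ∫⁻ x in Metric.ball 0 r, h (a + x) ≤
      eLpNorm h p volume * volume (Metric.ball (0 : E) r) ^ (1 - 1 / p.toReal) := by
  have h1 := eLpNorm_le_eLpNorm_mul_rpow_measure_univ (f := fun x ↦ h (a + x)) hp
    (μ := volume.restrict (Metric.ball (0 : E) r))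
    (hh.comp (measurable_const_add a)).aestronglyMeasurable
  rw [Measure.restrict_apply_univ, eLpNorm_one_eq_lintegral_enorm] at h1
  simp only [enorm_eq_self, ENNReal.toReal_one, div_one] at h1
  refine h1.trans ?_
  gcongr
  refine (eLpNorm_restrict_le _ _ _ _).trans (le_of_eq ?_)
  exact eLpNorm_comp_measurePreserving (g := h) hh.aestronglyMeasurable
    (measurePreserving_add_left volume a)

/-- Local averages are bounded by mixed norms. -/
theorem exists_setLIntegral_ball_le_mixNorm {p q : ℝ≥0∞} (hp : 1 ≤ p) (hq : 1 ≤ q) (r : ℝ) :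
    ∃ C : ℝ≥0∞, C ≠ ∞ ∧ ∀ F : E × E → ℝ≥0∞, Measurable F → ∀ z,
      ∫⁻ η in Metric.ball 0 r, F (z + η) ≤ C * mixNorm p q F := by
  -- For `p = ∞` the conventions `∞.toReal = 0` and `1 / 0 = 0` give exponent `1`, which is the
  -- correct one.
  have hexp : ∀ {p : ℝ≥0∞}, 1 ≤ p → volume (Metric.ball (0 : E) r) ^ (1 - 1 / p.toReal) ≠ ∞ := by
    intro p hp
    refine ENNReal.rpow_ne_top_of_nonneg ?_ measure_ball_lt_top.ne
    by_cases h1 : p = ∞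
    · simp [h1]
    · have hr : 1 ≤ p.toReal := by
        rw [← ENNReal.toReal_one]
        exact ENNReal.toReal_mono h1 hp
      rw [sub_nonneg, div_le_one (by linarith)]
      exact hr
  set Cp := volume (Metric.ball (0 : E) r) ^ (1 - 1 / p.toReal)
  set Cq := volume (Metric.ball (0 : E) r) ^ (1 - 1 / q.toReal)
  refine ⟨Cq * Cp, ENNReal.mul_ne_top (hexp hq) (hexp hp), fun F hF z ↦ ?_⟩
  have hFz : Measurable (fun η ↦ F (z + η)) := hF.comp (measurable_const_add z)
  have hb : Metric.ball (0 : E × E) r = Metric.ball 0 r ×ˢ Metric.ball 0 r :=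
    (ball_prod_same (0 : E) 0 r).symm
  rw [hb, Measure.volume_eq_prod, ← Measure.prod_restrict,
    lintegral_prod _ hFz.aemeasurable]
  set f := fun x ↦ eLpNorm (fun ω ↦ F (x, ω)) p volume
  calc ∫⁻ x in Metric.ball 0 r, ∫⁻ ω in Metric.ball 0 r, F (z + (x, ω))
      ≤ ∫⁻ x in Metric.ball 0 r, f (z.1 + x) * Cp := by
        refine lintegral_mono fun x ↦ ?_
        exact setLIntegral_ball_le hp (h := fun ω ↦ F (z.1 + x, ω))
          (hF.comp measurable_prodMk_left) r z.2
    _ = (∫⁻ x in Metric.ball 0 r, f (z.1 + x)) * Cp :=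
        lintegral_mul_const _ ((measurable_inner_eLpNorm hF p).comp (measurable_const_add z.1))
    _ ≤ mixNorm p q F * Cq * Cp := by
        gcongr
        exact setLIntegral_ball_le hq (measurable_inner_eLpNorm hF p) r z.1
    _ = _ := by ring

end mixed

/-! ### Weighted estimates for the short-time Fourier transform -/

section estimates
variable {V : Type} [NormedAddCommGroup V] [InnerProductSpace ℝ V] [FiniteDimensional ℝ V]
  [MeasurableSpace V] [BorelSpace V]

/-- The absolute value of the short-time Fourier transform. -/
def absStft (g : 𝓢(V, ℂ)) (f : 𝓢'(V, ℂ)) (z : V × V) : ℝ≥0∞ := ‖bracket f (tf z g)‖ₑ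

/-- The absolute value of the ambiguity function. -/
def ambig (g : 𝓢(V, ℂ)) (z : V × V) : ℝ≥0∞ := ‖ip g (tf z g)‖ₑ

theorem continuous_absStft (g : 𝓢(V, ℂ)) (f : 𝓢'(V, ℂ)) : Continuous (absStft g f) :=
  (continuous_bracket_tf f g).enorm

theorem continuous_ambig (g : 𝓢(V, ℂ)) : Continuous (ambig g) := (continuous_ip_tf g g).enorm

theorem enorm_ip_tf_tf (g : 𝓢(V, ℂ)) (z w : V × V) :
    ‖ip (tf z g) (tf w g)‖ₑ = ambig g (w - z) := by
  rw [ambig, ← ofReal_norm, ← ofReal_norm, norm_ip_tf_tf]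

theorem ambig_neg (g : 𝓢(V, ℂ)) (z : V × V) : ambig g (-z) = ambig g z := by
  have h1 := enorm_ip_tf_tf g z 0
  have h2 := enorm_ip_tf_tf g 0 z
  rw [sub_zero] at h2
  rw [zero_sub] at h1
  rw [← h1, ← h2, ← conj_ip, RCLike.enorm_conj]

theorem tf_zero (g : 𝓢(V, ℂ)) : tf 0 g = g := by
  ext t
  rw [tf_apply]
  simp

theorem absStft_tf (g : 𝓢(V, ℂ)) (f : 𝓢'(V, ℂ)) (z w : V × V) :
    ‖bracket f (tf z (tf w g))‖ₑ = absStft g f (z + w) := by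
  rw [absStft, ← ofReal_norm, ← ofReal_norm, norm_bracket_tf_tf]

theorem enorm_ip_mul_bracket_le (f : 𝓢'(V, ℂ)) (g α β : 𝓢(V, ℂ)) :
    ‖ip β α‖ₑ * ‖bracket f g‖ₑ ≤ ∫⁻ z : V × V, ‖ip g (tf z α)‖ₑ * ‖bracket f (tf z β)‖ₑ := by
  have h := bracket_inversion f g α β
  have h2 := congrArg (fun c : ℂ ↦ ‖c‖ₑ) h
  simp only [enorm_mul, RCLike.enorm_conj] at h2
  rw [h2]
  refine (enorm_integral_le_lintegral_enorm _).trans (le_of_eq ?_)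
  simp only [enorm_mul, RCLike.enorm_conj]

/-- Inversion with synthesis window `π(η)g` instead of `g`: the value at `w` is controlled by values
displaced by `η`. The freedom in `η` is what later permits averaging over a ball. -/
theorem ambig_mul_absStft_le (g : 𝓢(V, ℂ)) (f : 𝓢'(V, ℂ)) (η w : V × V) :
    ambig g η * absStft g f w ≤ ∫⁻ z, ambig g (z - w) * absStft g f (z + η) := by
  have h := enorm_ip_mul_bracket_le f (tf w g) g (tf η g)
  have h1 : ‖ip (tf η g) g‖ₑ = ambig g η := by
    have := enorm_ip_tf_tf g η 0
    rwa [tf_zero, zero_sub, ambig_neg] at this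
  simp_rw [h1, absStft_tf, enorm_ip_tf_tf] at h
  exact h

end estimates

/-! ### Moderate weights and boundedness of the weighted short-time Fourier transform. -/

section weighted
variable {E : Type} [NormedAddCommGroup E] [InnerProductSpace ℝ E] [FiniteDimensional ℝ E]
  [MeasurableSpace E] [BorelSpace E]

/-- `M` is a `ρ`-moderate weight, for an even continuous weight `ρ`. -/
structure ModeratePair (ρ M : E × E → ℝ≥0∞) (C : ℝ≥0∞) : Prop where
  measurable : Measurable M
  continuous : Continuous ρ
  ne_zero : ∀ z, M z ≠ 0
  ne_top : ∀ z, M z ≠ ∞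
  ne_top' : ∀ z, ρ z ≠ ∞
  const_ne_top : C ≠ ∞
  even : ∀ z, ρ (-z) = ρ z
  moderate : ∀ z η, M (z + η) ≤ C * ρ η * M z

variable {ρ M : E × E → ℝ≥0∞} {C : ℝ≥0∞}

theorem ModeratePair.le_sub (h : ModeratePair ρ M C) (z w : E × E) :
    M w ≤ C * ρ (w - z) * M z := by
  have := h.moderate z (w - z)
  rwa [add_sub_cancel] at this

theorem ModeratePair.convolution_mul_le (h : ModeratePair ρ M C) (G : E × E → ℝ≥0∞)
    (B : E × E → ℝ≥0∞) (w : E × E) :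
    (∫⁻ z, G z * B (w - z)) * M w ≤
      C * ∫⁻ z, (G z * M z) * (B (w - z) * ρ (w - z)) := by
  rw [← lintegral_mul_const' _ _ (h.ne_top w), ← lintegral_const_mul' _ _ h.const_ne_top]
  refine lintegral_mono fun z ↦ ?_
  calc G z * B (w - z) * M w ≤ G z * B (w - z) * (C * ρ (w - z) * M z) := by
        gcongr; exact h.le_sub z w
    _ = _ := by ring

/-- Functions bounded with the weight `M` are stable under convolution with kernels in `L^1_ρ`;
being quantitative, the bound can be iterated. -/
theorem ModeratePair.convolution_mul_le_of_bound (h : ModeratePair ρ M C) {G : E × E → ℝ≥0∞}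
    {D : ℝ≥0∞} (hG : ∀ z, G z * M z ≤ D) {B : E × E → ℝ≥0∞} (hB : Measurable B) (w : E × E) :
    (∫⁻ z, G z * B (w - z)) * M w ≤ C * (D * ∫⁻ η, B η * ρ η) := by
  refine (h.convolution_mul_le G B w).trans ?_
  gcongr
  have hm : Measurable (fun η ↦ B η * ρ η) := hB.mul h.continuous.measurable
  calc ∫⁻ z, (G z * M z) * (B (w - z) * ρ (w - z))
      ≤ ∫⁻ z, D * (B (w - z) * ρ (w - z)) := by gcongr; exact hG _
    _ = D * ∫⁻ z, B (w - z) * ρ (w - z) :=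
        lintegral_const_mul _ (hm.comp (measurable_const_sub w))
    _ = _ := by rw [lintegral_sub_left_eq_self (fun η ↦ B η * ρ η)]

/-- A finite weighted bound gives finiteness because the weight does not vanish; absolute
convergence of the integrals defining the operator is obtained this way. -/
theorem ModeratePair.lintegral_ne_top (h : ModeratePair ρ M C) {x D : ℝ≥0∞} {w : E × E}
    (hx : x * M w ≤ D) (hD : D ≠ ∞) : x ≠ ∞ := by
  rintro rfl
  rw [ENNReal.top_mul (h.ne_zero w)] at hx
  exact hD (top_le_iff.1 hx)

/-- A distribution whose short-time Fourier transform has finite weighted mixed norm has a bounded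
weighted short-time Fourier transform. -/
theorem ModeratePair.exists_bound_absStft (h : ModeratePair ρ M C) {φ : 𝓢(E, ℂ)} (hφ : φ ≠ 0)
    (hA : ∫⁻ z, ambig φ z * ρ z ≠ ∞) {p q : ℝ≥0∞} (hp : 1 ≤ p) (hq : 1 ≤ q) {f : 𝓢'(E, ℂ)}
    (hf : mixNorm p q (fun z ↦ absStft φ f z * M z) ≠ ∞) :
    ∃ D, D ≠ ∞ ∧ ∀ z, absStft φ f z * M z ≤ D := by
  obtain ⟨L, hL, hle⟩ := exists_setLIntegral_ball_le_mixNorm (E := E) hp hq 1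
  set N := mixNorm p q (fun z ↦ absStft φ f z * M z)
  set Q := Metric.ball (0 : E × E) 1
  have hFM : Measurable (fun z ↦ absStft φ f z * M z) :=
    (continuous_absStft φ f).measurable.mul h.measurable
  have hAm : Measurable (ambig φ) := (continuous_ambig φ).measurable
  -- `R` is the maximum of `ρ` on the closed unit ball; it is the price of displacing the weight by
  -- `η`.
  obtain ⟨R, hR, hRle⟩ : ∃ R, R ≠ ∞ ∧ ∀ η ∈ Q, ρ η ≤ R := by
    obtain ⟨x, -, hx⟩ := (isCompact_closedBall (0 : E × E) 1).exists_isMaxOn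
      ⟨0, Metric.mem_closedBall_self zero_le_one⟩ h.continuous.continuousOn
    exact ⟨ρ x, h.ne_top' x, fun η hη ↦ hx (Metric.ball_subset_closedBall hη)⟩
  set κ := ∫⁻ η in Q, ambig φ η
  -- The ambiguity function is continuous and equals `‖φ‖₂²` at the origin, so its mass on the ball
  -- is positive.
  have hκ : κ ≠ 0 := by
    intro h0
    have h1 := (lintegral_eq_zero_iff hAm).1 h0
    have h2 : ∀ᵐ η ∂volume, η ∈ Q → ambig φ η = 0 :=
      (ae_restrict_iff' Metric.isOpen_ball.measurableSet).1 h1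
    have hU : IsOpen (Q ∩ {η | ambig φ η ≠ 0}) :=
      Metric.isOpen_ball.inter ((isOpen_ne).preimage (continuous_ambig φ))
    have h3 : volume (Q ∩ {η | ambig φ η ≠ 0}) = 0 := by
      refine measure_mono_null (fun η hη ↦ ?_) (ae_iff.1 h2)
      simpa using hη
    replace h3 := (hU.measure_eq_zero_iff volume).1 h3
    have h4 : (0 : E × E) ∈ Q ∩ {η | ambig φ η ≠ 0} := by
      refine ⟨Metric.mem_ball_self one_pos, ?_⟩
      change ambig φ 0 ≠ 0
      rw [ambig, tf_zero, Ne, enorm_eq_zero]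
      exact ip_self_ne_zero hφ
    rw [h3] at h4
    exact h4
  set X := C * C * R * (L * N) * ∫⁻ z, ambig φ z * ρ z
  have hX : X ≠ ∞ := by
    refine ENNReal.mul_ne_top ?_ hA
    exact ENNReal.mul_ne_top (ENNReal.mul_ne_top (ENNReal.mul_ne_top h.const_ne_top
      h.const_ne_top) hR) (ENNReal.mul_ne_top hL hf)
  refine ⟨X / κ, ENNReal.div_ne_top hX hκ, fun w ↦ ?_⟩
  rw [ENNReal.le_div_iff_mul_le (Or.inl hκ) (Or.inr hX)]
  -- Integrating this over `η ∈ Q` gives the factor `κ` on the left and, on the right, local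
  -- averages of the weighted transform, which the mixed norm controls uniformly in `z`.
  have hpt : ∀ η ∈ Q, ambig φ η * (absStft φ f w * M w) ≤
      ∫⁻ z, C * C * R * (ambig φ (z - w) * ρ (z - w)) * (absStft φ f (z + η) * M (z + η)) := by
    intro η hη
    rw [← mul_assoc]
    refine (mul_le_mul_left (ambig_mul_absStft_le φ f η w) (M w)).trans ?_
    rw [← lintegral_mul_const' _ _ (h.ne_top w)]
    refine lintegral_mono fun z ↦ ?_
    have h1 : M w ≤ C * ρ (z - w) * (C * R * M (z + η)) := by
      refine (h.le_sub z w).trans ?_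
      rw [← neg_sub z w, h.even]
      gcongr
      refine (h.le_sub (z + η) z).trans ?_
      rw [sub_add_cancel_left, h.even]
      gcongr
      exact hRle η hη
    calc ambig φ (z - w) * absStft φ f (z + η) * M w
        ≤ ambig φ (z - w) * absStft φ f (z + η) * (C * ρ (z - w) * (C * R * M (z + η))) := by
          gcongr
      _ = _ := by ring
  have hm2 : Measurable (fun p : (E × E) × (E × E) ↦
      C * C * R * (ambig φ (p.2 - w) * ρ (p.2 - w)) *
        (absStft φ f (p.2 + p.1) * M (p.2 + p.1))) := by
    have h1 : Measurable (fun z ↦ ambig φ (z - w) * ρ (z - w)) :=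
      (hAm.mul h.continuous.measurable).comp (measurable_id.sub_const w)
    exact ((h1.comp measurable_snd).const_mul _).mul
      (hFM.comp (measurable_snd.add measurable_fst))
  calc absStft φ f w * M w * κ = ∫⁻ η in Q, ambig φ η * (absStft φ f w * M w) := by
        rw [lintegral_mul_const _ hAm, mul_comm]
    _ ≤ ∫⁻ η in Q, ∫⁻ z, C * C * R * (ambig φ (z - w) * ρ (z - w)) *
          (absStft φ f (z + η) * M (z + η)) :=
        setLIntegral_mono' Metric.isOpen_ball.measurableSet hpt
    _ = ∫⁻ z, ∫⁻ η in Q, C * C * R * (ambig φ (z - w) * ρ (z - w)) *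
          (absStft φ f (z + η) * M (z + η)) := lintegral_lintegral_swap hm2.aemeasurable
    _ ≤ ∫⁻ z, C * C * R * (ambig φ (z - w) * ρ (z - w)) * (L * N) := by
        refine lintegral_mono fun z ↦ ?_
        have hx : Measurable (fun η ↦ absStft φ f (z + η) * M (z + η)) :=
          hFM.comp (measurable_const_add z)
        rw [lintegral_const_mul _ hx]
        gcongr
        exact hle _ hFM z
    _ = ∫⁻ z, (C * C * R * (L * N)) * (ambig φ (z - w) * ρ (z - w)) := by
        congr 1; ext z; ring
    _ = X := by
        have hx : Measurable (fun z ↦ ambig φ (z - w) * ρ (z - w)) :=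
          (hAm.mul h.continuous.measurable).comp (measurable_id.sub_const w)
        rw [lintegral_const_mul _ hx,
          lintegral_sub_right_eq_self (fun z ↦ ambig φ z * ρ z) w]

end weighted

/-! ### The kernel of a symbol in the Sjöstrand class -/

section symbol
variable {V : Type} [NormedAddCommGroup V] [InnerProductSpace ℝ V] [FiniteDimensional ℝ V]
  [MeasurableSpace V] [BorelSpace V]

/-- The supremum over the positions of the short-time Fourier transform at a given frequency. -/
def supStft (g : 𝓢(V, ℂ)) (f : 𝓢'(V, ℂ)) (ζ : V) : ℝ≥0∞ := ⨆ u, absStft g f (u, ζ)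

theorem absStft_le_supStft (g : 𝓢(V, ℂ)) (f : 𝓢'(V, ℂ)) (z : V × V) :
    absStft g f z ≤ supStft g f z.2 := le_iSup (fun u ↦ absStft g f (u, z.2)) z.1

/-- The supremum runs over an uncountable family, but of continuous functions, so it is lower
semicontinuous. -/
theorem measurable_supStft (g : 𝓢(V, ℂ)) (f : 𝓢'(V, ℂ)) : Measurable (supStft g f) := by
  refine LowerSemicontinuous.measurable (lowerSemicontinuous_iSup fun u ↦ ?_)
  exact ((continuous_absStft g f).comp (by fun_prop : Continuous fun ζ : V ↦
    ((u, ζ) : V × V))).lowerSemicontinuous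

/-- Nonempty open sets have positive measure, so true and essential suprema agree; the modulation
norm is defined with the latter, the kernel bound needs the former. -/
theorem le_essSup_of_continuous {h : V → ℝ≥0∞} (hh : Continuous h) (u : V) :
    h u ≤ essSup h volume := by
  by_contra! hlt
  have hU : IsOpen {x | essSup h volume < h x} := isOpen_lt continuous_const hh
  have h0 : volume {x | essSup h volume < h x} = 0 := by
    have := ae_le_essSup (f := h) (μ := volume)
    rw [ae_iff] at this
    simpa using this
  replace h0 := (hU.measure_eq_zero_iff volume).1 h0
  have : u ∈ {x | essSup h volume < h x} := hlt
  rw [h0] at this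
  exact this

theorem lintegral_supStft_le_modNorm (g : 𝓢(V, ℂ)) (f : 𝓢'(V, ℂ)) (v : V → ℝ) :
    ∫⁻ ζ, supStft g f ζ * ENNReal.ofReal (v ζ) ≤ modNorm g (fun _ ζ ↦ v ζ) ∞ 1 f := by
  rw [modNorm, eLpNorm_one_eq_lintegral_enorm]
  refine lintegral_mono fun ζ ↦ ?_
  have h1 : Continuous fun u : V ↦ absStft g f (u, ζ) :=
    (continuous_absStft g f).comp (by fun_prop : Continuous fun u : V ↦ ((u, ζ) : V × V))
  have hc : Continuous (fun u ↦ absStft g f (u, ζ) * ENNReal.ofReal (v ζ)) :=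
    (ENNReal.continuous_mul_const ENNReal.ofReal_ne_top).comp h1
  have h2 : supStft g f ζ * ENNReal.ofReal (v ζ) ≤
      essSup (fun u ↦ absStft g f (u, ζ) * ENNReal.ofReal (v ζ)) volume := by
    rw [supStft, ENNReal.iSup_mul]
    exact iSup_le fun u ↦ le_essSup_of_continuous hc u
  rw [eLpNorm_exponent_top]
  exact h2

/-- Change of window in the Sjöstrand class, with an arbitrary Schwartz window on the right. -/
theorem exists_lintegral_supStft_le {ψ Φ : 𝓢(V, ℂ)} (hψ : ψ ≠ 0) (hΦ : Φ ≠ 0) {v : V → ℝ}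
    (hv : Continuous v) (hv0 : ∀ z, 0 ≤ v z) (hve : ∀ z, v (-z) = v z)
    (hvm : ∀ w z, v (w + z) ≤ v w * v z)
    (hA : ∫⁻ z : V × V, ambig ψ z * ENNReal.ofReal (v z.2) ≠ ∞) :
    ∃ C, C ≠ ∞ ∧ ∀ f : 𝓢'(V, ℂ), ∫⁻ ζ, supStft ψ f ζ * ENNReal.ofReal (v ζ) ≤
      C * modNorm Φ (fun _ ζ ↦ v ζ) ∞ 1 f := by
  -- The windows may be orthogonal, so `ψ` is first shifted: if every shift were orthogonal to `Φ`,
  -- the inversion formula would give `Φ = 0`.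
  obtain ⟨ξ, hξ⟩ : ∃ ξ, ip Φ (tf ξ ψ) ≠ 0 := by
    by_contra! h0
    apply hΦ
    ext t
    have h1 := stft_inversion Φ ψ ψ t
    simp only [h0, zero_mul, integral_zero] at h1
    simpa [ip_self_ne_zero hψ] using h1.symm
  set u : V → ℝ≥0∞ := fun ζ ↦ ENNReal.ofReal (v ζ)
  have hu : Measurable u := (ENNReal.continuous_ofReal.comp hv).measurable
  have hum : ∀ w z, u (w + z) ≤ u w * u z := fun w z ↦ by
    simp only [u]
    rw [← ENNReal.ofReal_mul (hv0 w)]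
    exact ENNReal.ofReal_le_ofReal (hvm w z)
  set c := ‖ip Φ (tf ξ ψ)‖ₑ
  have hc : c ≠ 0 := by simpa [c] using hξ
  set G : V → ℝ≥0∞ := fun ζ ↦ ∫⁻ x, ambig ψ (x, ζ)
  have hAm : Measurable (ambig ψ) := (continuous_ambig ψ).measurable
  have hG : Measurable G := Measurable.lintegral_prod_right' (f := fun z : V × V ↦
    ambig ψ (z.2, z.1)) (hAm.comp measurable_swap)
  have hGu : ∫⁻ ζ, G ζ * u ζ = ∫⁻ z : V × V, ambig ψ z * u z.2 := by
    rw [Measure.volume_eq_prod, lintegral_prod_symm]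
    · congr 1; ext ζ
      exact (lintegral_mul_const _ (hAm.comp measurable_prodMk_right)).symm
    · exact (hAm.mul (hu.comp measurable_snd)).aemeasurable
  rw [← hGu] at hA
  refine ⟨u ξ.2 * (∫⁻ ζ, G ζ * u ζ) / c, ENNReal.div_ne_top
    (ENNReal.mul_ne_top ENNReal.ofReal_ne_top hA) hc, fun f ↦ ?_⟩
  set S := supStft Φ f
  have hS : Measurable S := measurable_supStft Φ f
  -- Once `Φ` contributes only its supremum over positions, the position integral of the ambiguity
  -- function is translation invariant. The bound no longer depends on `x`, so the supremum may be
  -- taken on the left.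
  have hpt : ∀ ζ, c * supStft ψ f ζ ≤ ∫⁻ ζ', S ζ' * G (ζ' + ξ.2 - ζ) := by
    intro ζ
    rw [supStft, ENNReal.mul_iSup]
    refine iSup_le fun x ↦ ?_
    have h := enorm_ip_mul_bracket_le f (tf (x, ζ) ψ) (tf ξ ψ) Φ
    refine h.trans ?_
    have h1 : ∀ z, ‖ip (tf (x, ζ) ψ) (tf z (tf ξ ψ))‖ₑ = ambig ψ (z + ξ - (x, ζ)) := by
      intro z
      rw [tf_tf, ip_smul_right, enorm_mul, RCLike.enorm_conj, enorm_ip_tf_tf]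
      rw [← ofReal_norm, Circle.norm_coe]
      simp
    simp_rw [h1]
    calc ∫⁻ z : V × V, ambig ψ (z + ξ - (x, ζ)) * ‖bracket f (tf z Φ)‖ₑ
        ≤ ∫⁻ z : V × V, ambig ψ (z + ξ - (x, ζ)) * S z.2 := by
          gcongr with z
          exact absStft_le_supStft Φ f z
      _ = ∫⁻ ζ', ∫⁻ x', ambig ψ ((x', ζ') + ξ - (x, ζ)) * S ζ' := by
          rw [Measure.volume_eq_prod, lintegral_prod_symm]
          exact ((hAm.comp ((measurable_id.add_const ξ).sub_const _)).mul
            (hS.comp measurable_snd)).aemeasurable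
      _ = _ := by
          congr 1; ext ζ'
          have h2 : Measurable (fun x' ↦ ambig ψ (x', ζ' + ξ.2 - ζ)) :=
            hAm.comp measurable_prodMk_right
          have h3 : ∀ x', ambig ψ ((x', ζ') + ξ - (x, ζ)) =
              (fun x' ↦ ambig ψ (x', ζ' + ξ.2 - ζ)) (x' + (ξ.1 - x)) := by
            intro x'
            beta_reduce
            congr 1
            ext
            · exact add_sub_assoc _ _ _
            · rfl
          simp_rw [h3]
          have h4 : Measurable (fun x' ↦ ambig ψ (x' + (ξ.1 - x), ζ' + ξ.2 - ζ)) :=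
            h2.comp (measurable_id.add_const _)
          rw [lintegral_mul_const _ h4,
            lintegral_add_right_eq_self (fun x' ↦ ambig ψ (x', ζ' + ξ.2 - ζ)), mul_comm]
  have hkey : c * ∫⁻ ζ, supStft ψ f ζ * u ζ ≤
      u ξ.2 * (∫⁻ ζ, G ζ * u ζ) * ∫⁻ ζ', S ζ' * u ζ' := by
    have hψu : Measurable (fun ζ ↦ supStft ψ f ζ * u ζ) := (measurable_supStft ψ f).mul hu
    have hSu : Measurable (fun ζ ↦ S ζ * u ζ) := hS.mul hu
    rw [← lintegral_const_mul _ hψu]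
    have hm : Measurable (fun p : V × V ↦
        u ξ.2 * (S p.2 * u p.2) * (G (p.2 + ξ.2 - p.1) * u (p.2 + ξ.2 - p.1))) := by
      have e : Measurable (fun p : V × V ↦ p.2 + ξ.2 - p.1) :=
        (measurable_snd.add_const _).sub measurable_fst
      exact (((hS.mul hu).comp measurable_snd).const_mul _).mul ((hG.mul hu).comp e)
    calc ∫⁻ ζ, c * (supStft ψ f ζ * u ζ)
        ≤ ∫⁻ ζ, ∫⁻ ζ', u ξ.2 * (S ζ' * u ζ') * (G (ζ' + ξ.2 - ζ) * u (ζ' + ξ.2 - ζ)) := by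
          refine lintegral_mono fun ζ ↦ ?_
          beta_reduce
          rw [← mul_assoc]
          refine (mul_le_mul_left (hpt ζ) (u ζ)).trans ?_
          rw [← lintegral_mul_const' _ _ ENNReal.ofReal_ne_top]
          refine lintegral_mono fun ζ' ↦ ?_
          -- Submultiplicativity and evenness split the weight over the three frequencies; the shift
          -- `ξ` costs only the constant `u ξ.2`.
          have h1 : u ζ ≤ u ζ' * u ξ.2 * u (ζ' + ξ.2 - ζ) := by
            have e1 : ζ = ζ' + ξ.2 + -(ζ' + ξ.2 - ζ) := by abel
            calc u ζ = u (ζ' + ξ.2 + -(ζ' + ξ.2 - ζ)) := congrArg u e1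
              _ ≤ u (ζ' + ξ.2) * u (-(ζ' + ξ.2 - ζ)) := hum _ _
              _ ≤ u ζ' * u ξ.2 * u (-(ζ' + ξ.2 - ζ)) := by gcongr; exact hum _ _
              _ = _ := by simp only [u, hve]
          calc S ζ' * G (ζ' + ξ.2 - ζ) * u ζ
              ≤ S ζ' * G (ζ' + ξ.2 - ζ) * (u ζ' * u ξ.2 * u (ζ' + ξ.2 - ζ)) := by gcongr
            _ = _ := by ring
      _ = ∫⁻ ζ', ∫⁻ ζ, u ξ.2 * (S ζ' * u ζ') * (G (ζ' + ξ.2 - ζ) * u (ζ' + ξ.2 - ζ)) :=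
          lintegral_lintegral_swap hm.aemeasurable
      _ = ∫⁻ ζ', u ξ.2 * (S ζ' * u ζ') * ∫⁻ ζ, G ζ * u ζ := by
          congr 1; ext ζ'
          have h5 : Measurable (fun ζ ↦ G (ζ' + ξ.2 - ζ) * u (ζ' + ξ.2 - ζ)) :=
            (hG.mul hu).comp (measurable_const_sub _)
          rw [lintegral_const_mul _ h5,
            lintegral_sub_left_eq_self (fun ζ ↦ G ζ * u ζ)]
      _ = _ := by
          rw [lintegral_mul_const _ (hSu.const_mul _), lintegral_const_mul _ hSu]
          ring
  rw [ENNReal.div_eq_inv_mul, mul_assoc, ← ENNReal.div_eq_inv_mul,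
    ENNReal.le_div_iff_mul_le (Or.inl hc) (Or.inl enorm_ne_top), mul_comm]
  refine hkey.trans ?_
  gcongr
  exact lintegral_supStft_le_modNorm Φ f v

end symbol

/-! ### The `τ`-Wigner distribution of the window -/

section wignerWindow
variable {E : Type} [NormedAddCommGroup E] [InnerProductSpace ℝ E] [FiniteDimensional ℝ E]
  [MeasurableSpace E] [BorelSpace E]

theorem tauWigner_self_ne_zero (τ : ℝ) {φ : 𝓢(E, ℂ)} (hφ : φ ≠ 0) : tauWigner τ φ φ ≠ 0 := by
  intro h0
  have h := ip_tauWigner τ φ φ φ φ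
  rw [h0, conj_ip] at h
  have h1 : ip (0 : 𝓢(Phase E, ℂ)) 0 = 0 := by simp [ip]
  rw [h1] at h
  exact mul_ne_zero (ip_self_ne_zero hφ) (ip_self_ne_zero hφ) h.symm

/-- Covariance rewrites the shifted window as a `τ`-Wigner distribution of shifted functions, and
Moyal's formula then factors the inner product. -/
theorem ambig_tauWigner (τ : ℝ) (φ : 𝓢(E, ℂ)) (w z : E × E) :
    ambig (tauWigner τ φ φ) (wignerPoint τ w z) = ambig φ w * ambig φ z := by
  have h := ip_tauWigner τ φ φ (tf w φ) (tf z φ)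
  rw [tauWigner_tf, ip_smul_right] at h
  have h2 := congrArg (fun c : ℂ ↦ ‖c‖ₑ) h
  simp only [enorm_mul, RCLike.enorm_conj] at h2
  rw [← ofReal_norm, Circle.norm_coe, ENNReal.ofReal_one, one_mul] at h2
  exact h2

theorem rot_sub (w z : E × E) : rot (w - z) = rot w + -rot z := by
  rw [rot, rot, rot, ph_eq, ph_eq, ph_eq, Prod.fst_sub, Prod.snd_sub, map_sub, map_neg, map_neg,
    map_neg, map_sub]
  abel

/-- The ambiguity function of the `τ`-Wigner distribution in a weighted space. -/
theorem lintegral_ambig_tauWigner_le (τ : ℝ) (φ : 𝓢(E, ℂ)) {u : Phase E → ℝ≥0∞}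
    (hu : Measurable u) (hue : ∀ z, u (-z) = u z) (hum : ∀ w z, u (w + z) ≤ u w * u z) :
    ∫⁻ p : Phase E × Phase E, ambig (tauWigner τ φ φ) p * u p.2 ≤
      (∫⁻ z : E × E, ambig φ z * u (rot z)) ^ 2 := by
  have hm : Measurable (fun p : Phase E × Phase E ↦ ambig (tauWigner τ φ φ) p * u p.2) :=
    (continuous_ambig _).measurable.mul (hu.comp measurable_snd)
  rw [← (measurePreserving_wignerPoint (E := E) τ).lintegral_comp hm]
  have hF : Measurable (fun z : E × E ↦ ambig φ z * u (rot z)) :=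
    (continuous_ambig _).measurable.mul (hu.comp continuous_rot.measurable)
  rw [sq, ← lintegral_prod_mul hF.aemeasurable hF.aemeasurable, ← Measure.volume_eq_prod]
  refine lintegral_mono fun p ↦ ?_
  rw [ambig_tauWigner]
  have h1 : u (wignerPoint τ p.1 p.2).2 ≤ u (rot p.1) * u (rot p.2) := by
    change u (rot (p.1 - p.2)) ≤ _
    rw [rot_sub, ← hue (rot p.2)]
    exact hum _ _
  calc ambig φ p.1 * ambig φ p.2 * u (wignerPoint τ p.1 p.2).2
      ≤ ambig φ p.1 * ambig φ p.2 * (u (rot p.1) * u (rot p.2)) := by gcongr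
    _ = _ := by ring

/-- The convolution kernel that dominates the matrix of `Op_τ(σ)`. -/
def kernelBound (τ : ℝ) (σ : 𝓢'(Phase E, ℂ)) (φ : 𝓢(E, ℂ)) (η : E × E) : ℝ≥0∞ :=
  supStft (tauWigner τ φ φ) σ (rot η)

theorem measurable_kernelBound (τ : ℝ) (σ : 𝓢'(Phase E, ℂ)) (φ : 𝓢(E, ℂ)) :
    Measurable (kernelBound τ σ φ) :=
  (measurable_supStft _ _).comp continuous_rot.measurable

theorem enorm_opTau_le (τ : ℝ) (σ : 𝓢'(Phase E, ℂ)) (φ : 𝓢(E, ℂ)) (w z : E × E) :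
    ‖opTau τ σ (tf z φ) (tf w φ)‖ₑ ≤ kernelBound τ σ φ (w - z) := by
  rw [← ofReal_norm, norm_opTau, ofReal_norm]
  exact absStft_le_supStft (tauWigner τ φ φ) σ (wignerPoint τ w z)

theorem lintegral_kernelBound (τ : ℝ) (σ : 𝓢'(Phase E, ℂ)) (φ : 𝓢(E, ℂ)) {u : Phase E → ℝ≥0∞}
    (hu : Measurable u) : ∫⁻ η : E × E, kernelBound τ σ φ η * u (rot η) =
      ∫⁻ ζ, supStft (tauWigner τ φ φ) σ ζ * u ζ :=
  (measurePreserving_rot (E := E)).lintegral_comp ((measurable_supStft (tauWigner τ φ φ) σ).mul hu)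

end wignerWindow

/-! ### The weights -/

section weights
variable {d : ℕ} {v : Phase (Rd d) → ℝ}

theorem IsAdmissible.map_neg (hv : IsAdmissible v) (z : Phase (Rd d)) : v (-z) = v z :=
  hv.even z (-z) (fun i ↦ by simp) (fun i ↦ by simp)

/-- The weight `v ∘ J` on the time-frequency plane. -/
def rotWeight (v : Phase (Rd d) → ℝ) (η : Rd d × Rd d) : ℝ≥0∞ := ENNReal.ofReal (v (rot η))

theorem lintegral_ambig_mul_rotWeight_ne_top (hv : IsAdmissible v) {φ : 𝓢(Rd d, ℂ)}
    (hφ : IsWindow v φ) : ∫⁻ z, ambig φ z * rotWeight v z ≠ ∞ := by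
  have h := hφ.integrable.ne
  rw [modNorm, eLpNorm_one_eq_lintegral_enorm] at h
  simp_rw [eLpNorm_one_eq_lintegral_enorm, enorm_eq_self] at h
  have hm : Measurable (fun z : Rd d × Rd d ↦ ambig φ z * rotWeight v z) :=
    (continuous_ambig φ).measurable.mul
      (ENNReal.continuous_ofReal.comp (hv.continuous.comp continuous_rot)).measurable
  rw [Measure.volume_eq_prod, lintegral_prod_symm _ hm.aemeasurable]
  refine (le_of_eq ?_).trans_lt (lt_top_iff_ne_top.2 h) |>.ne
  congr 1; ext ω
  congr 1; ext x
  have h1 : stft φ (toDist φ) x ω = ip φ (tf (x, ω) φ) := bracket_toDist_eq φ (tf (x, ω) φ)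
  have h2 : v (rot (x, ω)) = v (ph (-ω) x) :=
    hv.even (ph (-ω) x) (rot (x, ω)) (fun i ↦ by simp [rot, ph]) (fun i ↦ by simp [rot, ph])
  rw [h1, rotWeight, h2]
  rfl

/-- The weight `(x, ω) ↦ m₁(ω) m₂(x)` of the Wiener amalgam space. -/
def amalgamWeight (m₁ m₂ : Rd d → ℝ) (z : Rd d × Rd d) : ℝ≥0∞ :=
  ENNReal.ofReal (tensorWeight m₁ m₂ (ph z.2 z.1))

/-- The amalgam weight is `m` with its arguments exchanged. Evenness of `v` in each coordinate
identifies `v` at the exchanged point with `v ∘ rot`, the weight carried by the kernel. -/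
theorem exists_moderatePair (hv : IsAdmissible v) {m₁ m₂ : Rd d → ℝ} (hm₁ : Measurable m₁)
    (hm₂ : Measurable m₂) (hm : IsModerate v (tensorWeight m₁ m₂)) :
    ∃ C, ModeratePair (rotWeight v) (amalgamWeight m₁ m₂) C := by
  obtain ⟨C, hC, hle⟩ := hm.moderate
  refine ⟨ENNReal.ofReal C, ⟨?_, ?_, ?_, ?_, ?_, ENNReal.ofReal_ne_top, ?_, ?_⟩⟩
  · exact ENNReal.measurable_ofReal.comp
      ((hm₁.comp measurable_snd).mul (hm₂.comp measurable_fst))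
  · exact ENNReal.continuous_ofReal.comp (hv.continuous.comp continuous_rot)
  · exact fun z ↦ (ENNReal.ofReal_pos.2 (hm.pos _)).ne'
  · exact fun z ↦ ENNReal.ofReal_ne_top
  · exact fun z ↦ ENNReal.ofReal_ne_top
  · intro z
    rw [rotWeight, rotWeight, ← zero_sub, rot_sub]
    congr 1
    rw [← hv.map_neg]
    congr 1
    simp [rot, ph_eq]
  · intro z η
    have h1 : v (ph η.2 η.1) = v (rot η) :=
      hv.even (rot η) (ph η.2 η.1) (fun i ↦ by simp [rot, ph]) (fun i ↦ by simp [rot, ph])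
    rw [amalgamWeight, amalgamWeight, rotWeight, ← h1, ← ENNReal.ofReal_mul hC,
      ← ENNReal.ofReal_mul (mul_nonneg hC (hv.nonneg _))]
    refine ENNReal.ofReal_le_ofReal (le_trans (le_of_eq ?_) (hle (ph η.2 η.1) (ph z.2 z.1)))
    congr 1
    rw [ph_eq, ph_eq, ph_eq, Prod.fst_add, Prod.snd_add, map_add, map_add]
    abel

theorem amalgamNorm_eq_mixNorm (φ : 𝓢(Rd d, ℂ)) {m₁ m₂ : Rd d → ℝ} (hm₁ : Measurable m₁)
    (hm₁_pos : ∀ x, 0 < m₁ x) (p q : ℝ≥0∞) (f : 𝓢'(Rd d, ℂ)) :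
    amalgamNorm φ m₁ m₂ p q f = mixNorm p q (fun z ↦ absStft φ f z * amalgamWeight m₁ m₂ z) := by
  rw [amalgamNorm, mixNorm]
  congr 1; ext x
  have hF : Measurable (fun ω ↦ ‖stft φ f x ω‖ₑ * ENNReal.ofReal (m₁ ω)) :=
    ((continuous_absStft φ f).measurable.comp measurable_prodMk_left).mul
      (ENNReal.measurable_ofReal.comp hm₁)
  rw [mul_comm, ← eLpNorm_const_mul_ennreal hF]
  congr 1; ext ω
  have h1 : amalgamWeight m₁ m₂ (x, ω) = ENNReal.ofReal (m₁ ω) * ENNReal.ofReal (m₂ x) :=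
    ENNReal.ofReal_mul (hm₁_pos ω).le
  rw [h1, mul_comm, mul_assoc]
  rfl

theorem exists_amalgamWeight_lower_bound {m₁ m₂ : Rd d → ℝ}
    (hM : IsTemperedBelow (tensorWeight m₁ m₂)) : ∃ L : ℝ≥0∞, L ≠ ∞ ∧ ∃ N : ℕ, ∀ z,
      1 ≤ L * ENNReal.ofReal ((1 + ‖z‖) ^ N) * amalgamWeight m₁ m₂ z := by
  rcases hM with h | ⟨c, hc, N, h⟩
  · refine ⟨1, ENNReal.one_ne_top, 0, fun z ↦ ?_⟩
    simpa [amalgamWeight] using h (ph z.2 z.1)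
  · refine ⟨ENNReal.ofReal (c⁻¹ * 2 ^ N), ENNReal.ofReal_ne_top, N, fun z ↦ ?_⟩
    rw [amalgamWeight, ← ENNReal.ofReal_mul (by positivity), ← ENNReal.ofReal_mul (by positivity),
      ENNReal.one_le_ofReal]
    set p : Phase (Rd d) := ph z.2 z.1
    -- Passage from the Euclidean norm of phase space to the maximum norm of the product, where `‖p‖
    -- ≤ 2 * ‖z‖`.
    have h1 : √(1 + ‖p‖ ^ 2) ≤ 2 * (1 + ‖z‖) := by
      have h2 : ‖p‖ ≤ ‖z.2‖ + ‖z.1‖ := norm_le_fst_add_snd p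
      have h3 := _root_.norm_fst_le z
      have h4 := _root_.norm_snd_le z
      rw [Real.sqrt_le_left (by positivity)]
      nlinarith [norm_nonneg p, norm_nonneg z]
    have h5 : 0 < √(1 + ‖p‖ ^ 2) := by positivity
    calc (1 : ℝ) = c⁻¹ * √(1 + ‖p‖ ^ 2) ^ N * (c * (√(1 + ‖p‖ ^ 2) ^ N)⁻¹) := by
          field_simp
      _ ≤ c⁻¹ * (2 * (1 + ‖z‖)) ^ N * tensorWeight m₁ m₂ p := by
          gcongr
          exact h p
      _ = _ := by rw [mul_pow]; ring

/-- The kernel bound in the weighted `L^1` space, in terms of the Sjöstrand norm. -/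
theorem exists_lintegral_kernelBound_le (hv : IsAdmissible v) {φ : 𝓢(Rd d, ℂ)}
    (hφ : IsWindow v φ) {Φ : 𝓢(Phase (Rd d), ℂ)} (hΦ : Φ ≠ 0) (τ : ℝ) :
    ∃ C, C ≠ ∞ ∧ ∀ σ : 𝓢'(Phase (Rd d), ℂ),
      ∫⁻ η, kernelBound τ σ φ η * rotWeight v η ≤ C * sjostrandNorm v Φ σ := by
  have hu : Measurable (fun ζ ↦ ENNReal.ofReal (v ζ)) :=
    (ENNReal.continuous_ofReal.comp hv.continuous).measurable
  have hA : ∫⁻ z : Phase (Rd d) × Phase (Rd d),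
      ambig (tauWigner τ φ φ) z * ENNReal.ofReal (v z.2) ≠ ∞ := by
    refine ne_top_of_le_ne_top (ENNReal.pow_ne_top
      (lintegral_ambig_mul_rotWeight_ne_top hv hφ) (n := 2)) ?_
    refine lintegral_ambig_tauWigner_le τ φ hu (fun z ↦ by rw [hv.map_neg]) fun w z ↦ ?_
    rw [← ENNReal.ofReal_mul (hv.nonneg w)]
    exact ENNReal.ofReal_le_ofReal (hv.submultiplicative w z)
  obtain ⟨C, hC, h⟩ := exists_lintegral_supStft_le (tauWigner_self_ne_zero τ hφ.ne_zero) hΦ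
    hv.continuous hv.nonneg hv.map_neg hv.submultiplicative hA
  exact ⟨C, hC, fun σ ↦ (lintegral_kernelBound τ σ φ hu).trans_le (h σ)⟩

end weights

/-! ### Synthesis of tempered distributions -/

section synthesis
variable {V : Type} [NormedAddCommGroup V] [InnerProductSpace ℝ V] [FiniteDimensional ℝ V]
  [MeasurableSpace V] [BorelSpace V]

theorem conjS_conjS (g : 𝓢(V, ℂ)) : conjS (conjS g) = g := by
  ext t
  rw [conjS_apply, conjS_apply, Complex.conj_conj]

theorem bracket_ext {f h : 𝓢'(V, ℂ)} (hfh : ∀ g, bracket f g = bracket h g) : f = h := by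
  ext g
  have := hfh (conjS g)
  rwa [bracket, bracket, conjS_conjS] at this

theorem bracket_add_left (f h : 𝓢'(V, ℂ)) (g : 𝓢(V, ℂ)) :
    bracket (f + h) g = bracket f g + bracket h g := rfl

theorem bracket_smul_left (c : ℂ) (f : 𝓢'(V, ℂ)) (g : 𝓢(V, ℂ)) :
    bracket (c • f) g = c * bracket f g := rfl

/-- Measurable functions of polynomial growth on the time-frequency plane. -/
structure PolyGrowth (Q : V × V → ℂ) : Prop where
  aestronglyMeasurable : AEStronglyMeasurable Q volume
  bound : ∃ D : ℝ, ∃ N : ℕ, ∀ w, ‖Q w‖ ≤ D * (1 + ‖w‖) ^ N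

theorem PolyGrowth.integrable {Q : V × V → ℂ} (hQ : PolyGrowth Q) (g φ : 𝓢(V, ℂ)) :
    Integrable (fun w ↦ Q w * conj (ip g (tf w φ))) := by
  obtain ⟨D, N, hle⟩ := hQ.bound
  refine ((integrable_pow_mul_ip_tf g φ N).const_mul D).mono'
    (hQ.aestronglyMeasurable.mul
      (Complex.continuous_conj.comp (continuous_ip_tf g φ)).aestronglyMeasurable)
    (Filter.Eventually.of_forall fun w ↦ ?_)
  rw [norm_mul, RCLike.norm_conj, ← mul_assoc]
  gcongr
  exact hle w

/-- The weak definition of the adjoint of `V_φ`, that is of `∫ Q(w) π(w)φ dw`: rapid decay of `V_φ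
g`, uniformly in terms of a Schwartz seminorm, beats the growth of `Q`. -/
theorem PolyGrowth.exists_distribution {Q : V × V → ℂ} (hQ : PolyGrowth Q) (φ : 𝓢(V, ℂ)) :
    ∃ t : 𝓢'(V, ℂ), ∀ g, bracket t g = ∫ w, Q w * conj (ip g (tf w φ)) := by
  obtain ⟨D, N, hle⟩ := hQ.bound
  obtain ⟨q, hq, B, hB, hB0, hqB⟩ := exists_seminorm_integral_ip_tf φ N
  have hD : 0 ≤ D := by
    have := (norm_nonneg _).trans (hle 0)
    simpa using this
  let A : 𝓢(V, ℂ) →ₗ[ℂ] ℂ :=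
    { toFun := fun h ↦ ∫ w, Q w * conj (ip (conjS h) (tf w φ))
      map_add' := fun g h ↦ by
        have e : ∀ w, Q w * conj (ip (conjS (g + h)) (tf w φ)) =
            Q w * conj (ip (conjS g) (tf w φ)) + Q w * conj (ip (conjS h) (tf w φ)) := by
          intro w
          have : conjS (g + h) = conjS g + conjS h := map_add (SchwartzMap.postcompCLM _) g h
          rw [this, ip_add_left, map_add, mul_add]
        simp_rw [e]
        exact integral_add (hQ.integrable _ _) (hQ.integrable _ _)
      map_smul' := fun c h ↦ by
        have e : ∀ w, Q w * conj (ip (conjS (c • h)) (tf w φ)) =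
            c * (Q w * conj (ip (conjS h) (tf w φ))) := by
          intro w
          rw [conjS_smul, ip_smul_left, map_mul, Complex.conj_conj]
          ring
        simp_rw [e]
        exact integral_const_mul _ _ }
  have hcont : Continuous (fun h : 𝓢(V, ℂ) ↦ A h) := by
    have hc : Continuous (fun h : 𝓢(V, ℂ) ↦ D * (q (conjS h) * ∫ w, B w)) :=
      continuous_const.mul ((hq.comp (SchwartzMap.postcompCLM (𝕜 := ℝ)
        (Complex.conjCLE : ℂ →L[ℝ] ℂ)).continuous).mul continuous_const)
    refine continuous_of_continuousAt_zero A.toAddMonoidHom ?_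
    have h0 : (A.toAddMonoidHom : 𝓢(V, ℂ) → ℂ) 0 = 0 := map_zero A
    rw [ContinuousAt, h0]
    refine squeeze_zero_norm (a := fun h : 𝓢(V, ℂ) ↦ D * (q (conjS h) * ∫ w, B w)) ?_ ?_
    · intro h
      have hi : Integrable (fun w ↦ D * (q (conjS h) * B w)) := (hB.const_mul _).const_mul _
      refine (norm_integral_le_of_norm_le hi (Filter.Eventually.of_forall fun w ↦ ?_)).trans
        (le_of_eq ?_)
      · rw [norm_mul, RCLike.norm_conj]
        calc ‖Q w‖ * ‖ip (conjS h) (tf w φ)‖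
            ≤ D * (1 + ‖w‖) ^ N * ‖ip (conjS h) (tf w φ)‖ := by gcongr; exact hle w
          _ = D * ((1 + ‖w‖) ^ N * ‖ip (conjS h) (tf w φ)‖) := by ring
          _ ≤ _ := mul_le_mul_of_nonneg_left (hqB _ w) hD
      · rw [integral_const_mul, integral_const_mul]
    · have := hc.tendsto 0
      have e : conjS (0 : 𝓢(V, ℂ)) = 0 := map_zero (SchwartzMap.postcompCLM _)
      simpa [e] using this
  refine ⟨ContinuousLinearMap.toPointwiseConvergenceCLM ℂ (RingHom.id ℂ) 𝓢(V, ℂ) ℂ ⟨A, hcont⟩,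
    fun g ↦ ?_⟩
  change ∫ w, Q w * conj (ip (conjS (conjS g)) (tf w φ)) = _
  rw [conjS_conjS]

end synthesis

/-! ### The operator on distributions with a bounded weighted short-time Fourier transform -/

section operator
variable {E : Type} [NormedAddCommGroup E] [InnerProductSpace ℝ E] [FiniteDimensional ℝ E]
  [MeasurableSpace E] [BorelSpace E] {ρ M : E × E → ℝ≥0∞} {C D : ℝ≥0∞}

/-- Up to normalization, the short-time Fourier transform of the image of `f` under `Op_τ(σ)`. -/
def opStft (τ : ℝ) (σ : 𝓢'(Phase E, ℂ)) (φ : 𝓢(E, ℂ)) (f : 𝓢'(E, ℂ)) (w : E × E) : ℂ :=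
  ∫ z, bracket f (tf z φ) * opTau τ σ (tf z φ) (tf w φ)

variable (τ : ℝ) (σ : 𝓢'(Phase E, ℂ)) {φ : 𝓢(E, ℂ)} {f : 𝓢'(E, ℂ)}

theorem continuous_bracket_mul_opTau (φ : 𝓢(E, ℂ)) (f : 𝓢'(E, ℂ)) :
    Continuous (fun p : (E × E) × (E × E) ↦
      bracket f (tf p.2 φ) * opTau τ σ (tf p.2 φ) (tf p.1 φ)) :=
  ((continuous_bracket_tf f φ).comp continuous_snd).mul (continuous_opTau τ σ φ φ)

theorem lintegral_bracket_mul_opTau_le (φ : 𝓢(E, ℂ)) (f : 𝓢'(E, ℂ)) (w : E × E) :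
    ∫⁻ z, ‖bracket f (tf z φ) * opTau τ σ (tf z φ) (tf w φ)‖ₑ ≤
      ∫⁻ z, absStft φ f z * kernelBound τ σ φ (w - z) := by
  refine lintegral_mono fun z ↦ ?_
  rw [enorm_mul]
  exact mul_le_mul_right (enorm_opTau_le τ σ φ w z) _

theorem enorm_opStft_le (φ : 𝓢(E, ℂ)) (f : 𝓢'(E, ℂ)) (w : E × E) :
    ‖opStft τ σ φ f w‖ₑ ≤ ∫⁻ z, absStft φ f z * kernelBound τ σ φ (w - z) :=
  (enorm_integral_le_lintegral_enorm _).trans (lintegral_bracket_mul_opTau_le τ σ φ f w)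

theorem ModeratePair.integrable_bracket_mul_opTau (h : ModeratePair ρ M C)
    (hB : ∫⁻ η, kernelBound τ σ φ η * ρ η ≠ ∞) (hD : D ≠ ∞)
    (hf : ∀ z, absStft φ f z * M z ≤ D) (w : E × E) :
    Integrable (fun z ↦ bracket f (tf z φ) * opTau τ σ (tf z φ) (tf w φ)) := by
  refine ⟨((continuous_bracket_mul_opTau τ σ φ f).comp
    (Continuous.prodMk_right w)).aestronglyMeasurable, ?_⟩
  refine (lintegral_bracket_mul_opTau_le τ σ φ f w).trans_lt (lt_top_iff_ne_top.2 ?_)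
  exact h.lintegral_ne_top (h.convolution_mul_le_of_bound hf (measurable_kernelBound τ σ φ) w)
    (ENNReal.mul_ne_top h.const_ne_top (ENNReal.mul_ne_top hD hB))

theorem aestronglyMeasurable_opStft (φ : 𝓢(E, ℂ)) (f : 𝓢'(E, ℂ)) :
    AEStronglyMeasurable (opStft τ σ φ f) volume :=
  (StronglyMeasurable.integral_prod_right
    (continuous_bracket_mul_opTau τ σ φ f).stronglyMeasurable).aestronglyMeasurable

/-- The convolution bound controls `opStft` times `M`; the polynomial lower bound on `M` removes the
weight. -/
theorem ModeratePair.polyGrowth_opStft (h : ModeratePair ρ M C)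
    (hB : ∫⁻ η, kernelBound τ σ φ η * ρ η ≠ ∞) (hD : D ≠ ∞)
    (hf : ∀ z, absStft φ f z * M z ≤ D) {L : ℝ≥0∞} (hL : L ≠ ∞) {N : ℕ}
    (hM : ∀ z, 1 ≤ L * ENNReal.ofReal ((1 + ‖z‖) ^ N) * M z) :
    PolyGrowth (opStft τ σ φ f) := by
  refine ⟨aestronglyMeasurable_opStft τ σ φ f, ?_⟩
  set X := C * (D * ∫⁻ η, kernelBound τ σ φ η * ρ η)
  have hX : X ≠ ∞ := ENNReal.mul_ne_top h.const_ne_top (ENNReal.mul_ne_top hD hB)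
  refine ⟨(X * L).toReal, N, fun w ↦ ?_⟩
  have h1 : ‖opStft τ σ φ f w‖ₑ * M w ≤ X :=
    (mul_le_mul_left (enorm_opStft_le τ σ φ f w) (M w)).trans
      (h.convolution_mul_le_of_bound hf (measurable_kernelBound τ σ φ) w)
  have h2 : ‖opStft τ σ φ f w‖ₑ ≤ X * L * ENNReal.ofReal ((1 + ‖w‖) ^ N) := by
    calc ‖opStft τ σ φ f w‖ₑ
        ≤ ‖opStft τ σ φ f w‖ₑ * (L * ENNReal.ofReal ((1 + ‖w‖) ^ N) * M w) :=
          le_mul_of_one_le_right' (hM w)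
      _ = ‖opStft τ σ φ f w‖ₑ * M w * (L * ENNReal.ofReal ((1 + ‖w‖) ^ N)) := by ring
      _ ≤ X * (L * ENNReal.ofReal ((1 + ‖w‖) ^ N)) := by gcongr
      _ = _ := by ring
  have h3 := ENNReal.toReal_mono
    (ENNReal.mul_ne_top (ENNReal.mul_ne_top hX hL) ENNReal.ofReal_ne_top) h2
  rwa [toReal_enorm, ENNReal.toReal_mul, ENNReal.toReal_ofReal (by positivity)] at h3

open Classical in
/-- The operator `Op_τ(σ)` on distributions, by synthesis from the short-time Fourier transform. -/
def tauOperator (φ : 𝓢(E, ℂ)) (f : 𝓢'(E, ℂ)) : 𝓢'(E, ℂ) :=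
  if hf : PolyGrowth (opStft τ σ φ f) then
    ((ip φ φ)⁻¹ ^ 2) • Classical.choose (hf.exists_distribution φ) else 0

/-- Two normalizing factors occur: one for the inversion formula inside `opStft`, one for the
synthesis. -/
theorem bracket_tauOperator (hf : PolyGrowth (opStft τ σ φ f)) (g : 𝓢(E, ℂ)) :
    bracket (tauOperator τ σ φ f) g =
      (ip φ φ)⁻¹ ^ 2 * ∫ w, opStft τ σ φ f w * conj (ip g (tf w φ)) := by
  rw [tauOperator, dif_pos hf, bracket_smul_left,
    Classical.choose_spec (hf.exists_distribution φ) g]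

theorem ip_mul_bracket_tf (φ : 𝓢(E, ℂ)) (f : 𝓢'(E, ℂ)) (w : E × E) :
    ip φ φ * bracket f (tf w φ) = ∫ z, bracket f (tf z φ) * ip (tf z φ) (tf w φ) := by
  have h := bracket_inversion f (tf w φ) φ φ
  simp_rw [conj_ip] at h
  rw [h]
  congr 1; ext z
  exact mul_comm _ _

theorem continuous_triple (φ : 𝓢(E, ℂ)) (f : 𝓢'(E, ℂ)) (w₀ : E × E) :
    Continuous (fun p : (E × E) × ((E × E) × (E × E)) ↦ bracket f (tf p.1 φ) *
      (opTau τ σ (tf p.2.2 φ) (tf p.2.1 φ) * ip (tf p.1 φ) (tf p.2.2 φ) *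
        conj (ip (tf w₀ φ) (tf p.2.1 φ)))) := by
  have h1 : Continuous (fun p : (E × E) × ((E × E) × (E × E)) ↦ bracket f (tf p.1 φ)) :=
    (continuous_bracket_tf f φ).comp continuous_fst
  have h2 : Continuous (fun p : (E × E) × ((E × E) × (E × E)) ↦
      opTau τ σ (tf p.2.2 φ) (tf p.2.1 φ)) := by
    have h := continuous_opTau τ σ φ φ
    generalize opTau τ σ = F at h ⊢
    exact h.comp continuous_snd
  have e : Continuous (fun p : (E × E) × ((E × E) × (E × E)) ↦ (p.1, p.2.2)) := by fun_prop
  have h3 : Continuous (fun p : (E × E) × ((E × E) × (E × E)) ↦ ip (tf p.1 φ) (tf p.2.2 φ)) := by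
    have h := continuous_ip_tf_tf φ φ
    generalize (ip : 𝓢(E, ℂ) → 𝓢(E, ℂ) → ℂ) = F at h ⊢
    exact h.comp e
  have e' : Continuous (fun p : (E × E) × ((E × E) × (E × E)) ↦ p.2.1) := by fun_prop
  have h4 : Continuous (fun p : (E × E) × ((E × E) × (E × E)) ↦ ip (tf w₀ φ) (tf p.2.1 φ)) :=
    (continuous_ip_tf (tf w₀ φ) φ).comp e'
  exact h1.mul ((h2.mul h3).mul (Complex.continuous_conj.comp h4))

/-- The integrand is dominated by an iterated convolution of `absStft φ f` with the ambiguity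
function, the kernel bound, and the ambiguity function again. Each convolution preserves boundedness
with the weight `M`, so evaluation at `w₀` is finite. -/
theorem ModeratePair.integrable_triple (h : ModeratePair ρ M C)
    (hA : ∫⁻ z, ambig φ z * ρ z ≠ ∞) (hB : ∫⁻ η, kernelBound τ σ φ η * ρ η ≠ ∞) (hD : D ≠ ∞)
    (hf : ∀ z, absStft φ f z * M z ≤ D) (w₀ : E × E) :
    Integrable (fun p : (E × E) × ((E × E) × (E × E)) ↦ bracket f (tf p.1 φ) *
      (opTau τ σ (tf p.2.2 φ) (tf p.2.1 φ) * ip (tf p.1 φ) (tf p.2.2 φ) *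
        conj (ip (tf w₀ φ) (tf p.2.1 φ)))) (volume.prod volume) := by
  have hFm : Measurable (absStft φ f) := (continuous_absStft φ f).measurable
  have hAm : Measurable (ambig φ) := (continuous_ambig φ).measurable
  have hKm := measurable_kernelBound τ σ φ
  refine ⟨(continuous_triple τ σ φ f w₀).aestronglyMeasurable, ?_⟩
  set G₁ : E × E → ℝ≥0∞ := fun z' ↦ ∫⁻ z, absStft φ f z * ambig φ (z' - z)
  set G₂ : E × E → ℝ≥0∞ := fun w ↦ ∫⁻ z', G₁ z' * kernelBound τ σ φ (w - z')
  have hconv : ∀ {G B : E × E → ℝ≥0∞}, Measurable G → Measurable B →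
      Measurable (fun p : (E × E) × (E × E) ↦ G p.2 * B (p.1 - p.2)) := fun hG hB ↦
    (hG.comp measurable_snd).mul (hB.comp (measurable_fst.sub measurable_snd))
  have hslice : ∀ {G B : E × E → ℝ≥0∞} (w : E × E), Measurable G → Measurable B →
      Measurable (fun z ↦ G z * B (w - z)) := fun w hG hB ↦
    hG.mul (hB.comp (measurable_const_sub w))
  have hG₁ : Measurable G₁ := (hconv hFm hAm).lintegral_prod_right'
  have hG₂ : Measurable G₂ := (hconv hG₁ hKm).lintegral_prod_right'
  have b₁ : ∀ z, G₁ z * M z ≤ _ := h.convolution_mul_le_of_bound hf hAm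
  have b₂ : ∀ z, G₂ z * M z ≤ _ := h.convolution_mul_le_of_bound b₁ hKm
  have b₃ := h.convolution_mul_le_of_bound b₂ hAm w₀
  have hfin : ∫⁻ w, G₂ w * ambig φ (w₀ - w) ≠ ∞ := by
    refine h.lintegral_ne_top b₃ ?_
    have hC := h.const_ne_top
    exact ENNReal.mul_ne_top hC (ENNReal.mul_ne_top (ENNReal.mul_ne_top hC (ENNReal.mul_ne_top
      (ENNReal.mul_ne_top hC (ENNReal.mul_ne_top hD hA)) hB)) hA)
  refine lt_of_le_of_lt ?_ (lt_top_iff_ne_top.2 hfin)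
  have hHm : Measurable (fun p : (E × E) × ((E × E) × (E × E)) ↦
      absStft φ f p.1 * ambig φ (p.2.2 - p.1) *
        (kernelBound τ σ φ (p.2.1 - p.2.2) * ambig φ (w₀ - p.2.1))) := by
    refine Measurable.mul ((hFm.comp measurable_fst).mul (hAm.comp
      ((measurable_snd.comp measurable_snd).sub measurable_fst))) (Measurable.mul (hKm.comp ?_)
      (hAm.comp ((measurable_const_sub w₀).comp (measurable_fst.comp measurable_snd))))
    exact (measurable_fst.comp measurable_snd).sub (measurable_snd.comp measurable_snd)
  have hm₂ : Measurable (fun p : (E × E) × (E × E) ↦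
      G₁ p.2 * (kernelBound τ σ φ (p.1 - p.2) * ambig φ (w₀ - p.1))) :=
    (hG₁.comp measurable_snd).mul ((hKm.comp (measurable_fst.sub measurable_snd)).mul
      (hAm.comp ((measurable_const_sub w₀).comp measurable_fst)))
  calc _ ≤ ∫⁻ p : (E × E) × ((E × E) × (E × E)), absStft φ f p.1 * ambig φ (p.2.2 - p.1) *
        (kernelBound τ σ φ (p.2.1 - p.2.2) * ambig φ (w₀ - p.2.1)) ∂(volume.prod volume) := by
        refine lintegral_mono fun p ↦ ?_
        rw [enorm_mul, enorm_mul, enorm_mul, RCLike.enorm_conj, enorm_ip_tf_tf, enorm_ip_tf_tf,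
          ← ambig_neg φ (p.2.1 - w₀), neg_sub]
        calc absStft φ f p.1 * (‖opTau τ σ (tf p.2.2 φ) (tf p.2.1 φ)‖ₑ * ambig φ (p.2.2 - p.1) *
              ambig φ (w₀ - p.2.1))
            ≤ absStft φ f p.1 * (kernelBound τ σ φ (p.2.1 - p.2.2) * ambig φ (p.2.2 - p.1) *
              ambig φ (w₀ - p.2.1)) := by gcongr; exact enorm_opTau_le τ σ φ _ _
          _ = _ := by ring
    _ = ∫⁻ p : (E × E) × (E × E),
          G₁ p.2 * (kernelBound τ σ φ (p.1 - p.2) * ambig φ (w₀ - p.1)) := by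
        rw [lintegral_prod_symm _ hHm.aemeasurable]
        congr 1; ext p
        exact lintegral_mul_const (kernelBound τ σ φ (p.1 - p.2) * ambig φ (w₀ - p.1))
          (hslice p.2 hFm hAm)
    _ = ∫⁻ w, ∫⁻ z', G₁ z' * kernelBound τ σ φ (w - z') * ambig φ (w₀ - w) := by
        rw [Measure.volume_eq_prod, lintegral_prod _ hm₂.aemeasurable]
        simp_rw [mul_assoc]
    _ = _ := by
        congr 1; ext w
        exact lintegral_mul_const _ (hslice w hG₁ hKm)

/-- `opStft` satisfies the reproducing formula, so the synthesized distribution has it as its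
short-time Fourier transform up to normalization. In the triple integral, integrating first over `z`
reproduces `V_φ f`, while integrating first over the pair `p` reproduces the matrix entry of the
operator. -/
theorem ModeratePair.integral_opStft_mul (h : ModeratePair ρ M C) (hφ : φ ≠ 0)
    (hA : ∫⁻ z, ambig φ z * ρ z ≠ ∞) (hB : ∫⁻ η, kernelBound τ σ φ η * ρ η ≠ ∞) (hD : D ≠ ∞)
    (hf : ∀ z, absStft φ f z * M z ≤ D) (w₀ : E × E) :
    ∫ w, opStft τ σ φ f w * conj (ip (tf w₀ φ) (tf w φ)) = ip φ φ * opStft τ σ φ f w₀ := by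
  have hH := h.integrable_triple τ σ hA hB hD hf w₀
  have hc := ip_self_ne_zero hφ
  have hsw := integral_integral_swap (f := fun (z : E × E) (p : (E × E) × (E × E)) ↦
    bracket f (tf z φ) * (opTau τ σ (tf p.2 φ) (tf p.1 φ) * ip (tf z φ) (tf p.2 φ) *
      conj (ip (tf w₀ φ) (tf p.1 φ)))) hH
  have hJ := hH.integral_prod_right
  have e₁ : ∀ p : (E × E) × (E × E), ∫ z, bracket f (tf z φ) *
      (opTau τ σ (tf p.2 φ) (tf p.1 φ) * ip (tf z φ) (tf p.2 φ) *
        conj (ip (tf w₀ φ) (tf p.1 φ))) =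
      ip φ φ * (bracket f (tf p.2 φ) * opTau τ σ (tf p.2 φ) (tf p.1 φ) *
        conj (ip (tf w₀ φ) (tf p.1 φ))) := by
    intro p
    calc _ = ∫ z, bracket f (tf z φ) * ip (tf z φ) (tf p.2 φ) *
          (opTau τ σ (tf p.2 φ) (tf p.1 φ) * conj (ip (tf w₀ φ) (tf p.1 φ))) := by
          congr 1; ext z; ring
      _ = _ := by rw [integral_mul_const, ← ip_mul_bracket_tf]; ring
  have e₂ : ∀ z, ∫ p : (E × E) × (E × E), bracket f (tf z φ) *
      (opTau τ σ (tf p.2 φ) (tf p.1 φ) * ip (tf z φ) (tf p.2 φ) *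
        conj (ip (tf w₀ φ) (tf p.1 φ))) =
      ip φ φ ^ 2 * (bracket f (tf z φ) * opTau τ σ (tf z φ) (tf w₀ φ)) := by
    intro z
    rw [integral_const_mul, ← (opTau_eq_integral τ σ (tf z φ) (tf w₀ φ) φ).2]
    ring
  simp only [e₁] at hJ hsw
  simp only [e₂] at hsw
  -- The known integrability `hJ` carries the factor `ip φ φ`, which is nonzero and can be dropped
  -- before applying Fubini in `p`.
  rw [integral_const_mul, integral_const_mul, Measure.volume_eq_prod (E × E) (E × E),
    integral_prod _ ((integrable_const_mul_iff (isUnit_iff_ne_zero.2 hc) _).1 hJ)] at hsw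
  simp only [integral_mul_const] at hsw
  have h1 : ip φ φ * (ip φ φ * opStft τ σ φ f w₀) =
      ip φ φ * ∫ w, opStft τ σ φ f w * conj (ip (tf w₀ φ) (tf w φ)) := by
    rw [← mul_assoc, ← sq]
    exact hsw
  exact (mul_left_cancel₀ hc h1).symm

end operator

/-! ### The extended operator and its norm estimate. -/

section extension
variable {E : Type} [NormedAddCommGroup E] [InnerProductSpace ℝ E] [FiniteDimensional ℝ E]
  [MeasurableSpace E] [BorelSpace E] {ρ M : E × E → ℝ≥0∞} {C : ℝ≥0∞}

/-- The distributions whose short-time Fourier transform is bounded with the weight `M`. -/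
def boundedStft (φ : 𝓢(E, ℂ)) (M : E × E → ℝ≥0∞) : Set 𝓢'(E, ℂ) :=
  {f | ∃ D, D ≠ ∞ ∧ ∀ z, absStft φ f z * M z ≤ D}

theorem add_mem_boundedStft {φ : 𝓢(E, ℂ)} {f h : 𝓢'(E, ℂ)} (hf : f ∈ boundedStft φ M)
    (hh : h ∈ boundedStft φ M) : f + h ∈ boundedStft φ M := by
  obtain ⟨D, hD, hf⟩ := hf
  obtain ⟨D', hD', hh⟩ := hh
  refine ⟨D + D', ENNReal.add_ne_top.2 ⟨hD, hD'⟩, fun z ↦ ?_⟩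
  calc absStft φ (f + h) z * M z ≤ (absStft φ f z + absStft φ h z) * M z := by
        gcongr; exact enorm_add_le _ _
    _ = absStft φ f z * M z + absStft φ h z * M z := add_mul _ _ _
    _ ≤ D + D' := add_le_add (hf z) (hh z)

theorem smul_mem_boundedStft {φ : 𝓢(E, ℂ)} {f : 𝓢'(E, ℂ)} (c : ℂ) (hf : f ∈ boundedStft φ M) :
    c • f ∈ boundedStft φ M := by
  obtain ⟨D, hD, hf⟩ := hf
  refine ⟨‖c‖ₑ * D, ENNReal.mul_ne_top enorm_ne_top hD, fun z ↦ ?_⟩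
  rw [absStft, bracket_smul_left, enorm_mul, mul_assoc]
  exact mul_le_mul_right (hf z) _

/-- The operator defined by synthesis is the extension of `Op_τ(σ)`. -/
theorem ModeratePair.isTauOperatorOn (h : ModeratePair ρ M C) (τ : ℝ) (σ : 𝓢'(Phase E, ℂ))
    {φ : 𝓢(E, ℂ)} (hφ : φ ≠ 0) (hA : ∫⁻ z, ambig φ z * ρ z ≠ ∞)
    (hB : ∫⁻ η, kernelBound τ σ φ η * ρ η ≠ ∞) {L : ℝ≥0∞} (hL : L ≠ ∞) {N : ℕ}
    (hM : ∀ z, 1 ≤ L * ENNReal.ofReal ((1 + ‖z‖) ^ N) * M z) {W : Set 𝓢'(E, ℂ)}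
    (hW : W ⊆ boundedStft φ M) : IsTauOperatorOn τ σ φ W (tauOperator τ σ φ) := by
  have hc := ip_self_ne_zero hφ
  have hgrowth : ∀ f ∈ boundedStft φ M, PolyGrowth (opStft τ σ φ f) := by
    rintro f ⟨D, hD, hf⟩
    exact h.polyGrowth_opStft τ σ hB hD hf hL hM
  have hint : ∀ f ∈ boundedStft φ M, ∀ w,
      Integrable (fun z ↦ bracket f (tf z φ) * opTau τ σ (tf z φ) (tf w φ)) := by
    rintro f ⟨D, hD, hf⟩ w
    exact h.integrable_bracket_mul_opTau τ σ hB hD hf w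
  refine ⟨?_, ?_, ?_, ?_, ?_⟩
  · intro f hf k hk
    replace hf := hW hf
    replace hk := hW hk
    refine bracket_ext fun g ↦ ?_
    rw [bracket_add_left, bracket_tauOperator τ σ (hgrowth _ hf),
      bracket_tauOperator τ σ (hgrowth _ hk),
      bracket_tauOperator τ σ (hgrowth _ (add_mem_boundedStft hf hk)), ← mul_add,
      ← integral_add ((hgrowth _ hf).integrable g φ) ((hgrowth _ hk).integrable g φ)]
    congr 2; ext w
    rw [← add_mul, opStft, opStft, opStft, ← integral_add (hint f hf w) (hint k hk w)]
    simp_rw [bracket_add_left, add_mul]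
  · intro c f hf
    replace hf := hW hf
    refine bracket_ext fun g ↦ ?_
    rw [bracket_smul_left, bracket_tauOperator τ σ (hgrowth _ hf),
      bracket_tauOperator τ σ (hgrowth _ (smul_mem_boundedStft c hf)), mul_left_comm,
      ← integral_const_mul c]
    congr 2; ext w
    rw [← mul_assoc, opStft, opStft, ← integral_const_mul c]
    simp_rw [bracket_smul_left, mul_assoc]
  · intro f hf g
    rw [bracket_tauOperator τ σ (hgrowth _ (hW hf))]
    -- For Schwartz `f` the synthesis formula is the matrix representation of `Op_τ(σ)` read as an
    -- iterated integral.
    obtain ⟨hi, he⟩ := opTau_eq_integral τ σ f g φ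
    rw [Measure.volume_eq_prod (E × E) (E × E)] at hi he
    rw [integral_prod _ hi] at he
    rw [inv_pow, inv_mul_eq_iff_eq_mul₀ (pow_ne_zero 2 hc), he]
    congr 1; ext w
    rw [opStft, ← integral_mul_const]
    congr 1; ext z
    rw [bracket_toDist_eq, mul_comm (ip f _)]
  · intro f hf x ω
    refine (integrable_phase_iff _).1 ?_
    exact hint f (hW hf) (x, ω)
  · intro f hf x ω
    obtain ⟨D, hD, hle⟩ := hW hf
    have h1 : stft φ (tauOperator τ σ φ f) x ω =
        bracket (tauOperator τ σ φ f) (tf (x, ω) φ) := rfl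
    -- The reproducing formula cancels one of the two normalizing factors; the remaining one is that
    -- of the required formula.
    rw [h1, bracket_tauOperator τ σ (hgrowth _ (hW hf)),
      h.integral_opStft_mul τ σ hφ hA hB hD hle, ← ip_self, sq, mul_assoc,
      inv_mul_cancel_left₀ hc]
    congr 1
    exact (integral_phase (fun z : Phase E ↦
      stft φ f z.fst z.snd * opTau τ σ (tfShift z.fst z.snd φ) (tfShift x ω φ))).symm

/-- Pointwise domination by a weighted convolution followed by Young's inequality; neither exponent
enters the constant. -/
theorem ModeratePair.mixNorm_tauOperator_le (h : ModeratePair ρ M C) (τ : ℝ)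
    (σ : 𝓢'(Phase E, ℂ)) {φ : 𝓢(E, ℂ)} (hφ : φ ≠ 0) (hA : ∫⁻ z, ambig φ z * ρ z ≠ ∞)
    (hB : ∫⁻ η, kernelBound τ σ φ η * ρ η ≠ ∞) {L : ℝ≥0∞} (hL : L ≠ ∞) {N : ℕ}
    (hM : ∀ z, 1 ≤ L * ENNReal.ofReal ((1 + ‖z‖) ^ N) * M z) {f : 𝓢'(E, ℂ)}
    (hf : f ∈ boundedStft φ M) {p q : ℝ≥0∞} (hp : 1 ≤ p) (hq : 1 ≤ q) :
    mixNorm p q (fun z ↦ absStft φ (tauOperator τ σ φ f) z * M z) ≤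
      ‖(ip φ φ)⁻¹‖ₑ * C * (∫⁻ η, kernelBound τ σ φ η * ρ η) *
        mixNorm p q (fun z ↦ absStft φ f z * M z) := by
  obtain ⟨D, hD, hle⟩ := hf
  have hc := ip_self_ne_zero hφ
  have hF : Measurable (fun z ↦ absStft φ f z * M z) :=
    (continuous_absStft φ f).measurable.mul h.measurable
  have hK : Measurable (fun η ↦ kernelBound τ σ φ η * ρ η) :=
    (measurable_kernelBound τ σ φ).mul h.continuous.measurable
  have hpt : ∀ w, absStft φ (tauOperator τ σ φ f) w * M w ≤ ‖(ip φ φ)⁻¹‖ₑ * C *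
      ∫⁻ z, (absStft φ f z * M z) * (kernelBound τ σ φ (w - z) * ρ (w - z)) := by
    intro w
    rw [absStft, bracket_tauOperator τ σ (h.polyGrowth_opStft τ σ hB hD hle hL hM),
      h.integral_opStft_mul τ σ hφ hA hB hD hle, sq, mul_assoc, inv_mul_cancel_left₀ hc,
      enorm_mul, mul_assoc, mul_assoc]
    refine mul_le_mul_right ?_ _
    exact (mul_le_mul_left (enorm_opStft_le τ σ φ f w) (M w)).trans (h.convolution_mul_le _ _ w)
  have hconv : Measurable (fun w ↦
      ∫⁻ z, (absStft φ f z * M z) * (kernelBound τ σ φ (w - z) * ρ (w - z))) :=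
    Measurable.lintegral_prod_right' (f := fun p : (E × E) × (E × E) ↦
      (absStft φ f p.2 * M p.2) * (kernelBound τ σ φ (p.1 - p.2) * ρ (p.1 - p.2)))
      ((hF.comp measurable_snd).mul (hK.comp (measurable_fst.sub measurable_snd)))
  refine (mixNorm_mono hpt).trans ?_
  rw [mixNorm_const_mul hconv, mul_assoc (‖(ip φ φ)⁻¹‖ₑ * C)]
  exact mul_le_mul_right (mixNorm_convolution_le hp hq hF hK) _

end extension

end TauPsiDO
end

/-! ### The theorem: assembling the constants. -/

theorem mainTheorem6 (d : ℕ) (v : Phase (Rd d) → ℝ) (hv : IsAdmissible v)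
    (m₁ m₂ : Rd d → ℝ) (hm₁ : Measurable m₁) (hm₂ : Measurable m₂)
    (hm₁_pos : ∀ x, 0 < m₁ x) (hm₂_pos : ∀ x, 0 < m₂ x)
    (hm : IsModerate v (tensorWeight m₁ m₂)) (hM : IsTemperedBelow (tensorWeight m₁ m₂))
    (φ : 𝓢(Rd d, ℂ)) (hφ : IsWindow v φ)
    (Φ : 𝓢(Phase (Rd d), ℂ)) (hΦ : Φ ≠ 0)
    (τ : ℝ) (hτ : τ ∈ Set.Icc (0 : ℝ) 1) :
    ∃ C : ℝ≥0, 0 < C ∧ ∀ p q : ℝ≥0∞, 1 ≤ p → 1 ≤ q →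
      ∀ σ : 𝓢'(Phase (Rd d), ℂ), sjostrandNorm v Φ σ < ∞ →
        ∃ T : 𝓢'(Rd d, ℂ) → 𝓢'(Rd d, ℂ),
          IsTauOperatorOn τ σ φ (Amalgam φ m₁ m₂ p q) T ∧
          ∀ f ∈ Amalgam φ m₁ m₂ p q, T f ∈ Amalgam φ m₁ m₂ p q ∧
            amalgamNorm φ m₁ m₂ p q (T f) ≤
              C * sjostrandNorm v Φ σ * amalgamNorm φ m₁ m₂ p q f := by
  obtain ⟨C, h⟩ := exists_moderatePair hv hm₁ hm₂ hm
  obtain ⟨L, hL, N, hLN⟩ := exists_amalgamWeight_lower_bound hM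
  obtain ⟨K, hK, hKle⟩ := exists_lintegral_kernelBound_le hv hφ hΦ τ
  have hA := lintegral_ambig_mul_rotWeight_ne_top hv hφ
  set X := ‖(ip φ φ)⁻¹‖ₑ * C * K
  have hX : X ≠ ∞ := ENNReal.mul_ne_top (ENNReal.mul_ne_top enorm_ne_top h.const_ne_top) hK
  -- The summand `1` only ensures positivity. `X` is chosen before the exponents and the symbol, and
  -- the same operator serves all `p` and `q`.
  refine ⟨X.toNNReal + 1, by positivity, fun p q hp hq σ hσ ↦ ⟨tauOperator τ σ φ, ?_⟩⟩
  have hB := ne_top_of_le_ne_top (ENNReal.mul_ne_top hK hσ.ne) (hKle σ)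
  -- All amalgam spaces embed into one space of distributions with bounded weighted transform, on
  -- which the operator is already constructed.
  have hW : Amalgam φ m₁ m₂ p q ⊆ boundedStft φ (amalgamWeight m₁ m₂) := by
    intro f hf
    have hf' : amalgamNorm φ m₁ m₂ p q f ≠ ∞ := ne_of_lt hf
    rw [amalgamNorm_eq_mixNorm φ hm₁ hm₁_pos] at hf'
    exact h.exists_bound_absStft hφ.ne_zero hA hp hq hf'
  refine ⟨h.isTauOperatorOn τ σ hφ.ne_zero hA hB hL hLN hW, fun f hf ↦ ?_⟩
  have hle : amalgamNorm φ m₁ m₂ p q (tauOperator τ σ φ f) ≤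
      (X.toNNReal + 1 : ℝ≥0) * sjostrandNorm v Φ σ * amalgamNorm φ m₁ m₂ p q f := by
    rw [amalgamNorm_eq_mixNorm φ hm₁ hm₁_pos, amalgamNorm_eq_mixNorm φ hm₁ hm₁_pos]
    refine (h.mixNorm_tauOperator_le τ σ hφ.ne_zero hA hB hL hLN (hW hf) hp hq).trans ?_
    refine mul_le_mul_left ?_ _
    calc _ ≤ ‖(ip φ φ)⁻¹‖ₑ * C * (K * sjostrandNorm v Φ σ) :=
          mul_le_mul_right (hKle σ) _
      _ = X * sjostrandNorm v Φ σ := by rw [← mul_assoc]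
      _ ≤ _ := by
        refine mul_le_mul_left ?_ _
        rw [ENNReal.coe_add, ENNReal.coe_toNNReal hX]
        exact le_self_add
  refine ⟨lt_of_le_of_lt hle ?_, hle⟩
  exact ENNReal.mul_lt_top (ENNReal.mul_lt_top ENNReal.coe_lt_top hσ) hf
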